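/- Let $G$ be a locally compact (Hausdorff) group with identity $e$ and left Haar measure $dx$, and let $\omega:G\to[1,\infty)$ be a weight, i.e. a continuous function with $\omega(xy)\le\omega(x)\omega(y)$ for all $x,y\in G$ and $\omega(e)=1$. Let $L^1(G,\omega)$ be the Banach algebra of (classes of) functions $f$ with $\|f\|_\omega=\int_G|f(x)|\,\omega(x)\,dx<\infty$, under convolution. On $G$, $G\times G$ and $G\times G\times G$, "almost everywhere" means outside a locally Haar-null set. A Banach algebra $A$ is called cyclically amenable if the continuous derivations $D:A\to A^*$ with $\langle D(a),b\rangle+\langle D(b),a\rangle=0$ for all $a,b\in A$ are exactly the inner derivations $a\mapsto F\cdot a-a\cdot F$ $(F\in A^*)$, where $\langle F\cdot a,b\rangle=F(ab)$ and $\langle a\cdot F,b\rangle=F(ba)$. A Borel function $q:G\times G\to\mathbb C$ is called quasi-additive if $q(xy,z)=q(x,yz)+q(y,zx)$ for almost every $(x,y,z)\in G^3$. It is called inner if there is a Borel function $h:G\to\mathbb C$ with $h/\omega$ essentially bounded such that $q(x,y)=h(xy)-h(yx)$ for almost every $(x,y)\in G^2$. Let $CD(G,\omega)$ be the set of all quasi-additive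 functions $q$ with $q(x,y)+q(y,x)=0$ for almost every $(x,y)$ and $$\sup_{x,y\in G}\frac{|q(x,y)|}{\omega(x)\,\omega(y)}<\infty .$$ Then $L^1(G,\omega)$ is cyclically amenable if and only if every element of $CD(G,\omega)$ is inner. Moreover, if a Borel function $q:G\times G\to\mathbb C$ satisfies $q(xy,z)=q(x,yz)+q(y,zx)$ for all $x,y,z\in G$, then $q(x,e)=0$ for almost every $x$ if and only if $q(x,y)+q(y,x)=0$ for almost every $(x,y)$. -/

import Mathlib

open MeasureTheory Measure Topology
open scoped ENNReal NNReal

noncomputable section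

/-- A weight function on a topological group: a continuous function `ω : G → [1, ∞)` with
`ω (x y) ≤ ω x * ω y` and `ω e = 1`. -/
structure Weight (G : Type*) [Group G] [TopologicalSpace G] where
  toFun : G → ℝ
  continuous' : Continuous toFun
  one_le' : ∀ x, 1 ≤ toFun x
  mul_le' : ∀ x y, toFun (x * y) ≤ toFun x * toFun y
  map_one' : toFun 1 = 1

instance (G : Type*) [Group G] [TopologicalSpace G] : CoeFun (Weight G) (fun _ => G → ℝ) :=
  ⟨Weight.toFun⟩

namespace Weight

theorem pos {G : Type*} [Group G] [TopologicalSpace G] (ω : Weight G) (x : G) : 0 < ω x :=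
  one_pos.trans_le (ω.one_le' x)

theorem measurable_nn {G : Type*} [Group G] [TopologicalSpace G]
    [MeasurableSpace G] [BorelSpace G] (ω : Weight G) : Measurable (fun x => Real.toNNReal (ω x)) :=
  ω.continuous'.measurable.real_toNNReal

theorem measurable_ofReal {G : Type*} [Group G] [TopologicalSpace G]
    [MeasurableSpace G] [BorelSpace G] (ω : Weight G) : Measurable (fun x => ENNReal.ofReal (ω x)) :=
  ω.continuous'.measurable.ennreal_ofReal

end Weight

section WeightedAlgebra

variable {G : Type*} [Group G] [TopologicalSpace G] [IsTopologicalGroup G]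
  [LocallyCompactSpace G] [MeasurableSpace G] [BorelSpace G]

namespace Weight

/-- The measure `ω(x) dx`, where `dx` is the left Haar measure. -/
def measure (ω : Weight G) : Measure G :=
  (haar : Measure G).withDensity (fun x => ENNReal.ofReal (ω x))

theorem haar_le (ω : Weight G) : (haar : Measure G) ≤ ω.measure := by
  calc (haar : Measure G) = (haar : Measure G).withDensity 1 := withDensity_one.symm
    _ ≤ _ := withDensity_mono (Filter.Eventually.of_forall fun x => by
      simpa using ENNReal.one_le_ofReal.2 (ω.one_le' x))

theorem haar_ac (ω : Weight G) : (haar : Measure G) ≪ ω.measure :=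
  absolutelyContinuous_of_le ω.haar_le

theorem map_le (ω : Weight G) (y : G) :
    ω.measure.map (fun x => y⁻¹ * x) ≤ ENNReal.ofReal (ω y) • ω.measure := by
  refine Measure.le_iff.2 fun s hs => ?_
  have hm : Measurable (fun x : G => y⁻¹ * x) := measurable_const_mul _
  rw [map_apply hm hs, Measure.smul_apply, Weight.measure, withDensity_apply _ (hm hs),
    withDensity_apply _ hs, smul_eq_mul, ← lintegral_const_mul _ ω.measurable_ofReal,
    ← lintegral_indicator (hm hs), ← lintegral_indicator hs,
    ← lintegral_mul_left_eq_self _ y]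
  refine lintegral_mono fun x => ?_
  by_cases hx : x ∈ s
  · have : y * x ∈ (fun x => y⁻¹ * x) ⁻¹' s := by simpa using hx
    rw [Set.indicator_of_mem this, Set.indicator_of_mem hx,
      ← ENNReal.ofReal_mul (ω.pos y).le]
    exact ENNReal.ofReal_le_ofReal (ω.mul_le' y x)
  · have : y * x ∉ (fun x => y⁻¹ * x) ⁻¹' s := by simpa using hx
    rw [Set.indicator_of_notMem this]
    exact zero_le

theorem qmp (ω : Weight G) (y : G) :
    QuasiMeasurePreserving (fun x : G => y⁻¹ * x) ω.measure ω.measure :=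
  ⟨measurable_const_mul _, (absolutelyContinuous_of_le (ω.map_le y)).trans
    (Measure.smul_absolutelyContinuous)⟩

end Weight

/-- The weighted space `L¹(G, ω)`: classes of functions `f` with `‖f‖ = ∫ |f(x)| ω(x) dx < ∞`,
for the left Haar measure `dx`. -/
def WeightedL1 (ω : Weight G) : Type _ := Lp ℂ 1 ω.measure

namespace WeightedL1

variable {ω : Weight G}

instance : NormedAddCommGroup (WeightedL1 ω) :=
  inferInstanceAs (NormedAddCommGroup (Lp ℂ 1 ω.measure))

instance : NormedSpace ℂ (WeightedL1 ω) := inferInstanceAs (NormedSpace ℂ (Lp ℂ 1 ω.measure))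

instance : CompleteSpace (WeightedL1 ω) := inferInstanceAs (CompleteSpace (Lp ℂ 1 ω.measure))

instance : CoeFun (WeightedL1 ω) (fun _ => G → ℂ) :=
  ⟨fun f : Lp ℂ 1 ω.measure => (f : G → ℂ)⟩

theorem ext_ae {f g : WeightedL1 ω} (h : (f : G → ℂ) =ᵐ[ω.measure] g) : f = g := Lp.ext h

theorem coeFn_add (f g : WeightedL1 ω) :
    ((f + g : WeightedL1 ω) : G → ℂ) =ᵐ[ω.measure] fun x => f x + g x := Lp.coeFn_add f g

theorem coeFn_smul (c : ℂ) (f : WeightedL1 ω) :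
    ((c • f : WeightedL1 ω) : G → ℂ) =ᵐ[ω.measure] fun x => c * f x := Lp.coeFn_smul c f

theorem memLp (f : WeightedL1 ω) : MemLp (f : G → ℂ) 1 ω.measure := Lp.memLp f

theorem eLpNorm_translate_le (y : G) (f : WeightedL1 ω) :
    eLpNorm (fun x => f (y⁻¹ * x)) 1 ω.measure ≤
      ENNReal.ofReal (ω y) * eLpNorm (f : G → ℂ) 1 ω.measure := by
  have h1 := (f.memLp.1.mono_ac (ω.qmp y).absolutelyContinuous)
  have h2 := eLpNorm_map_measure (p := 1) h1 (measurable_const_mul y⁻¹).aemeasurable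
  calc eLpNorm (fun x => f (y⁻¹ * x)) 1 ω.measure
      = eLpNorm (f : G → ℂ) 1 (ω.measure.map (fun x => y⁻¹ * x)) := h2.symm
    _ ≤ eLpNorm (f : G → ℂ) 1 (ENNReal.ofReal (ω y) • ω.measure) :=
      eLpNorm_mono_measure _ (ω.map_le y)
    _ = _ := eLpNorm_one_smul_measure _

theorem memLp_translate (y : G) (f : WeightedL1 ω) :
    MemLp (fun x => f (y⁻¹ * x)) 1 ω.measure :=
  ⟨f.memLp.1.comp_quasiMeasurePreserving (ω.qmp y),
    (eLpNorm_translate_le y f).trans_lt (ENNReal.mul_lt_top ENNReal.ofReal_lt_top f.memLp.2)⟩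

/-- The underlying function of `translate`. -/
def translateFun (y : G) (f : WeightedL1 ω) : WeightedL1 ω := (memLp_translate y f).toLp _

theorem coeFn_translateFun (y : G) (f : WeightedL1 ω) :
    (translateFun y f : G → ℂ) =ᵐ[ω.measure] fun x => f (y⁻¹ * x) := MemLp.coeFn_toLp _

theorem norm_translateFun_le (y : G) (f : WeightedL1 ω) :
    ‖translateFun y f‖ ≤ ω y * ‖f‖ := by
  have h : ‖translateFun y f‖ = (eLpNorm (fun x => f (y⁻¹ * x)) 1 ω.measure).toReal :=
    Lp.norm_toLp _ (memLp_translate y f)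
  have h' : ‖f‖ = (eLpNorm (f : G → ℂ) 1 ω.measure).toReal := Lp.norm_def _
  rw [h, h']
  refine (ENNReal.toReal_mono (ENNReal.mul_ne_top ENNReal.ofReal_ne_top f.memLp.2.ne)
    (eLpNorm_translate_le y f)).trans_eq ?_
  rw [ENNReal.toReal_mul, ENNReal.toReal_ofReal (ω.pos y).le]

/-- Left translation by `y`, that is `(translate y f)(x) = f(y⁻¹ x)`. -/
def translate (y : G) : WeightedL1 ω →L[ℂ] WeightedL1 ω :=
  LinearMap.mkContinuous
    { toFun := translateFun y
      map_add' := fun f g => by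
        apply ext_ae
        filter_upwards [coeFn_translateFun y (f + g), coeFn_translateFun y f,
          coeFn_translateFun y g, coeFn_add (translateFun y f) (translateFun y g),
          (ω.qmp y).ae (coeFn_add f g)] with x h1 h2 h3 h4 h5
        rw [h1, h4, h2, h3, h5]
      map_smul' := fun c f => by
        apply ext_ae
        filter_upwards [coeFn_translateFun y (c • f), coeFn_translateFun y f,
          coeFn_smul c (translateFun y f), (ω.qmp y).ae (coeFn_smul c f)] with x h1 h2 h3 h4
        rw [RingHom.id_apply, h1, h3, h2, h4] }
    (ω y) (norm_translateFun_le y)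

theorem coeFn_translate (y : G) (f : WeightedL1 ω) :
    (translate y f : G → ℂ) =ᵐ[ω.measure] fun x => f (y⁻¹ * x) := coeFn_translateFun y f

theorem norm_translate_le (y : G) (f : WeightedL1 ω) : ‖translate y f‖ ≤ ω y * ‖f‖ :=
  norm_translateFun_le y f

theorem translate_mul (y z : G) (f : WeightedL1 ω) :
    translate (y * z) f = translate y (translate z f) := by
  apply ext_ae
  filter_upwards [coeFn_translate (y * z) f, coeFn_translate y (translate z f),
    (ω.qmp y).ae (coeFn_translate z f)] with x h1 h2 h3
  rw [h1, h2, h3, mul_inv_rev, mul_assoc]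

theorem tendsto_translate_one (f : WeightedL1 ω) :
    Filter.Tendsto (fun y => translate y f) (𝓝 1) (𝓝 f) := by
  let Φ := withDensitySMulLI (E := ℂ) (haar : Measure G) ω.measurable_nn
  let u : Lp ℂ 1 (haar : Measure G) := Φ f
  have hu : (u : G → ℂ) =ᵐ[haar] fun x => Real.toNNReal (ω x) • f x :=
    MemLp.coeFn_toLp (memL1_smul_of_L1_withDensity ω.measurable_nn f)
  have hmp (y : G) : MeasurePreserving (fun x : G => y⁻¹ * x) haar haar :=
    measurePreserving_mul_left _ _
  let cm (y : G) : C(G, G) := ⟨fun x => y⁻¹ * x, by fun_prop⟩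
  let T (y : G) : Lp ℂ 1 (haar : Measure G) := Lp.compMeasurePreserving (cm y) (hmp y) u
  have hT : Filter.Tendsto T (𝓝 1) (𝓝 u) := by
    have hc : Continuous cm :=
      (ContinuousMap.mk (fun p : G × G => p.1⁻¹ * p.2) (by fun_prop)).curry.continuous
    have h0 : T 1 = u := by
      apply Lp.ext
      filter_upwards [Lp.coeFn_compMeasurePreserving u (hmp 1)] with x hx
      exact hx.trans (by simp)
    have := (continuous_const (y := u)).compMeasurePreservingLp hc hmp ENNReal.one_ne_top
    have h1 : Filter.Tendsto T (𝓝 1) (𝓝 (T 1)) := this.tendsto 1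
    rwa [h0] at h1
  have key (y : G) : ‖translate y f - f‖ ≤ (ω y + ω y⁻¹ - 2) * ‖u‖ + ‖T y - u‖ := by
    have e1 : ‖translate y f - f‖ = ‖Φ (translate y f) - Φ f‖ :=
      (Φ.norm_map (translate y f - f)).symm.trans
        (congrArg norm (Φ.map_sub (translate y f) f))
    have e2 : Φ (translate y f) - Φ f = (Φ (translate y f) - T y) + (T y - u) := by
      simp [u]
    have e3 : ‖T y‖ = ‖u‖ := Lp.norm_compMeasurePreserving u (hmp y)
    rw [e1, e2, ← e3]
    refine (norm_add_le _ _).trans (add_le_add_left ?_ _)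
    refine Lp.norm_le_mul_norm_of_ae_le_mul ?_
    filter_upwards [Lp.coeFn_sub (Φ (translate y f)) (T y),
      MemLp.coeFn_toLp (memL1_smul_of_L1_withDensity ω.measurable_nn (translate y f)),
      ω.haar_ac.ae_eq (coeFn_translate y f),
      Lp.coeFn_compMeasurePreserving u (hmp y),
      (hmp y).quasiMeasurePreserving.ae hu] with x h1 h2 h3 h4 h5
    have h4' : (T y : G → ℂ) x = ((ω (y⁻¹ * x) : ℝ) : ℂ) * f (y⁻¹ * x) := by
      refine h4.trans (h5.trans ?_)
      rw [NNReal.smul_def, Real.coe_toNNReal _ (ω.pos _).le]; rfl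
    have h2' : (Φ (translate y f) : G → ℂ) x = ((ω x : ℝ) : ℂ) * f (y⁻¹ * x) := by
      refine h2.trans ?_
      rw [NNReal.smul_def, Real.coe_toNNReal _ (ω.pos _).le]
      exact congrArg (fun z : ℂ => ((ω x : ℝ) : ℂ) * z) h3
    rw [h1, Pi.sub_apply, h2', h4', ← sub_mul, norm_mul, norm_mul, ← mul_assoc,
      ← Complex.ofReal_sub, Complex.norm_real, Complex.norm_real]
    refine mul_le_mul_of_nonneg_right ?_ (norm_nonneg _)
    rw [Real.norm_eq_abs, Real.norm_eq_abs, abs_of_pos (ω.pos _)]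
    have a1 := ω.mul_le' y (y⁻¹ * x)
    have a2 := ω.mul_le' y⁻¹ x
    rw [mul_inv_cancel_left] at a1
    have a3 := ω.one_le' y
    have a4 := ω.one_le' y⁻¹
    have a5 := ω.pos (y⁻¹ * x)
    have a6 := ω.pos x
    rw [abs_le]
    constructor
    · by_cases h : ω (y⁻¹ * x) ≤ ω x
      · nlinarith
      · nlinarith
    · nlinarith
  rw [tendsto_iff_norm_sub_tendsto_zero]
  refine squeeze_zero (fun _ => norm_nonneg _) key ?_
  have l1 : Filter.Tendsto (fun y : G => (ω y + ω y⁻¹ - 2) * ‖u‖) (𝓝 1) (𝓝 0) := by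
    have hc : Continuous (fun y : G => (ω y + ω y⁻¹ - 2) * ‖u‖) := by
      have := ω.continuous'
      fun_prop
    have := hc.tendsto 1
    simp only [inv_one, ω.map_one'] at this
    convert this using 2
    norm_num
  have l2 := tendsto_iff_norm_sub_tendsto_zero.1 hT
  simpa using l1.add l2

theorem continuous_translate (f : WeightedL1 ω) : Continuous (fun y : G => translate y f) := by
  rw [continuous_iff_continuousAt]
  intro y
  have h1 : Filter.Tendsto (fun z : G => y⁻¹ * z) (𝓝 y) (𝓝 1) := by
    have : Continuous (fun z : G => y⁻¹ * z) := by fun_prop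
    simpa using this.tendsto y
  have h2 := ((translate (ω := ω) y).continuous.tendsto f).comp
    ((tendsto_translate_one f).comp h1)
  refine h2.congr fun z => ?_
  simp only [Function.comp_apply]
  rw [← translate_mul, mul_inv_cancel_left]

theorem integrable (f : WeightedL1 ω) : Integrable (f : G → ℂ) haar :=
  (memLp_one_iff_integrable.1 f.memLp).mono_measure ω.haar_le

theorem integrable_weight (f : WeightedL1 ω) : Integrable (fun y => ω y * ‖f y‖) haar := by
  have h : Integrable (fun y => ‖f y‖) ω.measure := (memLp_one_iff_integrable.1 f.memLp).norm
  have h' := (integrable_withDensity_iff_integrable_smul ω.measurable_nn).1 h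
  refine h'.congr (Filter.Eventually.of_forall fun y => ?_)
  simp only [NNReal.smul_def, Real.coe_toNNReal _ (ω.pos y).le, smul_eq_mul]

theorem norm_eq (f : WeightedL1 ω) : ‖f‖ = ∫ y, ω y * ‖f y‖ ∂haar := by
  have h : ‖f‖ = ∫ y, ‖f y‖ ∂ω.measure := L1.norm_eq_integral_norm _
  have h2 : ∫ y, ‖f y‖ ∂ω.measure = ∫ y, Real.toNNReal (ω y) • ‖f y‖ ∂haar :=
    integral_withDensity_eq_integral_smul ω.measurable_nn _
  rw [h, h2]
  refine integral_congr_ae (Filter.Eventually.of_forall fun y => ?_)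
  simp only [NNReal.smul_def, Real.coe_toNNReal _ (ω.pos y).le, smul_eq_mul]

theorem aestronglyMeasurable_translate_restrict (g : WeightedL1 ω) {s : Set G}
    (hs : MeasurableSet s) (hμ : (haar : Measure G) s ≠ ∞) :
    AEStronglyMeasurable (fun y => translate y g) ((haar : Measure G).restrict s) := by
  choose K hKs hKc hKcl hK using fun n : ℕ =>
    hs.exists_isCompact_isClosed_sdiff_lt hμ (ε := (n : ℝ≥0∞)⁻¹)
      (ENNReal.inv_ne_zero.2 (ENNReal.natCast_ne_top n))
  have hsub : (⋃ n, K n) ⊆ s := Set.iUnion_subset hKs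
  have h0 : (haar : Measure G) (s \ ⋃ n, K n) = 0 := by
    refine le_antisymm (ge_of_tendsto' ENNReal.tendsto_inv_nat_nhds_zero fun n => ?_) zero_le
    exact (measure_mono (Set.sdiff_subset_sdiff_right (Set.subset_iUnion K n))).trans (hK n).le
  have hae : s =ᵐ[haar] ⋃ n, K n :=
    (ae_le_set.2 h0).antisymm hsub.eventuallyLE
  rw [restrict_congr_set hae, aestronglyMeasurable_iUnion_iff]
  exact fun n => (continuous_translate g).continuousOn.aestronglyMeasurable_of_isCompact
    (hKc n) (hKcl n).measurableSet

theorem integrable_smul_translate (f g : WeightedL1 ω) :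
    Integrable (fun y => f y • translate y g) haar := by
  have hm : AEStronglyMeasurable (fun y => f y • translate y g) (haar : Measure G) := by
    have hf : StronglyMeasurable (f : G → ℂ) :=
      Lp.stronglyMeasurable (show Lp ℂ 1 ω.measure from f)
    have hs : (Function.support (f : G → ℂ)) = ⋃ n : ℕ, {y | 1 / ((n : ℝ) + 1) ≤ ‖f y‖} := by
      ext y
      simp only [Function.mem_support, Set.mem_iUnion, Set.mem_ofPred_eq]
      constructor
      · intro hy
        obtain ⟨n, hn⟩ := exists_nat_one_div_lt (norm_pos_iff.2 hy)
        exact ⟨n, hn.le⟩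
      · rintro ⟨n, hn⟩ h0
        rw [h0, norm_zero] at hn
        have : (0 : ℝ) < 1 / ((n : ℝ) + 1) := by positivity
        linarith
    have hsm : MeasurableSet (Function.support (f : G → ℂ)) :=
      (hf.measurable (measurableSet_singleton 0)).compl
    have h1 : (Function.support (f : G → ℂ)).indicator (fun y => f y • translate y g)
        = fun y => f y • translate y g := by
      refine Set.indicator_eq_self.2 fun y hy hy' => hy ?_
      simp only [hy', zero_smul]
    rw [← h1, aestronglyMeasurable_indicator_iff hsm]
    refine hf.aestronglyMeasurable.smul ?_
    rw [hs, aestronglyMeasurable_iUnion_iff]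
    exact fun n => aestronglyMeasurable_translate_restrict g
      (measurableSet_le measurable_const hf.norm.measurable)
      (f.integrable.measure_norm_ge_lt_top (by positivity)).ne
  refine (f.integrable_weight.mul_const ‖g‖).mono' hm (Filter.Eventually.of_forall fun y => ?_)
  rw [norm_smul]
  nlinarith [norm_translate_le y g, norm_nonneg (f y)]

/-- The convolution product of `L¹(G, ω)`, as the Bochner integral `f * g = ∫ f(y) (L_y g) dy`
of the left translates `(L_y g)(x) = g(y⁻¹ x)`; in other words
`(f * g)(x) = ∫ f(y) g(y⁻¹ x) dy` for almost every `x`. -/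
instance : Mul (WeightedL1 ω) := ⟨fun f g => ∫ y, f y • translate y g ∂haar⟩

theorem mul_def (f g : WeightedL1 ω) : f * g = ∫ y, f y • translate y g ∂haar := rfl

theorem norm_mul_le' (f g : WeightedL1 ω) : ‖f * g‖ ≤ ‖f‖ * ‖g‖ := by
  rw [mul_def, norm_eq f, ← integral_mul_const]
  refine norm_integral_le_of_norm_le (f.integrable_weight.mul_const ‖g‖)
    (Filter.Eventually.of_forall fun y => ?_)
  rw [norm_smul]
  nlinarith [norm_translate_le y g, norm_nonneg (f y)]

theorem add_mul' (f g k : WeightedL1 ω) : (f + g) * k = f * k + g * k := by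
  rw [mul_def, mul_def, mul_def,
    ← integral_add (integrable_smul_translate f k) (integrable_smul_translate g k)]
  refine integral_congr_ae ?_
  filter_upwards [ω.haar_ac.ae_eq (coeFn_add f g)] with y hy
  rw [hy, add_smul]

theorem mul_add' (f g k : WeightedL1 ω) : f * (g + k) = f * g + f * k := by
  rw [mul_def, mul_def, mul_def,
    ← integral_add (integrable_smul_translate f g) (integrable_smul_translate f k)]
  simp only [map_add, smul_add]

theorem smul_mul' (c : ℂ) (f g : WeightedL1 ω) : (c • f) * g = c • (f * g) := by
  rw [mul_def, mul_def, ← integral_smul]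
  refine integral_congr_ae ?_
  filter_upwards [ω.haar_ac.ae_eq (coeFn_smul c f)] with y hy
  rw [hy, mul_smul]

theorem mul_smul' (c : ℂ) (f g : WeightedL1 ω) : f * (c • g) = c • (f * g) := by
  rw [mul_def, mul_def, ← integral_smul]
  simp only [map_smul, smul_comm c]

/-- Right multiplication by `k` as a continuous linear map. -/
def mulRightCLM (k : WeightedL1 ω) : WeightedL1 ω →L[ℂ] WeightedL1 ω :=
  LinearMap.mkContinuous
    { toFun := fun f => f * k
      map_add' := fun f g => add_mul' f g k
      map_smul' := fun c f => smul_mul' c f k }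
    ‖k‖ (fun f => (norm_mul_le' f k).trans_eq (mul_comm _ _))

theorem translate_mul_eq (y : G) (g k : WeightedL1 ω) :
    translate y g * k = translate y (g * k) := by
  rw [mul_def, mul_def, ← ContinuousLinearMap.integral_comp_comm _ (integrable_smul_translate g k)]
  have h : ∫ x, translate y g x • translate x k ∂(haar : Measure G)
      = ∫ x, g (y⁻¹ * x) • translate x k ∂haar := by
    refine integral_congr_ae ?_
    filter_upwards [ω.haar_ac.ae_eq (coeFn_translate y g)] with x hx
    rw [hx]
  rw [h, ← integral_mul_left_eq_self _ y]
  simp only [inv_mul_cancel_left, map_smul, translate_mul]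

theorem mul_assoc' (f g k : WeightedL1 ω) : f * g * k = f * (g * k) := by
  have h := ContinuousLinearMap.integral_comp_comm (mulRightCLM k) (integrable_smul_translate f g)
  calc f * g * k = mulRightCLM k (∫ y, f y • translate y g ∂haar) := rfl
    _ = ∫ y, mulRightCLM k (f y • translate y g) ∂haar := h.symm
    _ = ∫ y, f y • translate y (g * k) ∂haar := by
      refine integral_congr_ae (Filter.Eventually.of_forall fun y => ?_)
      simp only [map_smul]
      exact congrArg (fun z => f y • z) (translate_mul_eq y g k)
    _ = f * (g * k) := rfl

/-- `L¹(G, ω)` is a Banach algebra under convolution. -/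
instance : NonUnitalNormedRing (WeightedL1 ω) :=
  { (inferInstance : NormedAddCommGroup (WeightedL1 ω)) with
    mul := fun f g => f * g
    left_distrib := mul_add'
    right_distrib := add_mul'
    zero_mul := fun f => (mulRightCLM f).map_zero
    mul_zero := fun f => by
      have := mul_smul' (0 : ℂ) f 0
      rwa [zero_smul, zero_smul] at this
    mul_assoc := mul_assoc'
    norm_mul_le := norm_mul_le' }

instance : IsScalarTower ℂ (WeightedL1 ω) (WeightedL1 ω) := ⟨smul_mul'⟩

instance : SMulCommClass ℂ (WeightedL1 ω) (WeightedL1 ω) :=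
  ⟨fun c f g => (mul_smul' c f g).symm⟩

end WeightedL1

end WeightedAlgebra

section CyclicAmenability

variable {A : Type*} [NonUnitalNormedRing A] [NormedSpace ℂ A]

/-- `D : A → A*` is a derivation: `D(ab) = D(a)·b + a·D(b)`, where the module actions on `A*` are
`⟨F·a, b⟩ = ⟨F, ab⟩` and `⟨a·F, b⟩ = ⟨F, ba⟩`. -/
def IsDualDerivation (D : A →L[ℂ] StrongDual ℂ A) : Prop :=
  ∀ a b c : A, D (a * b) c = D a (b * c) + D b (c * a)

/-- `D : A → A*` is inner: `D(a) = F·a - a·F` for some `F ∈ A*`. -/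
def IsInnerDerivation (D : A →L[ℂ] StrongDual ℂ A) : Prop :=
  ∃ F : StrongDual ℂ A, ∀ a b : A, D a b = F (a * b) - F (b * a)

/-- `D : A → A*` is cyclic: `⟨D(a), b⟩ + ⟨D(b), a⟩ = 0`. -/
def IsCyclicMap (D : A →L[ℂ] StrongDual ℂ A) : Prop :=
  ∀ a b : A, D a b + D b a = 0

/-- A Banach algebra `A` is cyclically amenable if the continuous cyclic derivations `A → A*`
are exactly the inner derivations. -/
def CyclicallyAmenable (A : Type*) [NonUnitalNormedRing A] [NormedSpace ℂ A]
    [IsScalarTower ℂ A A] [SMulCommClass ℂ A A] [CompleteSpace A] : Prop :=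
  {D : A →L[ℂ] StrongDual ℂ A | IsDualDerivation D ∧ IsCyclicMap D} =
    {D : A →L[ℂ] StrongDual ℂ A | IsInnerDerivation D}

end CyclicAmenability

section QuasiAdditive

/-- `p x` holds for almost every `x` with respect to Haar measure on the locally compact group `H`
(with its Borel σ-algebra): the exceptional set is locally null, i.e. meets every compact set in a
null set. When `H` is σ-compact this is the same as being null; in general it is the usual
convention for `L^∞` on a locally compact group. -/
def HaarAE (H : Type*) [Group H] [TopologicalSpace H] [IsTopologicalGroup H]
    [LocallyCompactSpace H] (p : H → Prop) : Prop :=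
  letI : MeasurableSpace H := borel H
  haveI : BorelSpace H := ⟨rfl⟩
  ∀ K : Set H, IsCompact K → (haar : Measure H) ({x | ¬ p x} ∩ K) = 0

/-- `f : X → ℂ` is Borel measurable, for the Borel σ-algebra of the topology of `X`. (On `X = G × G`
this is the Borel σ-algebra of the product topology, also if `G` is not second countable.) -/
def IsBorel {X : Type*} [TopologicalSpace X] (f : X → ℂ) : Prop :=
  @Measurable X ℂ (borel X) (borel ℂ) f

variable {G : Type*} [Group G] [TopologicalSpace G] [IsTopologicalGroup G]
  [LocallyCompactSpace G]

/-- Quasi-additive functions: Borel functions `q` on `G × G` with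
`q(xy, z) = q(x, yz) + q(y, zx)` for almost every `(x, y, z)`. -/
def IsQuasiAdditive (q : G × G → ℂ) : Prop :=
  IsBorel q ∧ HaarAE (G × G × G) fun t =>
    q (t.1 * t.2.1, t.2.2) = q (t.1, t.2.1 * t.2.2) + q (t.2.1, t.2.2 * t.1)

/-- The space `L^∞(G, 1/ω)` of Borel functions `h` such that `h / ω` is essentially bounded. -/
def WeightedLInfty (ω : Weight G) : Set (G → ℂ) :=
  {h | IsBorel h ∧ ∃ C : ℝ, HaarAE G fun x => ‖h x‖ / ω x ≤ C}

/-- `q` is inner: there is `h ∈ L^∞(G, 1/ω)` with `q(x, y) = h(xy) - h(yx)` almost everywhere. -/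
def IsInnerFunction (ω : Weight G) (q : G × G → ℂ) : Prop :=
  ∃ h ∈ WeightedLInfty ω, HaarAE (G × G) fun t => q t = h (t.1 * t.2) - h (t.2 * t.1)

/-- The set `CD(G, ω)` of the quasi-additive functions `q` on `G × G` which are antisymmetric
almost everywhere and satisfy `sup |q(x, y)| / (ω(x) ω(y)) < ∞`.

For functions which satisfy the quasi-additivity identity everywhere, antisymmetry is the condition
`q(x, e) = 0`, because `q(xy, e) = q(x, y) + q(y, x)`. For functions defined up to null sets the
condition has to be put in the antisymmetric form, since `G × {e}` is a null set whenever `G` is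
not discrete. -/
def CD (ω : Weight G) : Set (G × G → ℂ) :=
  {q | IsQuasiAdditive q ∧ (HaarAE (G × G) fun t => q (t.1, t.2) + q (t.2, t.1) = 0) ∧
    BddAbove (Set.range fun t : G × G => ‖q t‖ / (ω t.1 * ω t.2))}

end QuasiAdditive

end

open scoped CompactlySupported

set_option linter.unusedSectionVars false

noncomputable section

/-! The dual of `L¹(G, ω)` is `L^∞(G, 1/ω)`, and every bounded bilinear form on `L¹(G, ω)` comes
from a functional on `L¹(G × G, ω ⊗ ω)`, hence from a Borel function `q` with `q / (ω ⊗ ω)` bounded.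
So the continuous maps `D : L¹(G, ω) → L¹(G, ω)*` are exactly the maps `toDual (pairing hq)`
(`exists_toDual_pairing_eq`). Under this correspondence `D` is a derivation iff `q` is
quasi-additive (`isDualDerivation_toDual_iff`), cyclic iff `q` is antisymmetric
(`isCyclicMap_toDual_iff`), and inner iff `q` is inner (`isInnerDerivation_toDual_iff`). As inner
derivations are always cyclic, the equivalence follows.

For the last claim, `z = e` in the identity gives `q(xy, e) = q(x, y) + q(y, x)`. It remains to see
that `N` is locally null in `G` iff `{(x, y) | xy ∈ N}` is locally null in `G × G`
(`haarAE_comp_mul_iff`).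

The work lies in the generality: `G` need be neither σ-compact nor second countable, so the Borel
σ-algebra of `G × G` may exceed the product σ-algebra, and Fubini is not at hand for a Borel `q`.
Iterated integrals are therefore used for `C_c` functions only. An identity between integrals of
`C_c` functions passes to Borel functions by regularity
(`integral_comp_mul_eq_of_forall_compactlySupported`). An identity between functionals is checked on
the tensors `φ ⊗ ψ` (`clm_ext_tensor`). The dual of `L¹(G, ω)` is found by gluing along the cosets
of an open σ-compact subgroup (`exists_pairing_eq`), and bilinear forms are represented by smoothing
with an approximate identity and taking a weak-* limit (`exists_clm_tmul_eq`). -/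

theorem haarAE_iff {H : Type*} [Group H] [TopologicalSpace H] [IsTopologicalGroup H]
    [LocallyCompactSpace H] [m : MeasurableSpace H] [b : BorelSpace H] {p : H → Prop} :
    HaarAE H p ↔ ∀ K : Set H, IsCompact K → (haar : Measure H) ({x | ¬ p x} ∩ K) = 0 := by
  obtain rfl : m = borel H := b.measurable_eq
  rfl

theorem isBorel_iff {X : Type*} [TopologicalSpace X] [m : MeasurableSpace X] [b : BorelSpace X]
    {f : X → ℂ} : IsBorel f ↔ Measurable f := by
  obtain rfl : m = borel X := b.measurable_eq
  rw [IsBorel, ← BorelSpace.measurable_eq (α := ℂ)]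

/-! ### Regular measures and density of `C_c` -/

namespace MeasureTheory.Measure.InnerRegularCompactLTTop

variable {X : Type*} [TopologicalSpace X] [MeasurableSpace X]

/-- Needed for the finite measures `|F| m` with `F` integrable, where `m` need not be σ-finite. An
integrable density lives on the sets `{f ≥ 1/(n+1)}`, which have finite `m`-measure, and there
regularity of `m` combines with absolute continuity of the integral. -/
theorem withDensity [BorelSpace X] [T2Space X] {m : Measure X}
    [InnerRegularCompactLTTop m] {f : X → ℝ≥0∞}
    (hf : AEMeasurable f m) (hfi : ∫⁻ x, f x ∂m ≠ ∞) :
    InnerRegularCompactLTTop (m.withDensity f) := by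
  wlog hfm : Measurable f generalizing f
  · rw [withDensity_congr_ae hf.ae_eq_mk]
    exact this hf.measurable_mk.aemeasurable (by rwa [← lintegral_congr_ae hf.ae_eq_mk])
      hf.measurable_mk
  refine ⟨fun E ⟨hE, hE'⟩ r hr => ?_⟩
  -- `E` may have infinite `m`-measure, but each `S n` has finite `m`-measure by Markov's
  -- inequality. The `S n` exhaust `E` up to the zeros of `f`, which carry no mass of `m.withDensity
  -- f`.
  let S (n : ℕ) : Set X := E ∩ {x | ((n : ℝ≥0∞) + 1)⁻¹ ≤ f x}
  have hSm (n : ℕ) : MeasurableSet (S n) := hE.inter (measurableSet_le measurable_const hfm)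
  have hmono : Monotone S := by
    intro i j hij x hx
    refine ⟨hx.1, le_trans (ENNReal.inv_le_inv.2 ?_) hx.2⟩
    gcongr
  have hU : m.withDensity f (⋃ n, S n) = m.withDensity f E := by
    rw [withDensity_apply _ (MeasurableSet.iUnion hSm), withDensity_apply _ hE,
      ← lintegral_indicator (MeasurableSet.iUnion hSm), ← lintegral_indicator hE]
    congr 1
    ext x
    by_cases hx : x ∈ ⋃ n, S n
    · have hxE : x ∈ E := by
        obtain ⟨n, hn⟩ := Set.mem_iUnion.1 hx
        exact hn.1
      simp [hx, hxE]
    · by_cases hxE : x ∈ E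
      · rw [Set.indicator_of_notMem hx, Set.indicator_of_mem hxE]
        by_contra h0
        apply hx
        obtain ⟨n, hn⟩ := ENNReal.exists_inv_nat_lt (Ne.symm h0)
        refine Set.mem_iUnion.2 ⟨n, hxE, le_trans (ENNReal.inv_le_inv.2 ?_) hn.le⟩
        simp
      · simp [hx, hxE]
  rw [← hU, hmono.measure_iUnion] at hr
  obtain ⟨n, hn⟩ := lt_iSup_iff.1 hr
  have hSfin : m (S n) ≠ ∞ := by
    refine ne_top_of_le_ne_top (b := m {x | ((n : ℝ≥0∞) + 1)⁻¹ ≤ f x}) ?_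
      (measure_mono Set.inter_subset_right)
    refine ne_top_of_le_ne_top ?_ (meas_ge_le_lintegral_div hfm.aemeasurable
      (by simp) (by simp))
    exact ENNReal.div_ne_top hfi (by simp)
  have hpos : m.withDensity f (S n) - r ≠ 0 := (tsub_pos_of_lt hn).ne'
  -- Removing a set of `m`-measure below `δ` costs less than the margin between the mass of `S n`
  -- and `r`.
  obtain ⟨δ, hδ, hδ'⟩ := exists_pos_setLIntegral_lt_of_measure_lt hfi hpos
  obtain ⟨K, hKS, hK, hKcl, hKδ⟩ := (hSm n).exists_isCompact_isClosed_sdiff_lt hSfin hδ.ne'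
  refine ⟨K, hKS.trans Set.inter_subset_left, hK, ?_⟩
  have h1 := hδ' _ hKδ
  rw [← withDensity_apply _ ((hSm n).diff hKcl.measurableSet)] at h1
  by_contra! hle
  have h2 : m.withDensity f (S n) ≤ m.withDensity f (S n \ K) + r := by
    calc m.withDensity f (S n) ≤ m.withDensity f (S n \ K ∪ K) :=
          measure_mono (by rw [Set.sdiff_union_self]; exact Set.subset_union_left)
      _ ≤ _ := (measure_union_le _ _).trans (by gcongr)
  have h3 : m.withDensity f (S n) - r ≤ m.withDensity f (S n \ K) := tsub_le_iff_right.2 h2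
  exact absurd h1 (not_lt.2 h3)

theorem add_of_isFiniteMeasure {μ ν : Measure X} [IsFiniteMeasure μ] [IsFiniteMeasure ν]
    [InnerRegularCompactLTTop μ] [InnerRegularCompactLTTop ν] :
    InnerRegularCompactLTTop (μ + ν) := by
  refine ⟨fun E ⟨hE, _⟩ r hr => ?_⟩
  rw [Measure.add_apply] at hr
  by_cases h1 : μ E = 0
  · rw [h1, zero_add] at hr
    obtain ⟨K, hKE, hK, h⟩ := hE.exists_lt_isCompact_of_ne_top (measure_ne_top ν E) hr
    exact ⟨K, hKE, hK, h.trans_le (by simp)⟩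
  by_cases h2 : ν E = 0
  · rw [h2, add_zero] at hr
    obtain ⟨K, hKE, hK, h⟩ := hE.exists_lt_isCompact_of_ne_top (measure_ne_top μ E) hr
    exact ⟨K, hKE, hK, h.trans_le (by simp)⟩
  obtain ⟨a, b, ha, hb, hab⟩ : ∃ a b, a < μ E ∧ b < ν E ∧ r < a + b := by
    obtain ⟨a, ha, b, hb, h⟩ := ENNReal.exists_lt_add_of_lt_add hr h1 h2
    exact ⟨a, b, ha, hb, h⟩
  obtain ⟨K, hKE, hK, h⟩ := hE.exists_lt_isCompact_of_ne_top (measure_ne_top μ E) ha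
  obtain ⟨L, hLE, hL, h'⟩ := hE.exists_lt_isCompact_of_ne_top (measure_ne_top ν E) hb
  refine ⟨K ∪ L, Set.union_subset hKE hLE, hK.union hL, hab.trans_le ?_⟩
  rw [Measure.add_apply]
  exact add_le_add (h.le.trans (measure_mono Set.subset_union_left))
    (h'.le.trans (measure_mono Set.subset_union_right))

end MeasureTheory.Measure.InnerRegularCompactLTTop

/-- Density of `C_c` in `Lᵖ`, on locally compact spaces which need not be normal. -/
theorem MeasureTheory.MemLp.exists_compactlySupported_eLpNorm_sub_le {X : Type*}
    [TopologicalSpace X] [T2Space X] [LocallyCompactSpace X] [MeasurableSpace X] [BorelSpace X]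
    {μ : Measure X} [InnerRegularCompactLTTop μ] [IsFiniteMeasureOnCompacts μ] {p : ℝ≥0∞}
    (hp : p ≠ ∞) {f : X → ℂ} (hf : MemLp f p μ) {ε : ℝ≥0∞} (hε : ε ≠ 0) :
    ∃ g : C_c(X, ℂ), eLpNorm (f - ⇑g) p μ ≤ ε := by
  suffices H : ∃ g : X → ℂ, eLpNorm (f - g) p μ ≤ ε ∧
      (Continuous g ∧ HasCompactSupport g) by
    obtain ⟨g, h1, h2, h3⟩ := H
    exact ⟨⟨⟨g, h2⟩, h3⟩, h1⟩
  refine hf.induction_dense hp (fun g => Continuous g ∧ HasCompactSupport g) ?_ ?_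
    (fun g hg => hg.1.measurable.aestronglyMeasurable) hε
  rotate_left
  · rintro f g ⟨hf, hf'⟩ ⟨hg, hg'⟩
    exact ⟨hf.add hg, HasCompactSupport.add hf' hg'⟩
  intro c t ht htμ ε hε
  obtain ⟨δ, δpos, hδ⟩ := exists_Lp_half ℂ μ p hε
  obtain ⟨η, ηpos, hη⟩ :
      ∃ η : ℝ≥0, 0 < η ∧ ∀ s : Set X, μ s ≤ η → eLpNorm (s.indicator fun _x => c) p μ ≤ δ :=
    exists_eLpNorm_indicator_le hp c δpos.ne'
  have hη' : (η : ℝ≥0∞) ≠ 0 := by exact_mod_cast ηpos.ne'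
  obtain ⟨K, hKt, hK, hKcl, hKη⟩ := ht.exists_isCompact_isClosed_sdiff_lt htμ.ne hη'
  -- Outer approximation is applied only to the compact `K`, not to `t`. A Urysohn function between
  -- `K` and `U` then differs from `1_K` only on `U \ K`.
  obtain ⟨U, hKU, hU, hUη⟩ := hK.exists_isOpen_lt_add (μ := μ) hη'
  obtain ⟨g, hg1, hg2, hg3, hg4⟩ := exists_continuousMap_one_of_isCompact_subset_isOpen hK hU hKU
  have hUK : μ (U \ K) ≤ η := (measure_sdiff_lt_of_lt_add hKcl.measurableSet.nullMeasurableSet hKU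
    hK.measure_lt_top.ne hUη).le
  refine ⟨fun x => (g x : ℂ) * c, ?_, by fun_prop, ?_⟩
  · have e : (fun x => (g x : ℂ) * c) - t.indicator (fun _ => c) =
        ((fun x => (g x : ℂ) * c) - K.indicator (fun _ => c)) +
          (K.indicator (fun _ => c) - t.indicator (fun _ => c)) := by abel
    rw [e]
    refine (hδ _ _ ?_ ?_ ((eLpNorm_mono fun x => ?_).trans (hη _ hUK)) ?_).le
    · exact ((by fun_prop : Continuous fun x => (g x : ℂ) * c).measurable.sub
        (measurable_const.indicator hKcl.measurableSet)).aestronglyMeasurable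
    · exact ((measurable_const.indicator hKcl.measurableSet).sub
        (measurable_const.indicator ht)).aestronglyMeasurable
    · by_cases hx : x ∈ K
      · have : g x = 1 := hg1 hx
        simp [hx, this]
      · by_cases hxU : x ∈ U
        · have h4 := hg4 x
          simp only [Pi.sub_apply, Set.indicator_of_notMem hx, sub_zero,
            Set.indicator_of_mem (show x ∈ U \ K from ⟨hxU, hx⟩), norm_mul, Complex.norm_real,
            Real.norm_eq_abs, abs_of_nonneg h4.1]
          exact mul_le_of_le_one_left (norm_nonneg _) h4.2
        · have : g x = 0 := by
            by_contra h0
            exact hxU (hg3 (subset_tsupport _ h0))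
          simp [hx, this]
    · rw [← eLpNorm_neg, neg_sub, ← Set.indicator_sdiff hKt]
      exact hη _ hKη.le
  · have h1 : HasCompactSupport g := hg2
    exact (h1.comp_left (g := fun r : ℝ => (r : ℂ)) (by simp)).mul_right

theorem integrable_withDensity_enorm_iff {X : Type*} [MeasurableSpace X] {m : Measure X}
    {F q : X → ℂ} (hF : AEStronglyMeasurable F m) (hq : AEStronglyMeasurable q (m.withDensity fun x => ‖F x‖ₑ)) :
    Integrable q (m.withDensity fun x => ‖F x‖ₑ) ↔ ∫⁻ x, ‖q x * F x‖ₑ ∂m ≠ ∞ := by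
  rw [Integrable, and_iff_right hq, HasFiniteIntegral, lintegral_withDensity_eq_lintegral_mul₀']
  · rw [lt_top_iff_ne_top]
    simp only [Pi.mul_apply, enorm_mul, mul_comm]
  · exact hF.enorm
  · exact hq.enorm

/-- If the complex measures `θ_*(F m)` and `u n` agree on continuous functions with compact support,
then they agree on Borel functions. -/
theorem integral_comp_mul_eq_of_forall_compactlySupported
    {X Y : Type*} [TopologicalSpace X] [MeasurableSpace X] [BorelSpace X] [T2Space X]
    [TopologicalSpace Y] [MeasurableSpace Y] [BorelSpace Y] [T2Space Y] [LocallyCompactSpace Y]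
    {m : Measure X} [InnerRegularCompactLTTop m] {n : Measure Y} [InnerRegularCompactLTTop n]
    {θ : X → Y} (hθ : Continuous θ) {F : X → ℂ} {u : Y → ℂ} (hF : Integrable F m)
    (hu : Integrable u n)
    (h : ∀ φ : C_c(Y, ℂ), ∫ x, φ (θ x) * F x ∂m = ∫ y, φ y * u y ∂n)
    {q : Y → ℂ} (hq : Measurable q) (hqF : Integrable (fun x => q (θ x) * F x) m)
    (hqu : Integrable (fun y => q y * u y) n) :
    ∫ x, q (θ x) * F x ∂m = ∫ y, q y * u y ∂n := by
  let m' := m.withDensity fun x => ‖F x‖ₑ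
  let n' := n.withDensity fun x => ‖u x‖ₑ
  have : IsFiniteMeasure m' := isFiniteMeasure_withDensity hF.2.ne
  have : IsFiniteMeasure n' := isFiniteMeasure_withDensity hu.2.ne
  have : InnerRegularCompactLTTop m' :=
    InnerRegularCompactLTTop.withDensity hF.1.enorm hF.2.ne
  have : InnerRegularCompactLTTop n' :=
    InnerRegularCompactLTTop.withDensity hu.1.enorm hu.2.ne
  have : InnerRegularCompactLTTop (m'.map θ) := InnerRegularCompactLTTop.map_of_continuous hθ
  -- Both sides of the claim are continuous in `q` for the norm of `L¹(ρ)`, so density of `C_c` in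
  -- that space gives the result.
  let ρ := m'.map θ + n'
  have : InnerRegularCompactLTTop ρ := InnerRegularCompactLTTop.add_of_isFiniteMeasure
  have key1 (g : Y → ℂ) (hg : Measurable g) :
      ∫⁻ x, ‖g (θ x) * F x‖ₑ ∂m ≤ ∫⁻ y, ‖g y‖ₑ ∂ρ := by
    have e : ∫⁻ x, ‖g (θ x)‖ₑ ∂m' = ∫⁻ x, ‖F x‖ₑ * ‖g (θ x)‖ₑ ∂m :=
      lintegral_withDensity_eq_lintegral_mul₀ hF.1.enorm
        (hg.comp hθ.measurable).enorm.aemeasurable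
    rw [lintegral_add_measure, lintegral_map hg.enorm hθ.measurable, e]
    refine le_add_right (le_of_eq ?_)
    simp only [enorm_mul, mul_comm]
  have key2 (g : Y → ℂ) (hg : Measurable g) :
      ∫⁻ y, ‖g y * u y‖ₑ ∂n ≤ ∫⁻ y, ‖g y‖ₑ ∂ρ := by
    rw [lintegral_add_measure, lintegral_withDensity_eq_lintegral_mul₀ hu.1.enorm
        hg.enorm.aemeasurable]
    refine le_add_left (le_of_eq ?_)
    simp only [Pi.mul_apply, enorm_mul, mul_comm]
  have hqρ : Integrable q ρ := by
    refine Integrable.add_measure ?_ ?_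
    · rw [integrable_map_measure hq.aestronglyMeasurable hθ.aemeasurable,
        integrable_withDensity_enorm_iff hF.1 (hq.comp hθ.measurable).aestronglyMeasurable]
      exact hqF.2.ne
    · rw [integrable_withDensity_enorm_iff hu.1 hq.aestronglyMeasurable]
      exact hqu.2.ne
  rw [← sub_eq_zero, ← enorm_eq_zero]
  refine le_antisymm (le_of_forall_pos_le_add fun ε hε => ?_) zero_le
  obtain ⟨φ, hφε⟩ := (memLp_one_iff_integrable.2
    hqρ).exists_compactlySupported_eLpNorm_sub_le ENNReal.one_ne_top (ENNReal.half_pos hε.ne').ne'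
  rw [eLpNorm_one_eq_lintegral_enorm] at hφε
  have hφ1 : Integrable (fun x => φ (θ x) * F x) m := by
    obtain ⟨C, hC⟩ := φ.hasCompactSupport.exists_bound_of_continuous φ.continuous
    exact hF.bdd_mul (c := C) (φ.continuous.comp hθ).measurable.aestronglyMeasurable (.of_forall fun _ => hC _)
  have hφ2 : Integrable (fun x => φ x * u x) n := by
    obtain ⟨C, hC⟩ := φ.hasCompactSupport.exists_bound_of_continuous φ.continuous
    exact hu.bdd_mul (c := C) φ.continuous.measurable.aestronglyMeasurable (.of_forall fun _ => hC _)
  have e : ∫ x, q (θ x) * F x ∂m - ∫ y, q y * u y ∂n =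
      ∫ x, (q - ⇑φ) (θ x) * F x ∂m - ∫ y, (q - ⇑φ) y * u y ∂n := by
    simp only [Pi.sub_apply, sub_mul]
    rw [integral_sub hqF hφ1, integral_sub hqu hφ2, h φ]
    simp
  have hm : Measurable (q - ⇑φ) := hq.sub φ.continuous.measurable
  rw [e, zero_add, ← ENNReal.add_halves ε]
  refine (enorm_sub_le ).trans (add_le_add ?_ ?_)
  · exact (enorm_integral_le_lintegral_enorm _).trans ((key1 _ hm).trans hφε)
  · exact (enorm_integral_le_lintegral_enorm _).trans ((key2 _ hm).trans hφε)

/-- An integrable function which integrates to zero against continuous functions with compact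
support vanishes almost everywhere. -/
theorem ae_eq_zero_of_forall_compactlySupported
    {Y : Type*} [TopologicalSpace Y] [MeasurableSpace Y] [BorelSpace Y] [T2Space Y]
    [LocallyCompactSpace Y] {n : Measure Y} [InnerRegularCompactLTTop n] {u : Y → ℂ}
    (hu : Integrable u n) (h : ∀ φ : C_c(Y, ℂ), ∫ y, φ y * u y ∂n = 0) : u =ᵐ[n] 0 := by
  refine hu.ae_eq_zero_of_forall_setIntegral_eq_zero fun s hs _ => ?_
  have e (y : Y) : s.indicator (fun _ => (1 : ℂ)) y * u y = s.indicator u y := by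
    by_cases hy : y ∈ s <;> simp [hy]
  -- With `F = 0` the left-hand complex measure vanishes, so `∫ q u = 0` for `q` the indicator of
  -- `s`.
  have := integral_comp_mul_eq_of_forall_compactlySupported (m := n) (n := n) (F := fun _ => 0)
    continuous_id (integrable_zero _ _ _) hu (fun φ => by simp [h φ])
    (q := s.indicator fun _ => 1) (measurable_const.indicator hs) (by simp)
    (by simp only [e]; exact hu.indicator hs)
  simpa only [e, mul_zero, integral_zero, integral_indicator hs, eq_comm] using this

/-! ### Haar measure on products as an iterated integral -/

/-- The exact sequence `1 → H → G × H → G → 1` induces a Haar measure on `G × H` whose integral of a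
`C_c` function is an iterated integral. It takes the place of the product measure, which is defined
on a possibly smaller σ-algebra. -/
theorem TopologicalGroup.isSES_inr_fst (G H : Type*) [Group G] [TopologicalSpace G] [T1Space G]
    [Group H] [TopologicalSpace H] :
    TopologicalGroup.IsSES (MonoidHom.inr G H) (MonoidHom.fst G H) where
  isClosedEmbedding := by
    refine ⟨isEmbedding_prodMkRight 1, ?_⟩
    have : Set.range (MonoidHom.inr G H) = Prod.fst ⁻¹' {1} := by
      ext ⟨x, y⟩
      simp [eq_comm]
    rw [this]
    exact isClosed_singleton.preimage continuous_fst
  isOpenQuotientMap := ⟨Prod.fst_surjective, continuous_fst, isOpenMap_fst⟩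
  mulExact := by
    rintro ⟨x, y⟩
    simp [eq_comm]

section Product

variable {G H : Type*} [Group G] [TopologicalSpace G] [IsTopologicalGroup G]
  [LocallyCompactSpace G] [T2Space G]
  [Group H] [TopologicalSpace H] [IsTopologicalGroup H]
  [LocallyCompactSpace H] [T2Space H] [MeasurableSpace H] [BorelSpace H]

/-- Integration of a continuous function with compact support over the second variable. -/
def integrateSnd {E : Type*} [NormedAddCommGroup E] [NormedSpace ℝ E] (k : C_c(G × H, E)) :
    C_c(G, E) :=
  (TopologicalGroup.isSES_inr_fst G H).pushforward (haar : Measure H) k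

theorem integrateSnd_apply {E : Type*} [NormedAddCommGroup E] [NormedSpace ℝ E]
    (k : C_c(G × H, E)) (x : G) : integrateSnd k x = ∫ y, k (x, y) ∂haar := by
  refine ((TopologicalGroup.isSES_inr_fst G H).pushforward_apply_apply haar k (x, 1)).trans ?_
  simp [TopologicalGroup.IsSES.pullback_def]

variable [MeasurableSpace G] [BorelSpace G]

theorem integral_integral_swap_compactlySupported (k : C_c(G × H, ℂ)) :
    ∫ x, ∫ y, k (x, y) ∂haar ∂haar = ∫ y, ∫ x, k (x, y) ∂haar ∂haar :=
  integral_integral_swap_of_hasCompactSupport (f := fun x y => k (x, y)) k.continuous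
    k.hasCompactSupport

variable [MeasurableSpace (G × H)] [BorelSpace (G × H)]

variable (G H) in
/-- The ratio of the Haar measure of `G × H` to the product of the Haar measures of `G` and `H`. -/
def haarProdFactor : ℝ≥0 :=
  haarScalarFactor (haar : Measure (G × H))
    ((TopologicalGroup.isSES_inr_fst G H).inducedMeasure haar haar)

variable (G H) in
theorem haarProdFactor_pos : 0 < haarProdFactor G H := haarScalarFactor_pos_of_isHaarMeasure _ _

/-- By uniqueness of Haar measure, `haar` on `G × H` is a multiple of the measure induced by the
exact sequence. The two are normalised independently, which is why the constant `haarProdFactor`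
appears throughout. -/
theorem integral_haar_prod_real (k : C_c(G × H, ℝ)) :
    ∫ t, k t ∂haar = haarProdFactor G H * ∫ x, ∫ y, k (x, y) ∂haar ∂haar := by
  have h := isMulLeftInvariant_eq_smul_of_regular (haar : Measure (G × H))
    ((TopologicalGroup.isSES_inr_fst G H).inducedMeasure haar haar)
  rw [h, integral_smul_nnreal_measure, TopologicalGroup.IsSES.integral_inducedMeasure,
    TopologicalGroup.IsSES.integrate_apply, NNReal.smul_def, smul_eq_mul, haarProdFactor]
  congr 2
  ext x
  exact integrateSnd_apply k x

theorem integral_haar_prod (k : C_c(G × H, ℂ)) :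
    ∫ t, k t ∂haar = haarProdFactor G H * ∫ x, ∫ y, k (x, y) ∂haar ∂haar := by
  have hk (x : G) : Integrable (fun y => k (x, y)) haar :=
    ((TopologicalGroup.isSES_inr_fst G H).pullback k (x, 1)).integrable.congr
      (.of_forall fun y => by simp [TopologicalGroup.IsSES.pullback_def])
  have hk' : Integrable (fun x => ∫ y, k (x, y) ∂haar) haar :=
    (integrateSnd k).integrable.congr (.of_forall fun x => integrateSnd_apply k x)
  have hre := integral_haar_prod_real (k.compLeft ⟨Complex.re, Complex.continuous_re⟩)
  have him := integral_haar_prod_real (k.compLeft ⟨Complex.im, Complex.continuous_im⟩)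
  simp only [CompactlySupportedContinuousMap.compLeft_apply (g := ⟨Complex.re, Complex.continuous_re⟩) rfl,
    CompactlySupportedContinuousMap.compLeft_apply (g := ⟨Complex.im, Complex.continuous_im⟩) rfl,
    ContinuousMap.coe_mk] at hre him
  apply Complex.ext
  · have h1 := integral_re (𝕜 := ℂ) (k.integrable (μ := haar))
    have h2 := integral_re (𝕜 := ℂ) hk'
    have h3 (x : G) := integral_re (𝕜 := ℂ) (hk x)
    simp only [RCLike.re_eq_complex_re] at h1 h2 h3
    rw [← h1, hre, Complex.re_ofReal_mul, ← h2]
    simp only [h3]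
  · have h1 := integral_im (𝕜 := ℂ) (k.integrable (μ := haar))
    have h2 := integral_im (𝕜 := ℂ) hk'
    have h3 (x : G) := integral_im (𝕜 := ℂ) (hk x)
    simp only [RCLike.im_eq_complex_im] at h1 h2 h3
    rw [← h1, him, Complex.im_ofReal_mul, ← h2]
    simp only [h3]

theorem integral_haar_prod_symm (k : C_c(G × H, ℂ)) :
    ∫ t, k t ∂haar = haarProdFactor G H * ∫ y, ∫ x, k (x, y) ∂haar ∂haar := by
  rw [integral_haar_prod, integral_integral_swap_compactlySupported]

end Product

/-- Composition of a continuous function with compact support with a homeomorphism. -/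
def CompactlySupportedContinuousMap.compHomeomorph {X Y : Type*} [TopologicalSpace X]
    [TopologicalSpace Y] (f : C_c(Y, ℂ)) (e : X ≃ₜ Y) : C_c(X, ℂ) where
  toFun := fun x => f (e x)
  hasCompactSupport' := f.hasCompactSupport.comp_homeomorph e

@[simp]
theorem CompactlySupportedContinuousMap.compHomeomorph_apply {X Y : Type*} [TopologicalSpace X]
    [TopologicalSpace Y] (f : C_c(Y, ℂ)) (e : X ≃ₜ Y) (x : X) : f.compHomeomorph e x = f (e x) :=
  rfl

/-- The restriction of a continuous function with compact support to a closed slice. -/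
def CompactlySupportedContinuousMap.slice {X Y : Type*} [TopologicalSpace X] [T1Space X]
    [TopologicalSpace Y] (k : C_c(X × Y, ℂ)) (x : X) : C_c(Y, ℂ) where
  toFun := fun y => k (x, y)
  hasCompactSupport' := by
    refine k.hasCompactSupport.comp_isClosedEmbedding ⟨isEmbedding_prodMkRight x, ?_⟩
    have : Set.range (Prod.mk x : Y → X × Y) = Prod.fst ⁻¹' {x} := by
      ext ⟨x, y⟩
      simp [eq_comm]
    rw [this]
    exact isClosed_singleton.preimage continuous_fst

section Triple

variable {G : Type*} [Group G] [TopologicalSpace G] [IsTopologicalGroup G]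
  [LocallyCompactSpace G] [T2Space G] [MeasurableSpace G] [BorelSpace G]

/-- Integrating out `z` leaves a `C_c` function of two variables, for which the order may be
exchanged. -/
theorem integral_swap_left (k : C_c(G × G × G, ℂ)) :
    ∫ x, ∫ y, ∫ z, k (x, y, z) ∂haar ∂haar ∂haar =
      ∫ y, ∫ x, ∫ z, k (x, y, z) ∂haar ∂haar ∂(haar : Measure G) := by
  have h := integral_integral_swap_compactlySupported
    (integrateSnd (k.compHomeomorph (Homeomorph.prodAssoc G G G)))
  simp only [integrateSnd_apply] at h
  exact h

theorem integral_swap_right (k : C_c(G × G × G, ℂ)) :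
    ∫ x, ∫ y, ∫ z, k (x, y, z) ∂haar ∂haar ∂haar =
      ∫ x, ∫ z, ∫ y, k (x, y, z) ∂haar ∂haar ∂(haar : Measure G) := by
  congr 1
  ext x
  exact integral_integral_swap_compactlySupported (k.slice x)

variable [MeasurableSpace (G × G)] [BorelSpace (G × G)]
  [MeasurableSpace (G × G × G)] [BorelSpace (G × G × G)]

theorem integral_haar_prod_triple (k : C_c(G × G × G, ℂ)) :
    ∫ t, k t ∂haar = haarProdFactor G (G × G) * (haarProdFactor G G *
      ∫ x, ∫ y, ∫ z, k (x, y, z) ∂haar ∂haar ∂haar) := by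
  rw [integral_haar_prod, ← integral_const_mul (haarProdFactor G G : ℂ)]
  congr 2
  ext x
  exact integral_haar_prod (k.slice x)

/-- Any of the three variables may be taken as the outer one, always with the same constant. The
three terms of quasi-additivity need different outer variables and are compared through this common
constant. -/
theorem integral_haar_prod_triple_snd (k : C_c(G × G × G, ℂ)) :
    ∫ t, k t ∂haar = haarProdFactor G (G × G) *
      ∫ y, ∫ p : G × G, k (p.1, y, p.2) ∂haar ∂haar := by
  let e : G × G × G ≃ₜ G × G × G :=
    { toFun := fun t => (t.2.1, t.1, t.2.2)
      invFun := fun t => (t.2.1, t.1, t.2.2)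
      left_inv := fun _ => rfl
      right_inv := fun _ => rfl
      continuous_toFun := by fun_prop
      continuous_invFun := by fun_prop }
  rw [integral_haar_prod_triple, integral_swap_left, ← integral_const_mul (haarProdFactor G G : ℂ)]
  congr 2
  ext y
  exact (integral_haar_prod ((k.compHomeomorph e).slice y)).symm

theorem integral_haar_prod_triple_trd (k : C_c(G × G × G, ℂ)) :
    ∫ t, k t ∂haar = haarProdFactor G (G × G) *
      ∫ z, ∫ p : G × G, k (p.2, p.1, z) ∂haar ∂haar := by
  let e : G × G × G ≃ₜ G × G × G :=
    { toFun := fun t => (t.2.2, t.2.1, t.1)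
      invFun := fun t => (t.2.2, t.2.1, t.1)
      left_inv := fun _ => rfl
      right_inv := fun _ => rfl
      continuous_toFun := by fun_prop
      continuous_invFun := by fun_prop }
  let e' : G × G × G ≃ₜ G × G × G :=
    { toFun := fun t => (t.1, t.2.2, t.2.1)
      invFun := fun t => (t.1, t.2.2, t.2.1)
      left_inv := fun _ => rfl
      right_inv := fun _ => rfl
      continuous_toFun := by fun_prop
      continuous_invFun := by fun_prop }
  have h := integral_swap_left (k.compHomeomorph e')
  have h' := integral_swap_right (k.compHomeomorph e)
  simp only [CompactlySupportedContinuousMap.compHomeomorph_apply, e, e', Homeomorph.homeomorph_mk_coe,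
    Equiv.coe_fn_mk] at h h'
  rw [integral_haar_prod_triple, integral_swap_right, h, ← h', ← integral_const_mul (haarProdFactor G G : ℂ)]
  congr 2
  ext z
  exact (integral_haar_prod ((k.compHomeomorph e).slice z)).symm

end Triple

/-! ### Dominated functions as functionals on `L¹(G, ω)` -/

section

variable {G : Type*} [Group G] [TopologicalSpace G] [IsTopologicalGroup G]
  [LocallyCompactSpace G] [MeasurableSpace G] [BorelSpace G]

theorem Weight.measure_ac (ω : Weight G) : ω.measure ≪ (haar : Measure G) :=
  withDensity_absolutelyContinuous _ _

theorem Weight.integrable_measure_iff (ω : Weight G) {f : G → ℂ} :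
    Integrable f ω.measure ↔ Integrable (fun x => (ω x : ℂ) * f x) haar := by
  refine (integrable_withDensity_iff_integrable_smul ω.measurable_nn).trans
    (integrable_congr (.of_forall fun x => ?_))
  simp only [NNReal.smul_def, Real.coe_toNNReal _ (ω.pos x).le, Complex.real_smul]

/-- Borel functions `q` with `q / ω` bounded. -/
def IsDominated (ω : Weight G) (q : G → ℂ) : Prop :=
  Measurable q ∧ ∃ C : ℝ, ∀ x, ‖q x‖ ≤ C * ω x

theorem IsDominated.add {ω : Weight G} {q r : G → ℂ} (hq : IsDominated ω q)
    (hr : IsDominated ω r) : IsDominated ω fun x => q x + r x := by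
  obtain ⟨C, hC⟩ := hq.2
  obtain ⟨D, hD⟩ := hr.2
  exact ⟨hq.1.add hr.1, C + D, fun x => (norm_add_le _ _).trans (by linarith [hC x, hD x])⟩

theorem IsDominated.sub {ω : Weight G} {q r : G → ℂ} (hq : IsDominated ω q)
    (hr : IsDominated ω r) : IsDominated ω fun x => q x - r x := by
  obtain ⟨C, hC⟩ := hq.2
  obtain ⟨D, hD⟩ := hr.2
  exact ⟨hq.1.sub hr.1, C + D, fun x => (norm_sub_le _ _).trans (by linarith [hC x, hD x])⟩

theorem IsDominated.const_mul {ω : Weight G} {q : G → ℂ} (hq : IsDominated ω q) (c : ℂ) :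
    IsDominated ω fun x => c * q x := by
  obtain ⟨C, hC⟩ := hq.2
  refine ⟨hq.1.const_mul c, ‖c‖ * C, fun x => ?_⟩
  rw [norm_mul, mul_assoc]
  exact mul_le_mul_of_nonneg_left (hC x) (norm_nonneg _)

theorem isDominated_of_norm_le (ω : Weight G) {q : G → ℂ} (hq : Measurable q) {C : ℝ}
    (h : ∀ x, ‖q x‖ ≤ C) : IsDominated ω q := by
  have hC : 0 ≤ C := (norm_nonneg _).trans (h 1)
  exact ⟨hq, C, fun x => (h x).trans (le_mul_of_one_le_right hC (ω.one_le' x))⟩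

theorem CompactlySupportedContinuousMap.isDominated (ω : Weight G) (φ : C_c(G, ℂ)) :
    IsDominated ω φ := by
  obtain ⟨C, hC⟩ := φ.hasCompactSupport.exists_bound_of_continuous φ.continuous
  exact isDominated_of_norm_le ω φ.continuous.measurable hC

namespace WeightedL1

variable {ω : Weight G}

theorem ext_haar {f g : WeightedL1 ω} (h : (f : G → ℂ) =ᵐ[haar] g) : f = g :=
  ext_ae (ω.measure_ac.ae_eq h)

/-- The class in `L¹(G, ω)` of a function `f` such that `ω f` is integrable. -/
def ofIntegrable (f : G → ℂ) (hf : Integrable (fun x => (ω x : ℂ) * f x) haar) : WeightedL1 ω :=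
  (memLp_one_iff_integrable.2 (ω.integrable_measure_iff.2 hf)).toLp f

theorem coeFn_ofIntegrable (f : G → ℂ) (hf : Integrable (fun x => (ω x : ℂ) * f x) haar) :
    (ofIntegrable f hf : G → ℂ) =ᵐ[haar] f :=
  ω.haar_ac.ae_eq (MemLp.coeFn_toLp (memLp_one_iff_integrable.2 (ω.integrable_measure_iff.2 hf)))

theorem norm_eq_of_ae {f : WeightedL1 ω} {g : G → ℂ} (h : (f : G → ℂ) =ᵐ[haar] g) :
    ‖f‖ = ∫ x, ω x * ‖g x‖ ∂haar := by
  rw [norm_eq]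
  refine integral_congr_ae ?_
  filter_upwards [h] with x hx
  rw [hx]

theorem coeFn_sub (f g : WeightedL1 ω) :
    ((f - g : WeightedL1 ω) : G → ℂ) =ᵐ[haar] fun x => f x - g x :=
  ω.haar_ac.ae_eq (Lp.coeFn_sub (show Lp ℂ 1 ω.measure from f) (show Lp ℂ 1 ω.measure from g))

theorem integrable_weight_cc (ω : Weight G) (φ : C_c(G, ℂ)) :
    Integrable (fun x => (ω x : ℂ) * φ x) haar := by
  have := ω.continuous'
  exact Continuous.integrable_of_hasCompactSupport (by fun_prop) φ.hasCompactSupport.mul_left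

/-- The map from continuous functions with compact support to `L¹(G, ω)`. -/
def ofCc (ω : Weight G) : C_c(G, ℂ) →ₗ[ℂ] WeightedL1 ω where
  toFun φ := ofIntegrable φ (integrable_weight_cc ω φ)
  map_add' φ ψ := by
    apply ext_haar
    filter_upwards [coeFn_ofIntegrable (ω := ω) _ (integrable_weight_cc ω (φ + ψ)),
      coeFn_ofIntegrable (ω := ω) _ (integrable_weight_cc ω φ),
      coeFn_ofIntegrable (ω := ω) _ (integrable_weight_cc ω ψ),
      ω.haar_ac.ae_eq (coeFn_add (ofIntegrable (ω := ω) _ (integrable_weight_cc ω φ))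
        (ofIntegrable (ω := ω) _ (integrable_weight_cc ω ψ)))] with x h1 h2 h3 h4
    rw [h1, h4, h2, h3, CompactlySupportedContinuousMap.add_apply]
  map_smul' c φ := by
    apply ext_haar
    filter_upwards [coeFn_ofIntegrable (ω := ω) _ (integrable_weight_cc ω (c • φ)),
      coeFn_ofIntegrable (ω := ω) _ (integrable_weight_cc ω φ),
      ω.haar_ac.ae_eq (coeFn_smul c (ofIntegrable (ω := ω) _ (integrable_weight_cc ω φ)))]
      with x h1 h2 h3
    rw [h1, RingHom.id_apply, h3, h2, CompactlySupportedContinuousMap.smul_apply, smul_eq_mul]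

theorem coeFn_ofCc (φ : C_c(G, ℂ)) : (ofCc ω φ : G → ℂ) =ᵐ[haar] φ :=
  coeFn_ofIntegrable _ (integrable_weight_cc ω φ)

theorem norm_ofCc (φ : C_c(G, ℂ)) : ‖ofCc ω φ‖ = ∫ x, ω x * ‖φ x‖ ∂haar :=
  norm_eq_of_ae (coeFn_ofCc φ)

theorem integrable_dominated_mul {q : G → ℂ} (hq : IsDominated ω q) (f : WeightedL1 ω) :
    Integrable (fun x => q x * f x) haar := by
  obtain ⟨C, hC⟩ := hq.2
  refine (f.integrable_weight.const_mul C).mono'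
    (hq.1.aestronglyMeasurable.mul f.integrable.1) (.of_forall fun x => ?_)
  rw [norm_mul, ← mul_assoc]
  exact mul_le_mul_of_nonneg_right (hC x) (norm_nonneg _)

/-- The functional `f ↦ ∫ q f` on `L¹(G, ω)`, where `q / ω` is bounded. -/
def pairing {q : G → ℂ} (hq : IsDominated ω q) : WeightedL1 ω →L[ℂ] ℂ :=
  LinearMap.mkContinuousOfExistsBound
    { toFun := fun f => ∫ x, q x * f x ∂haar
      map_add' := fun f g => by
        rw [← integral_add (integrable_dominated_mul hq f) (integrable_dominated_mul hq g)]
        refine integral_congr_ae ?_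
        filter_upwards [ω.haar_ac.ae_eq (coeFn_add f g)] with x hx
        rw [hx, mul_add]
      map_smul' := fun c f => by
        rw [RingHom.id_apply, smul_eq_mul, ← integral_const_mul]
        refine integral_congr_ae ?_
        filter_upwards [ω.haar_ac.ae_eq (coeFn_smul c f)] with x hx
        rw [hx, mul_left_comm] }
    (by
      obtain ⟨C, hC⟩ := hq.2
      refine ⟨C, fun f => ?_⟩
      rw [norm_eq f, ← integral_const_mul]
      refine norm_integral_le_of_norm_le (f.integrable_weight.const_mul C)
        (.of_forall fun x => ?_)
      rw [norm_mul, ← mul_assoc]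
      exact mul_le_mul_of_nonneg_right (hC x) (norm_nonneg _))

theorem pairing_apply {q : G → ℂ} (hq : IsDominated ω q) (f : WeightedL1 ω) :
    pairing hq f = ∫ x, q x * f x ∂haar := rfl

theorem pairing_ofCc {q : G → ℂ} (hq : IsDominated ω q) (φ : C_c(G, ℂ)) :
    pairing hq (ofCc ω φ) = ∫ x, q x * φ x ∂haar := by
  rw [pairing_apply]
  refine integral_congr_ae ?_
  filter_upwards [coeFn_ofCc (ω := ω) φ] with x hx
  rw [hx]

theorem pairing_add_apply {q r : G → ℂ} (hq : IsDominated ω q) (hr : IsDominated ω r)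
    (f : WeightedL1 ω) : pairing (hq.add hr) f = pairing hq f + pairing hr f := by
  simp only [pairing_apply, add_mul]
  exact integral_add (integrable_dominated_mul hq f) (integrable_dominated_mul hr f)

theorem pairing_sub_apply {q r : G → ℂ} (hq : IsDominated ω q) (hr : IsDominated ω r)
    (f : WeightedL1 ω) : pairing (hq.sub hr) f = pairing hq f - pairing hr f := by
  simp only [pairing_apply, sub_mul]
  exact integral_sub (integrable_dominated_mul hq f) (integrable_dominated_mul hr f)

theorem pairing_const_mul_apply {q : G → ℂ} (hq : IsDominated ω q) (c : ℂ)
    (f : WeightedL1 ω) : pairing (hq.const_mul c) f = c * pairing hq f := by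
  simp only [pairing_apply, mul_assoc]
  exact integral_const_mul _ _

/-- A functional evaluated at a convolution product. -/
theorem clm_mul (Λ : WeightedL1 ω →L[ℂ] ℂ) (f g : WeightedL1 ω) :
    Λ (f * g) = ∫ y, f y * Λ (translate y g) ∂haar := by
  rw [mul_def, ← ContinuousLinearMap.integral_comp_comm _ (integrable_smul_translate f g)]
  simp

theorem clm_ofCc_mul (Λ : WeightedL1 ω →L[ℂ] ℂ) (φ : C_c(G, ℂ)) (g : WeightedL1 ω) :
    Λ (ofCc ω φ * g) = ∫ y, φ y * Λ (translate y g) ∂haar := by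
  rw [clm_mul]
  refine integral_congr_ae ?_
  filter_upwards [coeFn_ofCc (ω := ω) φ] with x hx
  rw [hx]

theorem translate_ofCc (y : G) (φ : C_c(G, ℂ)) :
    translate y (ofCc ω φ) = ofCc ω (φ.compHomeomorph (Homeomorph.mulLeft y⁻¹)) := by
  apply ext_haar
  have h' : ∀ᵐ x ∂haar, (ofCc ω φ : G → ℂ) (y⁻¹ * x) = φ (y⁻¹ * x) :=
    (measurePreserving_mul_left (haar : Measure G) y⁻¹).quasiMeasurePreserving.ae_eq_comp
      (coeFn_ofCc (ω := ω) φ)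
  filter_upwards [ω.haar_ac.ae_eq (coeFn_translate y (ofCc ω φ)), h',
    coeFn_ofCc (ω := ω) (φ.compHomeomorph (Homeomorph.mulLeft y⁻¹))] with x h1 h2 h3
  rw [h1, h2, h3]
  rfl

variable [T2Space G]

theorem eq_of_forall_integral_eq {f g : WeightedL1 ω}
    (h : ∀ φ : C_c(G, ℂ), ∫ x, φ x * f x ∂haar = ∫ x, φ x * g x ∂haar) : f = g := by
  have hi : Integrable (fun x => f x - g x) (haar : Measure G) := f.integrable.sub g.integrable
  have := ae_eq_zero_of_forall_compactlySupported hi fun φ => by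
    simp only [mul_sub]
    rw [integral_sub (integrable_dominated_mul (φ.isDominated ω) f)
      (integrable_dominated_mul (φ.isDominated ω) g), h, sub_self]
  apply ext_haar
  filter_upwards [this] with x hx
  exact sub_eq_zero.1 hx

/-- `f ↦ ω f` is isometric into the unweighted `L¹`. There `ω f` is approximated by some `g` in
`C_c`, and `g / ω` is again in `C_c`. -/
theorem denseRange_ofCc : DenseRange (ofCc ω) := by
  refine Metric.denseRange_iff.2 fun f ε hε => ?_
  have hf : Integrable (fun x => (ω x : ℂ) * f x) haar :=
    ω.integrable_measure_iff.1 (memLp_one_iff_integrable.1 f.memLp)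
  obtain ⟨g, hg⟩ := (memLp_one_iff_integrable.2 hf).exists_compactlySupported_eLpNorm_sub_le
    ENNReal.one_ne_top (ε := ENNReal.ofReal (ε / 2)) (by simpa using hε)
  have hω := ω.continuous'
  have hne (x : G) : (ω x : ℂ) ≠ 0 := by exact_mod_cast (ω.pos x).ne'
  let k : C_c(G, ℂ) := ⟨⟨fun x => (ω x : ℂ)⁻¹ * g x, by
    exact ((Complex.continuous_ofReal.comp hω).inv₀ hne).mul g.continuous⟩,
    g.hasCompactSupport.mul_left⟩
  refine ⟨k, ?_⟩
  have hi : Integrable (fun x => (ω x : ℂ) * f x - g x) haar := hf.sub g.integrable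
  have e : ‖f - ofCc ω k‖ = ∫ x, ‖(ω x : ℂ) * f x - g x‖ ∂haar := by
    rw [norm_eq]
    refine integral_congr_ae ?_
    filter_upwards [coeFn_sub f (ofCc ω k), coeFn_ofCc (ω := ω) k] with x h1 h2
    have h3 : (ω x : ℂ) * f x - g x = ω x * (f x - k x) := by
      simp only [k, CompactlySupportedContinuousMap.coe_mk, ContinuousMap.coe_mk]
      rw [mul_sub, mul_inv_cancel_left₀ (hne x)]
    rw [h1, h2, h3, norm_mul, Complex.norm_real, Real.norm_eq_abs, abs_of_pos (ω.pos x)]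
  rw [dist_eq_norm, e, integral_norm_eq_lintegral_enorm hi.1]
  rw [eLpNorm_one_eq_lintegral_enorm] at hg
  refine (ENNReal.toReal_mono ENNReal.ofReal_ne_top hg).trans_lt ?_
  rw [ENNReal.toReal_ofReal (by positivity)]
  linarith

theorem clm_ext {E : Type*} [NormedAddCommGroup E] [NormedSpace ℂ E] {S T : WeightedL1 ω →L[ℂ] E}
    (h : ∀ φ, S (ofCc ω φ) = T (ofCc ω φ)) : S = T :=
  ContinuousLinearMap.coeFn_injective <| denseRange_ofCc.equalizer S.continuous T.continuous
    (funext h)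

/-- Testing against the conjugate of `d = q - r` cut off to a compact `K` yields `∫_K |d|² = 0`.
Conversely, functions with compact support do not see locally null sets, and they are dense. This is
why equality holds locally almost everywhere. -/
theorem pairing_eq_iff {q r : G → ℂ} (hq : IsDominated ω q) (hr : IsDominated ω r) :
    pairing hq = pairing hr ↔ HaarAE G fun x => q x = r x := by
  rw [haarAE_iff]
  constructor
  · intro h K hK
    let d : G → ℂ := fun x => q x - r x
    have hd : IsDominated ω d := hq.sub hr
    have hm : Measurable fun x => starRingEnd ℂ (d x) := Complex.continuous_conj.measurable.comp hd.1
    let w : G → ℂ := K.indicator fun x => starRingEnd ℂ (d x)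
    obtain ⟨C, hC⟩ := hd.2
    obtain ⟨B, hB⟩ := hK.exists_bound_of_continuousOn ω.continuous'.continuousOn
    have hw : Integrable (fun x => (ω x : ℂ) * w x) haar := by
      have e : (fun x => (ω x : ℂ) * w x) =
          K.indicator fun x => (ω x : ℂ) * starRingEnd ℂ (d x) := by
        ext x
        by_cases hx : x ∈ K <;> simp [w, hx]
      rw [e, integrable_indicator_iff hK.measurableSet]
      refine IntegrableOn.of_bound hK.measure_lt_top ?_ (B * (|C| * B)) ?_
      · exact ((Complex.continuous_ofReal.measurable.comp ω.continuous'.measurable).mul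
          hm).aestronglyMeasurable
      · filter_upwards [ae_restrict_mem hK.measurableSet] with x hx
        have h1 := hB x hx
        rw [norm_mul, RCLike.norm_conj, Complex.norm_real]
        have h2 : 0 ≤ B := (norm_nonneg _).trans h1
        refine mul_le_mul h1 ((hC x).trans ?_) (norm_nonneg _) h2
        exact mul_le_mul (le_abs_self C) ((le_abs_self _).trans h1) (ω.pos x).le (abs_nonneg _)
    have h0 : pairing hd (ofIntegrable w hw) = 0 := by
      rw [pairing_sub_apply hq hr, h, sub_self]
    have h1 : ∫ x in K, (‖d x‖ ^ 2 : ℝ) ∂haar = 0 := by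
      rw [← integral_indicator hK.measurableSet]
      rw [pairing_apply] at h0
      have e : ∫ x, d x * (ofIntegrable w hw : WeightedL1 ω) x ∂haar =
          ∫ x, ((K.indicator (fun x => (‖d x‖ ^ 2 : ℝ)) x : ℝ) : ℂ) ∂haar := by
        refine integral_congr_ae ?_
        filter_upwards [coeFn_ofIntegrable (ω := ω) w hw] with x hx
        rw [hx]
        by_cases hxK : x ∈ K
        · simp [w, hxK, Complex.mul_conj, Complex.normSq_eq_norm_sq]
        · simp [w, hxK]
      rw [e, integral_complex_ofReal] at h0
      exact_mod_cast h0
    have hi : IntegrableOn (fun x => (‖d x‖ ^ 2 : ℝ)) K haar := by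
      refine IntegrableOn.of_bound hK.measure_lt_top (hd.1.norm.pow_const 2).aestronglyMeasurable
        ((|C| * B) ^ 2) ?_
      filter_upwards [ae_restrict_mem hK.measurableSet] with x hx
      rw [Real.norm_eq_abs, abs_of_nonneg (by positivity)]
      refine pow_le_pow_left₀ (norm_nonneg _) ((hC x).trans ?_) 2
      exact mul_le_mul (le_abs_self C) ((le_abs_self _).trans (hB x hx)) (ω.pos x).le
        (abs_nonneg _)
    have h2 := (integral_eq_zero_iff_of_nonneg (fun x => by positivity) hi).1 h1
    rw [Filter.EventuallyEq, ae_restrict_iff' hK.measurableSet] at h2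
    refine measure_mono_null ?_ h2
    rintro x ⟨hx, hxK⟩ hc
    have := hc hxK
    simp only [Pi.zero_apply, ne_eq, OfNat.ofNat_ne_zero, not_false_eq_true, pow_eq_zero_iff,
      norm_eq_zero] at this
    exact hx (sub_eq_zero.1 this)
  · intro h
    refine clm_ext fun φ => ?_
    rw [pairing_ofCc, pairing_ofCc]
    refine integral_congr_ae ?_
    have h0 : ∀ᵐ x ∂(haar : Measure G), x ∉ {x | ¬ q x = r x} ∩ tsupport φ :=
      measure_eq_zero_iff_ae_notMem.1 (h _ φ.hasCompactSupport)
    filter_upwards [h0] with x hx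
    by_cases hx' : x ∈ tsupport φ
    · have : q x = r x := by
        by_contra hne
        exact hx ⟨hne, hx'⟩
      rw [this]
    · simp [image_eq_zero_of_notMem_tsupport hx']

end WeightedL1

end

/-! ### A bounded approximate identity in `C_c` -/

section ApproximateIdentity

variable {G : Type*} [Group G] [TopologicalSpace G] [IsTopologicalGroup G]
  [LocallyCompactSpace G] [MeasurableSpace G] [BorelSpace G] [T2Space G]

/-- The support lies in the image of `supp φ × supp ψ` under `(y, z) ↦ (yz, y)`. -/
theorem hasCompactSupport_mul_comp_inv_mul (φ ψ : C_c(G, ℂ)) :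
    HasCompactSupport fun t : G × G => φ t.2 * ψ (t.2⁻¹ * t.1) := by
  let θ : G × G → G × G := fun p => (p.1 * p.2, p.1)
  have hθ : Continuous θ := by fun_prop
  refine HasCompactSupport.intro
    ((φ.hasCompactSupport.isCompact.prod ψ.hasCompactSupport.isCompact).image hθ) ?_
  rintro ⟨x, y⟩ hxy
  by_contra h0
  obtain ⟨h1, h2⟩ := mul_ne_zero_iff.1 h0
  exact hxy ⟨(y, y⁻¹ * x), ⟨subset_tsupport _ h1, subset_tsupport _ h2⟩, by simp [θ]⟩

/-- The function `(x, y) ↦ φ(y) ψ(y⁻¹ x)`. -/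
def convolutionKernel (φ ψ : C_c(G, ℂ)) : C_c(G × G, ℂ) where
  toFun := fun t => φ t.2 * ψ (t.2⁻¹ * t.1)
  continuous_toFun := by fun_prop
  hasCompactSupport' := hasCompactSupport_mul_comp_inv_mul φ ψ

namespace WeightedL1

variable {ω : Weight G}

/-- The product is a Bochner integral of translates. It is identified with a concrete function by
integrating both against an arbitrary `η` in `C_c` and exchanging the two integrals. -/
theorem ofCc_mul_ofCc (φ ψ : C_c(G, ℂ)) :
    ofCc ω φ * ofCc ω ψ = ofCc ω (integrateSnd (convolutionKernel φ ψ)) := by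
  refine eq_of_forall_integral_eq fun η => ?_
  let k : C_c(G × G, ℂ) := ⟨⟨fun t => η t.1 * convolutionKernel φ ψ t, by fun_prop⟩,
    (convolutionKernel φ ψ).hasCompactSupport.mul_left⟩
  have h1 := clm_ofCc_mul (pairing (η.isDominated ω)) φ (ofCc ω ψ)
  have h2 := pairing_ofCc (η.isDominated ω) (integrateSnd (convolutionKernel φ ψ))
  have h3 := integral_integral_swap_compactlySupported k
  rw [← pairing_apply (η.isDominated ω), ← pairing_apply (η.isDominated ω), h1, h2]
  simp only [translate_ofCc, pairing_ofCc, integrateSnd_apply, ← integral_const_mul]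
  refine Eq.trans ?_ h3.symm
  refine integral_congr_ae (.of_forall fun y => integral_congr_ae (.of_forall fun x => ?_))
  exact mul_left_comm _ _ _

end WeightedL1

/-- `u` is a nonnegative symmetric function with integral one and support in `U`. -/
structure IsMollifier (U : Set G) (u : C_c(G, ℂ)) : Prop where
  nonneg : ∀ x, u x = (‖u x‖ : ℝ)
  symm : ∀ x, u x⁻¹ = u x
  integral : ∫ x, ‖u x‖ ∂haar = 1
  eq_zero : ∀ x ∉ U, u x = 0

/-- Symmetry is asked for because it gives `(f * u)(x) = ∫ f(xt) u(t) dt`, an average of right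
translates of `f`, without the modular function. -/
theorem exists_isMollifier {U : Set G} (hU : U ∈ 𝓝 (1 : G)) : ∃ u, IsMollifier U u := by
  obtain ⟨V, hVU, hVo, hV1⟩ := mem_nhds_iff.1 hU
  obtain ⟨g, hg1, hg2, hg3, hg4⟩ := exists_continuousMap_one_of_isCompact_subset_isOpen
    (isCompact_singleton (x := (1 : G))) (hVo.inter hVo.inv) (by simpa using hV1)
  have hgc : HasCompactSupport g := hg2
  let w : G → ℝ := fun x => g x + g x⁻¹
  have hw0 (x : G) : 0 ≤ w x := add_nonneg (hg4 _).1 (hg4 _).1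
  have hwc : Continuous w := by fun_prop
  have hws : HasCompactSupport w := hgc.add (hgc.comp_homeomorph (Homeomorph.inv G))
  have hg1' : g 1 = 1 := hg1 rfl
  have hpos : 0 < ∫ x, w x ∂(haar : Measure G) :=
    hwc.integral_pos_of_hasCompactSupport_nonneg_nonzero hws hw0 (x := 1) (by simp [w, hg1'])
  have hz (x : G) (hx : x ∉ V ∩ V⁻¹) : g x = 0 := by
    by_contra h
    exact hx (hg3 (subset_tsupport _ h))
  let c := (∫ x, w x ∂(haar : Measure G))⁻¹
  have hc : 0 < c := inv_pos.2 hpos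
  have hn (x : G) : ‖((c * w x : ℝ) : ℂ)‖ = c * w x := by
    rw [Complex.norm_real, Real.norm_eq_abs, abs_of_nonneg (mul_nonneg hc.le (hw0 x))]
  refine ⟨⟨⟨fun x => ((c * w x : ℝ) : ℂ), by fun_prop⟩, ?_⟩, ?_, ?_, ?_, ?_⟩
  · exact (hws.mul_left (f := fun _ => c)).comp_left (g := fun r : ℝ => (r : ℂ)) rfl
  · intro x
    exact (congrArg (fun r : ℝ => (r : ℂ)) (hn x)).symm
  · intro x
    change ((c * w x⁻¹ : ℝ) : ℂ) = ((c * w x : ℝ) : ℂ)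
    simp only [w, inv_inv, add_comm]
  · change ∫ x, ‖((c * w x : ℝ) : ℂ)‖ ∂haar = 1
    simp only [hn]
    rw [integral_const_mul, inv_mul_cancel₀ hpos.ne']
  · intro x hx
    have h1 : g x = 0 := hz x fun h => hx (hVU h.1)
    have h2 : g x⁻¹ = 0 := hz _ fun h => hx (hVU (by simpa using h.2))
    change ((c * w x : ℝ) : ℂ) = 0
    simp [w, h1, h2]

/-- For `t` in a compact neighbourhood `V` of the identity, both `f(xt)` and `f(x)` vanish unless
`x` lies in the compact set `(supp f) V⁻¹`, so compactness makes the estimate uniform in `x`. -/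
theorem eventually_forall_norm_mul_right_sub_le (f : C_c(G, ℂ)) {ε : ℝ} (hε : 0 < ε) :
    ∀ᶠ t in 𝓝 (1 : G), ∀ x, ‖f (x * t) - f x‖ ≤ ε := by
  obtain ⟨V, hV, hV1⟩ := exists_compact_mem_nhds (1 : G)
  let L := (fun p : G × G => p.1 * p.2⁻¹) '' (tsupport f ×ˢ V)
  have hL : IsCompact L := (f.hasCompactSupport.isCompact.prod hV).image (by fun_prop)
  have h1 : ∀ᶠ t in 𝓝 (1 : G), ∀ x ∈ L, ‖f (x * t) - f x‖ < ε := by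
    refine hL.eventually_forall_of_forall_eventually fun x _ => ?_
    have hc : Continuous fun p : G × G => ‖f (p.2 * p.1) - f p.2‖ := by fun_prop
    have := hc.tendsto (1, x)
    simp only [mul_one, sub_self, norm_zero] at this
    exact this.eventually_lt_const hε
  filter_upwards [h1, hV1] with t ht htV x
  by_cases hx : x ∈ L
  · exact (ht x hx).le
  · have e1 : f (x * t) = 0 := by
      by_contra h
      exact hx ⟨(x * t, t), ⟨subset_tsupport _ h, htV⟩, by simp⟩
    have e2 : f x = 0 := by
      by_contra h
      exact hx ⟨(x, 1), ⟨subset_tsupport _ h, mem_of_mem_nhds hV1⟩, by simp⟩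
    simp [e1, e2, hε.le]

namespace WeightedL1

variable {ω : Weight G}

variable (G) in
/-- The filter of small neighbourhoods of the identity. -/
def smallNhdsOne : Filter (Set G) := (𝓝 (1 : G)).smallSets ⊓ Filter.principal {U | U ∈ 𝓝 (1 : G)}

instance : (smallNhdsOne G).NeBot := by
  rw [smallNhdsOne, ← Filter.frequently_mem_iff_neBot]
  exact Filter.frequently_smallSets_mem _

theorem eventually_smallNhdsOne {S : Set G} (hS : S ∈ 𝓝 (1 : G)) :
    ∀ᶠ U in smallNhdsOne G, U ∈ 𝓝 (1 : G) ∧ U ⊆ S := by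
  rw [smallNhdsOne, Filter.eventually_inf_principal]
  exact (Filter.eventually_smallSets_subset.2 hS).mono fun U h hU => ⟨hU, h⟩

theorem norm_ofCc_le_two {U : Set G} {u : C_c(G, ℂ)} (hu : IsMollifier U u)
    (hU : ∀ x ∈ U, ω x ≤ 2) : ‖ofCc ω u‖ ≤ 2 := by
  have hu' : Integrable (fun x => ‖u x‖) (haar : Measure G) := u.integrable.norm
  have h2 : ∫ x, 2 * ‖u x‖ ∂(haar : Measure G) = 2 := by
    rw [integral_const_mul, hu.integral, mul_one]
  rw [norm_ofCc, ← h2]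
  refine integral_mono_of_nonneg (.of_forall fun x => mul_nonneg (ω.pos x).le (norm_nonneg _))
    (hu'.const_mul 2) (.of_forall fun x => ?_)
  by_cases hx : x ∈ U
  · exact mul_le_mul_of_nonneg_right (hU x hx) (norm_nonneg _)
  · simp [hu.eq_zero x hx]

theorem tendsto_ofCc_mul_mollifier {u : Set G → C_c(G, ℂ)}
    (hu : ∀ U ∈ 𝓝 (1 : G), IsMollifier U (u U)) (f : C_c(G, ℂ)) :
    Filter.Tendsto (fun U => ofCc ω f * ofCc ω (u U)) (smallNhdsOne G) (𝓝 (ofCc ω f)) := by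
  obtain ⟨V, hV, hV1⟩ := exists_compact_mem_nhds (1 : G)
  let L := (fun p : G × G => p.1 * p.2⁻¹) '' (tsupport f ×ˢ V)
  have hL : IsCompact L := (f.hasCompactSupport.isCompact.prod hV).image (by fun_prop)
  have hωL : IntegrableOn ω L haar := ω.continuous'.continuousOn.integrableOn_compact hL
  let c := ∫ x in L, ω x ∂haar
  have hc : 0 ≤ c := integral_nonneg fun x => (ω.pos x).le
  rw [Metric.tendsto_nhds]
  intro ε hε
  -- The error is at most `δ` on `L` and zero elsewhere, so its weighted norm is at most `δ c < ε`.
  -- The `+ 1` covers `c = 0`.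
  let δ := ε / (c + 1)
  have hδ : 0 < δ := by positivity
  have hev := eventually_forall_norm_mul_right_sub_le f hδ
  have hS : V ∩ {t | ∀ x, ‖f (x * t) - f x‖ ≤ δ} ∈ 𝓝 (1 : G) := Filter.inter_mem hV1 hev
  have hmem : ∀ᶠ U in smallNhdsOne G, U ∈ 𝓝 (1 : G) ∧
      U ⊆ V ∩ {t | ∀ x, ‖f (x * t) - f x‖ ≤ δ} :=
    eventually_smallNhdsOne hS
  filter_upwards [hmem] with U ⟨hU, hUS⟩
  have hv := hu U hU
  set v := u U
  have hvi : Integrable (fun t => δ * ‖v t‖) (haar : Measure G) := v.integrable.norm.const_mul δ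
  have hv1 : ∫ t, v t ∂(haar : Measure G) = 1 := by
    have : ∫ t, v t ∂(haar : Measure G) = ∫ t, ((‖v t‖ : ℝ) : ℂ) ∂haar :=
      integral_congr_ae (.of_forall hv.nonneg)
    rw [this, integral_complex_ofReal, hv.integral, Complex.ofReal_one]
  have key (x : G) : integrateSnd (convolutionKernel f v) x - f x =
      ∫ t, (f (x * t) - f x) * v t ∂haar := by
    have i1 : Integrable (fun t => f (x * t) * v t) haar :=
      Continuous.integrable_of_hasCompactSupport (by fun_prop) v.hasCompactSupport.mul_left
    have i2 : Integrable (fun t => f x * v t) haar := v.integrable.const_mul _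
    simp only [sub_mul]
    rw [integral_sub i1 i2, integral_const_mul, hv1, mul_one, integrateSnd_apply]
    congr 1
    rw [← integral_mul_left_eq_self _ x]
    refine integral_congr_ae (.of_forall fun t => ?_)
    change f (x * t) * v ((x * t)⁻¹ * x) = f (x * t) * v t
    rw [← hv.symm t]
    congr 2
    group
  have bound (x : G) : ‖integrateSnd (convolutionKernel f v) x - f x‖ ≤ L.indicator (fun _ => δ) x := by
    rw [key]
    by_cases hx : x ∈ L
    · rw [Set.indicator_of_mem hx]
      have h2 : ∫ t, δ * ‖v t‖ ∂(haar : Measure G) = δ := by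
        rw [integral_const_mul, hv.integral, mul_one]
      refine (norm_integral_le_of_norm_le hvi (.of_forall fun t => ?_)).trans_eq h2
      rw [norm_mul]
      by_cases ht : t ∈ U
      · exact mul_le_mul_of_nonneg_right ((hUS ht).2 x) (norm_nonneg _)
      · simp [hv.eq_zero t ht]
    · rw [Set.indicator_of_notMem hx]
      have e2 : f x = 0 := by
        by_contra h
        exact hx ⟨(x, 1), ⟨subset_tsupport _ h, mem_of_mem_nhds hV1⟩, by simp⟩
      have e (t : G) : (f (x * t) - f x) * v t = 0 := by
        by_cases ht : t ∈ U
        · have e1 : f (x * t) = 0 := by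
            by_contra h
            exact hx ⟨(x * t, t), ⟨subset_tsupport _ h, (hUS ht).1⟩, by simp⟩
          rw [e1, e2, sub_zero, zero_mul]
        · rw [hv.eq_zero t ht, mul_zero]
      simp [e]
  rw [dist_eq_norm, ofCc_mul_ofCc, ← map_sub, norm_ofCc]
  have h3 : ∫ x, ω x * ‖(integrateSnd (convolutionKernel f v) - f) x‖ ∂haar ≤ δ * c := by
    rw [← integral_const_mul, ← integral_indicator hL.measurableSet]
    refine integral_mono_of_nonneg (.of_forall fun x => mul_nonneg (ω.pos x).le (norm_nonneg _))
      ((integrable_indicator_iff hL.measurableSet).2 (hωL.const_mul δ)) (.of_forall fun x => ?_)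
    have := mul_le_mul_of_nonneg_left (bound x) (ω.pos x).le
    refine this.trans_eq ?_
    by_cases hx : x ∈ L <;> simp [hx, mul_comm]
  refine h3.trans_lt ?_
  rw [div_mul_eq_mul_div, div_lt_iff₀ (by positivity)]
  nlinarith

theorem tendsto_mul_mollifier {u : Set G → C_c(G, ℂ)}
    (hu : ∀ U ∈ 𝓝 (1 : G), IsMollifier U (u U)) (f : WeightedL1 ω) :
    Filter.Tendsto (fun U => f * ofCc ω (u U)) (smallNhdsOne G) (𝓝 f) := by
  have hω2 : {x : G | ω x ≤ 2} ∈ 𝓝 (1 : G) := by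
    have := ω.continuous'.tendsto 1
    rw [ω.map_one'] at this
    exact (this.eventually_lt_const (by norm_num : (1 : ℝ) < 2)).mono fun x hx => hx.le
  have hmem : ∀ᶠ U in smallNhdsOne G, U ∈ 𝓝 (1 : G) ∧ U ⊆ {x : G | ω x ≤ 2} :=
    eventually_smallNhdsOne hω2
  rw [Metric.tendsto_nhds]
  intro ε hε
  -- Since `‖u‖ ≤ 2`, the three errors add up to less than `2 · ε/4 + ε/4 + ε/4`.
  obtain ⟨g, hg⟩ := Metric.denseRange_iff.1 (denseRange_ofCc (ω := ω)) f (ε / 4) (by positivity)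
  filter_upwards [hmem, Metric.tendsto_nhds.1 (tendsto_ofCc_mul_mollifier (ω := ω) hu g) (ε / 4)
    (by positivity)] with U ⟨hU, hU2⟩ h
  have h2 := norm_ofCc_le_two (hu U hU) hU2
  rw [dist_eq_norm] at hg h ⊢
  have e : f * ofCc ω (u U) - f = (f - ofCc ω g) * ofCc ω (u U) +
      (ofCc ω g * ofCc ω (u U) - ofCc ω g) - (f - ofCc ω g) := by
    rw [sub_mul]
    abel
  have h3 := norm_mul_le (f - ofCc ω g) (ofCc ω (u U))
  rw [e]
  refine (norm_sub_le _ _).trans_lt ?_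
  have h4 := norm_add_le ((f - ofCc ω g) * ofCc ω (u U)) (ofCc ω g * ofCc ω (u U) - ofCc ω g)
  nlinarith [norm_nonneg (f - ofCc ω g)]

end WeightedL1

end ApproximateIdentity

/-- The weight `(x, y) ↦ ω(x) ω'(y)`. -/
def Weight.prod {G H : Type*} [Group G] [TopologicalSpace G] [Group H] [TopologicalSpace H]
    (ω : Weight G) (ω' : Weight H) : Weight (G × H) where
  toFun := fun t => ω t.1 * ω' t.2
  continuous' := (ω.continuous'.comp continuous_fst).mul (ω'.continuous'.comp continuous_snd)
  one_le' := fun t => one_le_mul_of_one_le_of_one_le (ω.one_le' _) (ω'.one_le' _)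
  mul_le' := fun s t => by
    calc ω (s.1 * t.1) * ω' (s.2 * t.2) ≤ (ω s.1 * ω t.1) * (ω' s.2 * ω' t.2) :=
          mul_le_mul (ω.mul_le' _ _) (ω'.mul_le' _ _) (ω'.pos _).le
            (mul_nonneg (ω.pos _).le (ω.pos _).le)
      _ = _ := by ring
  map_one' := by simp [ω.map_one', ω'.map_one']

theorem Weight.prod_apply {G H : Type*} [Group G] [TopologicalSpace G] [Group H]
    [TopologicalSpace H] (ω : Weight G) (ω' : Weight H) (t : G × H) :
    ω.prod ω' t = ω t.1 * ω' t.2 := rfl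

/-! ### Tensor products and their density -/

section Tensor

variable {X Y : Type*} [TopologicalSpace X] [TopologicalSpace Y]

theorem hasCompactSupport_tensor {R : Type*} [MulZeroClass R] [TopologicalSpace R] {φ : X → R}
    {ψ : Y → R} (hφ : HasCompactSupport φ) (hψ : HasCompactSupport ψ) [T2Space X] [T2Space Y] :
    HasCompactSupport fun t : X × Y => φ t.1 * ψ t.2 := by
  refine HasCompactSupport.intro (hφ.isCompact.prod hψ.isCompact) fun t ht => ?_
  by_contra h
  exact ht ⟨subset_tsupport _ (left_ne_zero_of_mul h), subset_tsupport _ (right_ne_zero_of_mul h)⟩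

variable [T2Space X] [T2Space Y]

/-- The tensor product `(x, y) ↦ φ(x) ψ(y)`. -/
def tensor (φ : C_c(X, ℂ)) (ψ : C_c(Y, ℂ)) : C_c(X × Y, ℂ) where
  toFun := fun t => φ t.1 * ψ t.2
  hasCompactSupport' := hasCompactSupport_tensor φ.hasCompactSupport ψ.hasCompactSupport

@[simp]
theorem tensor_apply (φ : C_c(X, ℂ)) (ψ : C_c(Y, ℂ)) (t : X × Y) :
    tensor φ ψ t = φ t.1 * ψ t.2 := rfl

variable (X Y) in
/-- The tensor product of functions as a bilinear map. -/
def tensorₗ : C_c(X, ℂ) →ₗ[ℂ] C_c(Y, ℂ) →ₗ[ℂ] C_c(X × Y, ℂ) :=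
  LinearMap.mk₂ ℂ tensor (fun _ _ _ => by ext; simp [add_mul]) (fun _ _ _ => by ext; simp [mul_assoc])
    (fun _ _ _ => by ext; simp [mul_add]) (fun _ _ _ => by ext; simp [mul_left_comm])

@[simp]
theorem tensorₗ_apply (φ : C_c(X, ℂ)) (ψ : C_c(Y, ℂ)) : tensorₗ X Y φ ψ = tensor φ ψ := rfl

theorem exists_cutoff [LocallyCompactSpace X] {K : Set X} (hK : IsCompact K) :
    ∃ F : C_c(X, ℂ), (∀ x ∈ K, F x = 1) ∧ ∀ x, ‖F x‖ ≤ 1 := by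
  obtain ⟨g, hg1, hg2, -, hg4⟩ := exists_continuousMap_one_of_isCompact_subset_isOpen hK
    isOpen_univ (Set.subset_univ K)
  have hgc : HasCompactSupport g := hg2
  refine ⟨⟨⟨fun x => (g x : ℂ), by fun_prop⟩, hgc.comp_left (g := fun r : ℝ => (r : ℂ)) rfl⟩,
    fun x hx => ?_, fun x => ?_⟩
  · have : g x = 1 := hg1 hx
    change ((g x : ℝ) : ℂ) = 1
    rw [this, Complex.ofReal_one]
  · change ‖((g x : ℝ) : ℂ)‖ ≤ 1
    rw [Complex.norm_real, Real.norm_eq_abs, abs_of_nonneg (hg4 x).1]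
    exact (hg4 x).2

theorem exists_continuousMap_ne [LocallyCompactSpace X] {x y : X} (h : x ≠ y) :
    ∃ f : C(X, ℂ), f x ≠ f y := by
  obtain ⟨g, hg1, -, hg3, -⟩ := exists_continuousMap_one_of_isCompact_subset_isOpen
    (isCompact_singleton (x := x)) (isOpen_compl_singleton (x := y)) (by simpa [eq_comm] using h)
  refine ⟨⟨fun x => (g x : ℂ), by fun_prop⟩, ?_⟩
  have h1 : g x = 1 := hg1 rfl
  have h2 : g y = 0 := by
    by_contra h0
    exact hg3 (subset_tsupport _ h0) rfl
  simp [h1, h2]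

/-- Restrictions to a set `S ⊆ X × Y` of functions `(x, y) ↦ a(x) b(y)`. -/
def elementaryTensors (S : Set (X × Y)) : Submonoid C(S, ℂ) where
  carrier := {h | ∃ (a : C(X, ℂ)) (b : C(Y, ℂ)), ∀ t : S, h t = a t.1.1 * b t.1.2}
  one_mem' := ⟨1, 1, by simp⟩
  mul_mem' := by
    rintro _ _ ⟨a, b, h⟩ ⟨a', b', h'⟩
    exact ⟨a * a', b * b', fun t => by simp [h, h', mul_mul_mul_comm]⟩

/-- Stone–Weierstrass: elementary tensors are closed under products and conjugation, so the star
algebra they generate is merely their span, and they separate points. -/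
theorem exists_mem_span_elementaryTensors_near [LocallyCompactSpace X] [LocallyCompactSpace Y]
    {S : Set (X × Y)} (hS : IsCompact S) (f : C(S, ℂ)) {ε : ℝ} (hε : 0 < ε) :
    ∃ h ∈ Submodule.span ℂ (elementaryTensors S : Set C(S, ℂ)), ∀ t, ‖h t - f t‖ < ε := by
  have := isCompact_iff_compactSpace.1 hS
  let A := StarAlgebra.adjoin ℂ (elementaryTensors S : Set C(S, ℂ))
  have hstar : star (elementaryTensors S : Set C(S, ℂ)) = elementaryTensors S := by
    have hsub : star (elementaryTensors S : Set C(S, ℂ)) ⊆ elementaryTensors S := by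
      rintro h ⟨a, b, hab⟩
      refine ⟨star a, star b, fun t => ?_⟩
      have := congrArg star (hab t)
      simpa using this
    refine hsub.antisymm fun h hh => ?_
    have : star h ∈ star (elementaryTensors S : Set C(S, ℂ)) := by simpa using hh
    exact hsub this
  have hA : Subalgebra.toSubmodule A.toSubalgebra = Submodule.span ℂ (elementaryTensors S : Set C(S, ℂ)) := by
    rw [StarAlgebra.adjoin_eq_span, hstar, Set.union_self, Submonoid.closure_eq]
  have hsep : A.SeparatesPoints := by
    intro s t hst
    have hmem (h : C(S, ℂ)) (hh : h ∈ elementaryTensors S) : h ∈ A :=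
      StarAlgebra.subset_adjoin ℂ _ hh
    by_cases h1 : s.1.1 = t.1.1
    · have h2 : s.1.2 ≠ t.1.2 := fun h2 => hst (Subtype.ext (Prod.ext h1 h2))
      obtain ⟨b, hb⟩ := exists_continuousMap_ne h2
      refine ⟨_, ⟨⟨fun t : S => b t.1.2, by fun_prop⟩, hmem _ ⟨1, b, by simp⟩, rfl⟩, hb⟩
    · obtain ⟨a, ha⟩ := exists_continuousMap_ne h1
      refine ⟨_, ⟨⟨fun t : S => a t.1.1, by fun_prop⟩, hmem _ ⟨a, 1, by simp⟩, rfl⟩, ha⟩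
  have htop := ContinuousMap.starSubalgebra_topologicalClosure_eq_top_of_separatesPoints A hsep
  have hf : f ∈ closure (A : Set C(S, ℂ)) := by
    rw [← StarSubalgebra.topologicalClosure_coe, htop]
    trivial
  obtain ⟨h, hhA, hh⟩ := Metric.mem_closure_iff.1 hf ε hε
  refine ⟨h, ?_, fun t => ?_⟩
  · rw [← hA]
    exact hhA
  · rw [dist_comm] at hh
    rw [← dist_eq_norm]
    exact (ContinuousMap.dist_apply_le_dist t).trans_lt hh

/-- Continuous functions with compact support on a product are uniform limits of sums of elementary
tensors with supports in a fixed compact set. -/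
theorem exists_mem_span_tensor_near [LocallyCompactSpace X] [LocallyCompactSpace Y]
    (k : C_c(X × Y, ℂ)) : ∃ S : Set (X × Y), IsCompact S ∧ ∀ ε > (0 : ℝ),
      ∃ m ∈ Submodule.span ℂ {p : C_c(X × Y, ℂ) | ∃ φ ψ, p = tensor φ ψ},
        ∀ t, ‖m t - k t‖ ≤ S.indicator (fun _ => ε) t := by
  obtain ⟨F, hF, hF'⟩ := exists_cutoff (k.hasCompactSupport.isCompact.image continuous_fst)
  obtain ⟨F₂, hF₂, hF₂'⟩ := exists_cutoff (k.hasCompactSupport.isCompact.image continuous_snd)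
  -- The approximants are multiplied by the cutoff `F ⊗ F₂`. It confines them to `S` and leaves `k`
  -- unchanged, being `1` on the support of `k`.
  let S := tsupport F ×ˢ tsupport F₂
  have hS : IsCompact S := F.hasCompactSupport.isCompact.prod F₂.hasCompactSupport.isCompact
  have hFS (t : X × Y) (ht : t ∉ S) : tensor F F₂ t = 0 := by
    by_contra h
    exact ht ⟨subset_tsupport _ (left_ne_zero_of_mul h), subset_tsupport _ (right_ne_zero_of_mul h)⟩
  have hk (t : X × Y) : k t = tensor F F₂ t * k t := by
    by_cases ht : t ∈ tsupport k
    · rw [tensor_apply, hF _ ⟨t, ht, rfl⟩, hF₂ _ ⟨t, ht, rfl⟩, one_mul, one_mul]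
    · rw [image_eq_zero_of_notMem_tsupport ht, mul_zero]
  refine ⟨S, hS, fun ε hε => ?_⟩
  obtain ⟨h, hh, hhk⟩ := exists_mem_span_elementaryTensors_near hS
    (k.toContinuousMap.restrict S) hε
  have hm : ∃ m ∈ Submodule.span ℂ {p : C_c(X × Y, ℂ) | ∃ φ ψ, p = tensor φ ψ},
      (∀ t : S, m t = tensor F F₂ t * h t) ∧ ∀ t ∉ S, m t = 0 := by
    clear hhk
    induction hh using Submodule.span_induction with
    | mem h hh =>
      obtain ⟨a, b, hab⟩ := hh
      refine ⟨tensor ⟨a * F.toContinuousMap, F.hasCompactSupport.mul_left⟩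
        ⟨b * F₂.toContinuousMap, F₂.hasCompactSupport.mul_left⟩,
        Submodule.subset_span ⟨_, _, rfl⟩, fun t => ?_, fun t ht => ?_⟩
      · rw [hab]
        change a t.1.1 * F t.1.1 * (b t.1.2 * F₂ t.1.2) = F t.1.1 * F₂ t.1.2 * _
        ring
      · have := hFS t ht
        change a t.1 * F t.1 * (b t.2 * F₂ t.2) = 0
        rw [mul_mul_mul_comm, ← tensor_apply, this, mul_zero]
    | zero => exact ⟨0, Submodule.zero_mem _, by simp, by simp⟩
    | add h h' _ _ ih ih' =>
      obtain ⟨m, hm, h1, h2⟩ := ih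
      obtain ⟨m', hm', h1', h2'⟩ := ih'
      exact ⟨m + m', Submodule.add_mem _ hm hm', fun t => by simp [h1, h1', mul_add],
        fun t ht => by simp [h2 t ht, h2' t ht]⟩
    | smul c h _ ih =>
      obtain ⟨m, hm, h1, h2⟩ := ih
      exact ⟨c • m, Submodule.smul_mem _ _ hm, fun t => by simp [h1, mul_left_comm],
        fun t ht => by simp [h2 t ht]⟩
  obtain ⟨m, hm, h1, h2⟩ := hm
  refine ⟨m, hm, fun t => ?_⟩
  by_cases ht : t ∈ S
  · rw [Set.indicator_of_mem ht, h1 ⟨t, ht⟩, hk t, ← mul_sub, norm_mul]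
    have e1 : ‖tensor F F₂ t‖ ≤ 1 := by
      rw [tensor_apply, norm_mul]
      exact mul_le_one₀ (hF' _) (norm_nonneg _) (hF₂' _)
    have e2 : ‖h ⟨t, ht⟩ - k t‖ ≤ ε := (hhk ⟨t, ht⟩).le
    exact (mul_le_of_le_one_left (norm_nonneg _) e1).trans e2
  · rw [Set.indicator_of_notMem ht, h2 t ht, hk t, hFS t ht]
    simp

end Tensor

namespace WeightedL1

variable {G H : Type*} [Group G] [TopologicalSpace G] [IsTopologicalGroup G]
  [LocallyCompactSpace G] [T2Space G] [MeasurableSpace G] [BorelSpace G]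
  [Group H] [TopologicalSpace H] [IsTopologicalGroup H]
  [LocallyCompactSpace H] [T2Space H] [MeasurableSpace H] [BorelSpace H]
  [MeasurableSpace (G × H)] [BorelSpace (G × H)] {ω : Weight G} {ω' : Weight H}

theorem norm_ofCc_tensor (φ : C_c(G, ℂ)) (ψ : C_c(H, ℂ)) :
    ‖ofCc (ω.prod ω') (tensor φ ψ)‖ =
      haarProdFactor G H * (‖ofCc ω φ‖ * ‖ofCc ω' ψ‖) := by
  have hω := ω.continuous'
  have hω' := ω'.continuous'
  have hφ : HasCompactSupport fun x => ω x * ‖φ x‖ := φ.hasCompactSupport.norm.mul_left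
  have hψ : HasCompactSupport fun y => ω' y * ‖ψ y‖ := ψ.hasCompactSupport.norm.mul_left
  have hs : HasCompactSupport fun t : G × H => (ω t.1 * ‖φ t.1‖) * (ω' t.2 * ‖ψ t.2‖) :=
    hasCompactSupport_tensor (φ := fun x => ω x * ‖φ x‖) (ψ := fun y => ω' y * ‖ψ y‖) hφ hψ
  have hc : Continuous fun t : G × H => (ω t.1 * ‖φ t.1‖) * (ω' t.2 * ‖ψ t.2‖) := by fun_prop
  obtain ⟨k, hk⟩ : ∃ k : C_c(G × H, ℝ), ∀ t, k t = (ω t.1 * ‖φ t.1‖) * (ω' t.2 * ‖ψ t.2‖) :=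
    ⟨⟨⟨_, hc⟩, hs⟩, fun _ => rfl⟩
  have h := integral_haar_prod_real k
  simp only [hk, integral_const_mul, integral_mul_const] at h
  rw [norm_ofCc, norm_ofCc, norm_ofCc, ← h]
  refine integral_congr_ae (.of_forall fun t => ?_)
  simp only [Weight.prod_apply, tensor_apply, norm_mul]
  ring

/-- The weight is integrable on a compact set, so uniform approximation by sums of tensors supported
in one compact set is approximation in the weighted norm. -/
theorem clm_ext_tensor {E : Type*} [NormedAddCommGroup E] [NormedSpace ℂ E]
    {S T : WeightedL1 (ω.prod ω') →L[ℂ] E}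
    (h : ∀ φ ψ, S (ofCc _ (tensor φ ψ)) = T (ofCc _ (tensor φ ψ))) : S = T := by
  refine clm_ext fun k => ?_
  obtain ⟨K, hK, hk⟩ := exists_mem_span_tensor_near k
  have hspan (m : C_c(G × H, ℂ))
      (hm : m ∈ Submodule.span ℂ {p : C_c(G × H, ℂ) | ∃ φ ψ, p = tensor φ ψ}) :
      S (ofCc _ m) = T (ofCc _ m) := by
    induction hm using Submodule.span_induction with
    | mem m hm =>
      obtain ⟨φ, ψ, rfl⟩ := hm
      exact h φ ψ
    | zero => simp
    | add m m' _ _ h1 h2 => rw [map_add, map_add, map_add, h1, h2]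
    | smul c m _ h1 => rw [map_smul, map_smul, map_smul, h1]
  have hωK : IntegrableOn (ω.prod ω') K haar :=
    (ω.prod ω').continuous'.continuousOn.integrableOn_compact hK
  let c := ∫ t in K, ω.prod ω' t ∂haar
  have hc : 0 ≤ c := integral_nonneg fun t => ((ω.prod ω').pos t).le
  have hmem : ofCc (ω.prod ω') k ∈ closure {f | S f = T f} := by
    refine Metric.mem_closure_iff.2 fun ε hε => ?_
    have hδ : 0 < ε / (c + 1) := by positivity
    obtain ⟨m, hm, hmk⟩ := hk _ hδ
    refine ⟨ofCc _ m, hspan m hm, ?_⟩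
    rw [dist_comm, dist_eq_norm, ← map_sub, norm_ofCc]
    have h3 : ∫ t, ω.prod ω' t * ‖(m - k) t‖ ∂haar ≤ ε / (c + 1) * c := by
      rw [← integral_const_mul, ← integral_indicator hK.measurableSet]
      refine integral_mono_of_nonneg
        (.of_forall fun t => mul_nonneg ((ω.prod ω').pos t).le (norm_nonneg _))
        ((integrable_indicator_iff hK.measurableSet).2 (hωK.const_mul _)) (.of_forall fun t => ?_)
      refine (mul_le_mul_of_nonneg_left (hmk t) ((ω.prod ω').pos t).le).trans_eq ?_
      by_cases ht : t ∈ K <;> simp [ht, mul_comm]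
    refine h3.trans_lt ?_
    rw [div_mul_eq_mul_div, div_lt_iff₀ (by positivity)]
    nlinarith
  rw [(isClosed_eq S.continuous T.continuous).closure_eq] at hmem
  exact hmem

/-- The tensor product of a continuous function with compact support and an element of
`L¹(H, ω')`. -/
def ccTensor (ω : Weight G) (ω' : Weight H) :
    C_c(G, ℂ) →ₗ[ℂ] WeightedL1 ω' →L[ℂ] WeightedL1 (ω.prod ω') :=
  have hb (φ : C_c(G, ℂ)) (ψ : C_c(H, ℂ)) : ‖(ofCc (ω.prod ω') ∘ₗ tensorₗ G H φ) ψ‖ ≤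
      haarProdFactor G H * ‖ofCc ω φ‖ * ‖ofCc ω' ψ‖ :=
    ((norm_ofCc_tensor φ ψ).trans (mul_assoc _ _ _).symm).le
  have he (φ : C_c(G, ℂ)) (ψ : C_c(H, ℂ)) :
      (ofCc (ω.prod ω') ∘ₗ tensorₗ G H φ).extendOfNorm (ofCc ω') (ofCc ω' ψ) =
        ofCc (ω.prod ω') (tensor φ ψ) :=
    LinearMap.extendOfNorm_eq denseRange_ofCc ⟨_, hb φ⟩ ψ
  { toFun := fun φ => (ofCc (ω.prod ω') ∘ₗ tensorₗ G H φ).extendOfNorm (ofCc ω')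
    map_add' := fun φ φ' => clm_ext fun ψ => by
      rw [_root_.add_apply, he, he, he, ← map_add, ← tensorₗ_apply, map_add,
        LinearMap.add_apply, tensorₗ_apply, tensorₗ_apply]
    map_smul' := fun c φ => clm_ext fun ψ => by
      rw [RingHom.id_apply, _root_.smul_apply, he, he, ← map_smul, ← tensorₗ_apply,
        map_smul, LinearMap.smul_apply, tensorₗ_apply] }

theorem ccTensor_apply (φ : C_c(G, ℂ)) (ψ : C_c(H, ℂ)) :
    ccTensor ω ω' φ (ofCc ω' ψ) = ofCc (ω.prod ω') (tensor φ ψ) :=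
  LinearMap.extendOfNorm_eq denseRange_ofCc ⟨haarProdFactor G H * ‖ofCc ω φ‖, fun ψ =>
    ((norm_ofCc_tensor φ ψ).trans (mul_assoc _ _ _).symm).le⟩ ψ

/-- `ccTensor` is an extension by continuity in the second factor; this bound allows the same in the
first, which yields `tmul`. -/
theorem norm_ccTensor_le (φ : C_c(G, ℂ)) :
    ‖ccTensor ω ω' φ‖ ≤ haarProdFactor G H * ‖ofCc ω φ‖ := by
  refine ContinuousLinearMap.opNorm_le_bound _ (by positivity) fun f => ?_
  exact LinearMap.norm_extendOfNorm_apply_le denseRange_ofCc _ (fun ψ =>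
    ((norm_ofCc_tensor φ ψ).trans (mul_assoc _ _ _).symm).le) f

/-- The tensor product `L¹(G, ω) × L¹(H, ω') → L¹(G × H, ω ⊗ ω')`. -/
def tmul (ω : Weight G) (ω' : Weight H) :
    WeightedL1 ω →L[ℂ] WeightedL1 ω' →L[ℂ] WeightedL1 (ω.prod ω') :=
  (ccTensor ω ω').extendOfNorm (ofCc ω)

theorem tmul_ofCc (φ : C_c(G, ℂ)) (ψ : C_c(H, ℂ)) :
    tmul ω ω' (ofCc ω φ) (ofCc ω' ψ) = ofCc (ω.prod ω') (tensor φ ψ) := by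
  rw [← ccTensor_apply, tmul, LinearMap.extendOfNorm_eq denseRange_ofCc ⟨_, norm_ccTensor_le⟩]

end WeightedL1

/-! ### Open σ-compact subgroups and gluing along cosets -/

section Gluing

variable {G : Type*} [Group G] [TopologicalSpace G] [IsTopologicalGroup G]

-- The subgroup generated by a compact neighbourhood of the identity. It stands in for σ-compactness
-- of `G`: its cosets are clopen translates, and a compact set meets only finitely many of them.
open scoped Pointwise in
theorem exists_open_sigmaCompact_subgroup [LocallyCompactSpace G] :
    ∃ (S : Subgroup G) (K : ℕ → Set G), IsOpen (S : Set G) ∧ (∀ n, IsCompact (K n)) ∧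
      (S : Set G) = ⋃ n, K n := by
  obtain ⟨C, hC, hC1⟩ := exists_compact_mem_nhds (1 : G)
  let D := C ∪ C⁻¹
  have hD : IsCompact D := hC.union hC.inv
  have hDinv : D⁻¹ = D := by simp [D, Set.union_inv, Set.union_comm]
  have hpow (n : ℕ) : IsCompact (D ^ n) := by
    induction n with
    | zero => simp [← Set.singleton_one]
    | succ n ih =>
      rw [pow_succ]
      exact ih.mul hD
  let S : Subgroup G :=
    { carrier := ⋃ n : ℕ, D ^ n
      mul_mem' := by
        rintro a b ha hb
        obtain ⟨m, hm⟩ := Set.mem_iUnion.1 ha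
        obtain ⟨n, hn⟩ := Set.mem_iUnion.1 hb
        exact Set.mem_iUnion.2 ⟨m + n, by rw [pow_add]; exact Set.mul_mem_mul hm hn⟩
      one_mem' := Set.mem_iUnion.2 ⟨0, by simp⟩
      inv_mem' := by
        rintro a ha
        obtain ⟨m, hm⟩ := Set.mem_iUnion.1 ha
        refine Set.mem_iUnion.2 ⟨m, ?_⟩
        rw [← hDinv, inv_pow]
        exact Set.inv_mem_inv.2 hm }
  refine ⟨S, fun n => D ^ n, ?_, hpow, rfl⟩
  refine S.isOpen_of_mem_nhds (g := 1) (Filter.mem_of_superset hC1 fun x hx => ?_)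
  exact Set.mem_iUnion.2 ⟨1, by rw [pow_one]; exact Or.inl hx⟩

theorem eventually_mk_eq {S : Subgroup G} (hS : IsOpen (S : Set G)) (x : G) :
    ∀ᶠ y : G in 𝓝 x, (y : G ⧸ S) = x := by
  have := QuotientGroup.discreteTopology hS
  have hc : Continuous (QuotientGroup.mk : G → G ⧸ S) := QuotientGroup.continuous_mk
  exact (hc.tendsto x).eventually (p := fun c => c = (x : G ⧸ S)) (by simp [nhds_discrete])

theorem continuous_glue {S : Subgroup G} (hS : IsOpen (S : Set G)) {E : Type*}
    [TopologicalSpace E] {F : G ⧸ S → G → E} (hF : ∀ c, Continuous (F c)) :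
    Continuous fun x : G => F x x := by
  refine continuous_iff_continuousAt.2 fun x => ?_
  refine ((hF x).tendsto x).congr' ?_
  filter_upwards [eventually_mk_eq hS x] with y hy
  rw [hy]

theorem isClopen_coset {S : Subgroup G} (hS : IsOpen (S : Set G)) (c : G ⧸ S) :
    IsClopen {x : G | (x : G ⧸ S) = c} := by
  have := QuotientGroup.discreteTopology hS
  exact (isClopen_discrete {c}).preimage QuotientGroup.continuous_mk

variable [LocallyCompactSpace G] [MeasurableSpace G] [BorelSpace G] [T2Space G]

theorem exists_continuous_integrable_pos {K : ℕ → Set G} (hK : ∀ n, IsCompact (K n)) :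
    ∃ v : G → ℝ, Continuous v ∧ (∀ x, 0 ≤ v x) ∧ (∀ x ∈ ⋃ n, K n, 0 < v x) ∧
      Integrable v (haar : Measure G) := by
  choose F hF1 hF2 hF3 hF4 using fun n =>
    exists_continuousMap_one_of_isCompact_subset_isOpen (hK n) isOpen_univ (Set.subset_univ _)
  have hFi (n : ℕ) : Integrable (F n) (haar : Measure G) :=
    (F n).continuous.integrable_of_hasCompactSupport (hF2 n)
  let I (n : ℕ) : ℝ := ∫ x, F n x ∂(haar : Measure G)
  have hI (n : ℕ) : 0 ≤ I n := integral_nonneg fun x => (hF4 n x).1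
  -- Chosen so that `a n ≤ 2⁻ⁿ`, for uniform convergence, and `a n * I n ≤ 2⁻ⁿ`, for integrability
  -- of the sum.
  let a (n : ℕ) : ℝ := (1 / 2) ^ n / (1 + I n)
  have ha (n : ℕ) : 0 < a n := div_pos (by positivity) (by linarith [hI n])
  have ha' (n : ℕ) : a n ≤ (1 / 2) ^ n := div_le_self (by positivity) (by linarith [hI n])
  have haI (n : ℕ) : a n * I n ≤ (1 / 2) ^ n := by
    rw [div_mul_eq_mul_div, div_le_iff₀ (by linarith [hI n])]
    exact mul_le_mul_of_nonneg_left (by linarith) (by positivity)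
  have hg : Summable fun n : ℕ => ((1 : ℝ) / 2) ^ n := summable_geometric_two
  have hnn (n : ℕ) (x : G) : 0 ≤ a n * F n x := mul_nonneg (ha n).le (hF4 n x).1
  have hle (n : ℕ) (x : G) : a n * F n x ≤ (1 / 2) ^ n :=
    (mul_le_of_le_one_right (ha n).le (hF4 n x).2).trans (ha' n)
  have hs (x : G) : Summable fun n => a n * F n x :=
    Summable.of_nonneg_of_le (fun n => hnn n x) (fun n => hle n x) hg
  have hcont : Continuous fun x => ∑' n, a n * F n x := by
    refine continuous_tsum (fun n => by fun_prop) hg fun n x => ?_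
    rw [Real.norm_eq_abs, abs_of_nonneg (hnn n x)]
    exact hle n x
  refine ⟨fun x => ∑' n, a n * F n x, hcont, fun x => tsum_nonneg fun n => hnn n x,
    fun x hx => ?_, hcont.measurable.aestronglyMeasurable, ?_⟩
  · obtain ⟨n, hn⟩ := Set.mem_iUnion.1 hx
    refine (hs x).tsum_pos (fun n => hnn n x) n ?_
    have : F n x = 1 := hF1 n hn
    rw [this, mul_one]
    exact ha n
  · rw [hasFiniteIntegral_iff_ofReal (.of_forall fun x => tsum_nonneg fun n => hnn n x)]
    simp only [fun x => ENNReal.ofReal_tsum_of_nonneg (fun n => hnn n x) (hs x)]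
    rw [lintegral_tsum fun n => (by fun_prop : Continuous fun x => a n * F n x).measurable.ennreal_ofReal.aemeasurable]
    have h1 (n : ℕ) : ∫⁻ x, ENNReal.ofReal (a n * F n x) ∂haar ≤ ENNReal.ofReal ((1 / 2) ^ n) := by
      rw [← ofReal_integral_eq_lintegral_ofReal ((hFi n).const_mul _) (.of_forall (hnn n)),
        integral_const_mul]
      exact ENNReal.ofReal_le_ofReal (haI n)
    refine (ENNReal.tsum_le_tsum h1).trans_lt ?_
    rw [← ENNReal.ofReal_tsum_of_nonneg (fun n => by positivity) hg]
    exact ENNReal.ofReal_lt_top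

variable (G) in
/-- There is a continuous positive function which is integrable on every coset of some open
subgroup. -/
theorem exists_continuous_integrableOn_coset :
    ∃ (S : Subgroup G) (v : G → ℝ), IsOpen (S : Set G) ∧ Continuous v ∧ (∀ x, 0 < v x) ∧
      ∀ c : G ⧸ S, IntegrableOn v {x : G | (x : G ⧸ S) = c} haar := by
  obtain ⟨S, K, hS, hK, hSK⟩ := exists_open_sigmaCompact_subgroup (G := G)
  obtain ⟨v, hvc, -, hvpos, hvi⟩ := exists_continuous_integrable_pos hK
  rw [← hSK] at hvpos
  -- On each coset, `v` is moved over from `S` by a chosen representative. Left invariance keeps it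
  -- integrable there.
  refine ⟨S, fun x => v ((x : G ⧸ S).out⁻¹ * x), hS,
    continuous_glue hS (F := fun c x => v (c.out⁻¹ * x)) fun c => by fun_prop, fun x => ?_,
    fun c => ?_⟩
  · refine hvpos _ ?_
    exact QuotientGroup.eq.1 (QuotientGroup.out_eq' _)
  · refine IntegrableOn.congr_fun (f := fun x => v (c.out⁻¹ * x))
      ((hvi.comp_mul_left c.out⁻¹).integrableOn) ?_ (isClopen_coset hS c).isOpen.measurableSet
    rintro x rfl
    rfl

/-- Functions on the cosets of an open subgroup can be glued to a Borel function, up to null sets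
in each coset. -/
theorem exists_measurable_glue {S : Subgroup G} (hS : IsOpen (S : Set G))
    (p : G ⧸ S → Lp ℂ 2 (haar : Measure G)) :
    ∃ P : G → ℂ, Measurable P ∧
      ∀ c, ∀ᵐ x : G ∂haar, (x : G ⧸ S) = c → P x = p c x := by
  -- Borel functions on uncountably many cosets need not glue to a Borel function, but continuous
  -- ones glue to a continuous function. Hence each `p c` is written as an almost everywhere limit
  -- of `C_c` functions, these are glued for each `n`, and the limit is taken afterwards.
  have h (c : G ⧸ S) : ∃ F : ℕ → C_c(G, ℂ), ∀ᵐ x ∂(haar : Measure G),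
      Filter.Tendsto (fun n => F n x) Filter.atTop (𝓝 (p c x)) := by
    choose g hg using fun n : ℕ => (Lp.memLp (p c)).exists_compactlySupported_eLpNorm_sub_le
      ENNReal.ofNat_ne_top (ε := ((n : ℝ≥0∞) + 1)⁻¹) (by simp)
    have hg0 : Filter.Tendsto (fun n => eLpNorm (⇑(g n) - ⇑(p c)) 2 (haar : Measure G)) Filter.atTop
        (𝓝 0) := by
      refine tendsto_of_tendsto_of_tendsto_of_le_of_le tendsto_const_nhds
        (ENNReal.tendsto_inv_nat_nhds_zero.comp (Filter.tendsto_add_atTop_nat 1))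
        (fun _ => zero_le) fun n => ?_
      rw [← eLpNorm_neg, neg_sub]
      simpa using hg n
    have hm := tendstoInMeasure_of_tendsto_eLpNorm (by simp)
      (fun n => (g n).continuous.measurable.aestronglyMeasurable) (Lp.aestronglyMeasurable (p c)) hg0
    obtain ⟨ns, -, hns⟩ := hm.exists_seq_tendsto_ae
    exact ⟨fun n => g (ns n), hns⟩
  choose F hF using h
  have hcont (n : ℕ) : Continuous fun x : G => F x n x :=
    continuous_glue hS (F := fun c => F c n) fun c => (F c n).continuous
  refine ⟨fun x => Filter.limUnder Filter.atTop fun n => F x n x,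
    (StronglyMeasurable.limUnder fun n => (hcont n).measurable.stronglyMeasurable).measurable,
    fun c => ?_⟩
  filter_upwards [hF c] with x hx hxc
  rw [hxc]
  exact hx.limUnder_eq

end Gluing

/-! ### The dual of `L¹(G, ω)` -/

namespace WeightedL1

variable {G : Type*} [Group G] [TopologicalSpace G] [IsTopologicalGroup G]
  [LocallyCompactSpace G] [MeasurableSpace G] [BorelSpace G] {ω : Weight G}

theorem integrable_weight_mul_inv_mul {g : G → ℂ} (hg : Integrable g (haar : Measure G)) :
    Integrable (fun x => (ω x : ℂ) * ((ω x : ℂ)⁻¹ * g x)) (haar : Measure G) := by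
  refine hg.congr (.of_forall fun x => ?_)
  have : (ω x : ℂ) ≠ 0 := by exact_mod_cast (ω.pos x).ne'
  exact (mul_inv_cancel_left₀ this _).symm

theorem norm_eq_integral_of_ae {f : WeightedL1 ω} {g : G → ℂ}
    (h : (f : G → ℂ) =ᵐ[haar] fun x => (ω x : ℂ)⁻¹ * g x) : ‖f‖ = ∫ x, ‖g x‖ ∂haar := by
  rw [norm_eq_of_ae h]
  refine integral_congr_ae (.of_forall fun x => ?_)
  simp only [norm_mul, norm_inv, Complex.norm_real, Real.norm_eq_abs, abs_of_pos (ω.pos x)]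
  exact mul_inv_cancel_left₀ (ω.pos x).ne' _

theorem integral_norm_mul_le {X : Type*} [MeasurableSpace X] {μ : Measure X} {W g : X → ℂ}
    (hW : MemLp W 2 μ) (hg : MemLp g 2 μ) :
    ∫ x, ‖W x * g x‖ ∂μ ≤ (eLpNorm W 2 μ).toReal * (eLpNorm g 2 μ).toReal := by
  have hi : Integrable (fun x => W x * g x) μ := hW.integrable_mul hg
  have h : eLpNorm (W • g) 1 μ ≤ eLpNorm W 2 μ * eLpNorm g 2 μ :=
    eLpNorm_smul_le_mul_eLpNorm hg.1 hW.1
  rw [eLpNorm_one_eq_lintegral_enorm] at h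
  rw [integral_norm_eq_lintegral_enorm hi.1, ← ENNReal.toReal_mul]
  exact ENNReal.toReal_mono (ENNReal.mul_ne_top hW.2.ne hg.2.ne) h

/-- The map `φ ↦ W φ / ω` from `L²(G)` to `L¹(G, ω)`, for `W` in `L²(G)`. -/
def ofLpTwo (ω : Weight G) {W : G → ℂ} (hW : MemLp W 2 haar) (φ : Lp ℂ 2 (haar : Measure G)) :
    WeightedL1 ω :=
  ofIntegrable (fun x => (ω x : ℂ)⁻¹ * (W x * φ x))
    (integrable_weight_mul_inv_mul (hW.integrable_mul (Lp.memLp φ)))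

theorem coeFn_ofLpTwo {W : G → ℂ} (hW : MemLp W 2 haar) (φ : Lp ℂ 2 (haar : Measure G)) :
    (ofLpTwo ω hW φ : G → ℂ) =ᵐ[haar] fun x => (ω x : ℂ)⁻¹ * (W x * φ x) :=
  coeFn_ofIntegrable _ (integrable_weight_mul_inv_mul (hW.integrable_mul (Lp.memLp φ)))

theorem norm_ofLpTwo_le {W : G → ℂ} (hW : MemLp W 2 haar) (φ : Lp ℂ 2 (haar : Measure G)) :
    ‖ofLpTwo ω hW φ‖ ≤ (eLpNorm W 2 haar).toReal * ‖φ‖ := by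
  rw [norm_eq_integral_of_ae (coeFn_ofLpTwo hW φ), Lp.norm_def]
  exact integral_norm_mul_le hW (Lp.memLp φ)

/-- `ofLpTwo` as a continuous linear map. -/
def ofLpTwoCLM (ω : Weight G) {W : G → ℂ} (hW : MemLp W 2 haar) :
    Lp ℂ 2 (haar : Measure G) →L[ℂ] WeightedL1 ω :=
  LinearMap.mkContinuous
    { toFun := ofLpTwo ω hW
      map_add' := fun φ ψ => by
        apply ext_haar
        filter_upwards [coeFn_ofLpTwo (ω := ω) hW (φ + ψ), coeFn_ofLpTwo (ω := ω) hW φ,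
          coeFn_ofLpTwo (ω := ω) hW ψ, Lp.coeFn_add φ ψ,
          ω.haar_ac.ae_eq (coeFn_add (ofLpTwo ω hW φ) (ofLpTwo ω hW ψ))] with x h1 h2 h3 h4 h5
        rw [h1, h5, h2, h3, h4, Pi.add_apply]
        ring
      map_smul' := fun c φ => by
        apply ext_haar
        filter_upwards [coeFn_ofLpTwo (ω := ω) hW (c • φ), coeFn_ofLpTwo (ω := ω) hW φ,
          Lp.coeFn_smul c φ,
          ω.haar_ac.ae_eq (coeFn_smul c (ofLpTwo ω hW φ))] with x h1 h2 h3 h4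
        rw [RingHom.id_apply, h1, h4, h2, h3, Pi.smul_apply, smul_eq_mul]
        ring }
    (eLpNorm W 2 haar).toReal (norm_ofLpTwo_le hW)

/-- By Cauchy–Schwarz `φ ↦ W φ / ω` is bounded from `L²` to `L¹(G, ω)`. The pullback of `Λ` is a
functional on a Hilbert space, and the Riesz representation supplies a density without
Radon–Nikodym. -/
theorem exists_lp_two_apply_eq (Λ : WeightedL1 ω →L[ℂ] ℂ) {W : G → ℂ} (hW : MemLp W 2 haar) :
    ∃ p : Lp ℂ 2 (haar : Measure G), ∀ (g : G → ℂ) (f : WeightedL1 ω), MemLp g 2 haar →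
      ((f : G → ℂ) =ᵐ[haar] fun x => (ω x : ℂ)⁻¹ * (W x * g x)) →
        Λ f = ∫ x, starRingEnd ℂ (p x) * g x ∂haar := by
  let p := (InnerProductSpace.toDual ℂ (Lp ℂ 2 (haar : Measure G))).symm (Λ.comp (ofLpTwoCLM ω hW))
  refine ⟨p, fun g f hg hf => ?_⟩
  have h1 : inner ℂ p (hg.toLp g) = Λ (ofLpTwo ω hW (hg.toLp g)) :=
    InnerProductSpace.toDual_symm_apply
  have h2 : f = ofLpTwo ω hW (hg.toLp g) := by
    apply ext_haar
    filter_upwards [hf, coeFn_ofLpTwo (ω := ω) hW (hg.toLp g), hg.coeFn_toLp] with x h1 h2 h3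
    rw [h1, h2, h3]
  rw [h2, ← h1, L2.inner_def]
  refine integral_congr_ae ?_
  filter_upwards [hg.coeFn_toLp] with x hx
  rw [hx, RCLike.inner_apply, mul_comm]

theorem exists_lp_two_of_clm (Λ : WeightedL1 ω →L[ℂ] ℂ) {W : G → ℂ} (hW : MemLp W 2 haar) :
    ∃ p : Lp ℂ 2 (haar : Measure G),
      (∀ (g : G → ℂ) (f : WeightedL1 ω), MemLp g 2 haar →
        ((f : G → ℂ) =ᵐ[haar] fun x => (ω x : ℂ)⁻¹ * (W x * g x)) →
          Λ f = ∫ x, starRingEnd ℂ (p x) * g x ∂haar) ∧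
      ∀ᵐ x ∂(haar : Measure G), W x ≠ 0 → ‖p x‖ ≤ ‖Λ‖ * ‖W x‖ := by
  obtain ⟨p, hp⟩ := exists_lp_two_apply_eq Λ hW
  have hint {g : G → ℂ} (hg : MemLp g 2 haar) : Integrable (fun x => W x * g x) haar :=
    hW.integrable_mul hg
  refine ⟨p, hp, ?_⟩
  have hpW : Integrable (fun x => ‖p x‖ * ‖W x‖) (haar : Measure G) :=
    (Lp.memLp p).norm.integrable_mul hW.norm
  have hWW : Integrable (fun x => ‖Λ‖ * (‖W x‖ * ‖W x‖)) (haar : Measure G) :=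
    (hW.norm.integrable_mul hW.norm).const_mul _
  have key : (fun x => ‖p x‖ * ‖W x‖) ≤ᵐ[haar] fun x => ‖Λ‖ * (‖W x‖ * ‖W x‖) := by
    refine ae_le_of_forall_setIntegral_le hpW hWW fun s hs _ => ?_
    -- The phase of `p`, equal to `0` where `p` vanishes. Testing with `g = σ |W|` on `s` gives `∫_s
    -- |p| |W| ≤ ‖Λ‖ ∫_s |W|²` for all `s`, hence the pointwise bound.
    let σ : G → ℂ := fun x => p x / (‖p x‖ : ℝ)
    have hσm : AEStronglyMeasurable σ (haar : Measure G) := by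
      have h1 := (Lp.stronglyMeasurable p).measurable
      exact (h1.div (Complex.continuous_ofReal.measurable.comp h1.norm)).aestronglyMeasurable
    have hσ1 (x : G) : ‖σ x‖ ≤ 1 := by
      rw [norm_div, Complex.norm_real, norm_norm]
      exact div_self_le_one _
    let g : G → ℂ := s.indicator fun x => σ x * (‖W x‖ : ℝ)
    have hgW (x : G) : ‖g x‖ ≤ ‖W x‖ := by
      by_cases hx : x ∈ s
      · simp only [g, Set.indicator_of_mem hx, norm_mul, Complex.norm_real, norm_norm]
        exact mul_le_of_le_one_left (norm_nonneg _) (hσ1 x)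
      · simp [g, hx]
    have hg : MemLp g 2 haar := by
      refine MemLp.of_le hW ?_ (.of_forall hgW)
      exact (hσm.mul (Complex.continuous_ofReal.comp_aestronglyMeasurable hW.1.norm)).indicator hs
    let f : WeightedL1 ω := ofIntegrable (fun x => (ω x : ℂ)⁻¹ * (W x * g x))
      (integrable_weight_mul_inv_mul (hint hg))
    have hf := coeFn_ofIntegrable (ω := ω) (fun x => (ω x : ℂ)⁻¹ * (W x * g x))
      (integrable_weight_mul_inv_mul (hint hg))
    have h1 := hp g f hg hf
    have h2 : ∫ x, starRingEnd ℂ (p x) * g x ∂haar =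
        ((∫ x in s, ‖p x‖ * ‖W x‖ ∂haar : ℝ) : ℂ) := by
      rw [← integral_complex_ofReal, ← integral_indicator hs]
      refine integral_congr_ae (.of_forall fun x => ?_)
      by_cases hx : x ∈ s
      · simp only [g, σ, Set.indicator_of_mem hx]
        by_cases h0 : p x = 0
        · simp [h0]
        · have h0' : ((‖p x‖ : ℝ) : ℂ) ≠ 0 := by simpa using h0
          have h3 : starRingEnd ℂ (p x) * p x = ((‖p x‖ : ℝ) : ℂ) * (‖p x‖ : ℝ) := by
            rw [mul_comm, Complex.mul_conj, Complex.normSq_eq_norm_sq]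
            push_cast
            ring
          rw [← mul_assoc, mul_div_assoc', h3, mul_div_assoc, div_self h0', mul_one]
          push_cast
          rfl
      · simp [g, hx]
    have h4 : ‖f‖ ≤ ∫ x in s, ‖W x‖ * ‖W x‖ ∂haar := by
      rw [norm_eq_integral_of_ae hf, ← integral_indicator hs]
      refine integral_mono_of_nonneg (.of_forall fun x => norm_nonneg _)
        ((hW.norm.integrable_mul hW.norm).indicator hs) (.of_forall fun x => ?_)
      by_cases hx : x ∈ s
      · simp only [Set.indicator_of_mem hx, norm_mul]
        exact mul_le_mul_of_nonneg_left (hgW x) (norm_nonneg _)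
      · simp [g, hx]
    rw [integral_const_mul]
    have h5 : (0 : ℝ) ≤ ∫ x in s, ‖p x‖ * ‖W x‖ ∂haar :=
      integral_nonneg fun x => mul_nonneg (norm_nonneg _) (norm_nonneg _)
    calc ∫ x in s, ‖p x‖ * ‖W x‖ ∂haar = ‖Λ f‖ := by
          rw [h1, h2, Complex.norm_real, Real.norm_eq_abs, abs_of_nonneg h5]
      _ ≤ ‖Λ‖ * ‖f‖ := Λ.le_opNorm f
      _ ≤ _ := mul_le_mul_of_nonneg_left h4 (norm_nonneg _)
  filter_upwards [key] with x hx hx0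
  rw [← mul_assoc] at hx
  exact le_of_mul_le_mul_right hx (norm_pos_iff.2 hx0)

variable [T2Space G]

/-- The dual of `L¹(G, ω)` is `L^∞(G, 1/ω)`. -/
theorem exists_pairing_eq (Λ : WeightedL1 ω →L[ℂ] ℂ) :
    ∃ (q : G → ℂ) (hq : IsDominated ω q), pairing hq = Λ := by
  obtain ⟨S, v, hS, hv, hv0, hvi⟩ := exists_continuous_integrableOn_coset G
  -- As `v` is integrable on every coset, its square root cut off to one coset is an admissible `W`
  -- in `L²`.
  let w : G → ℂ := fun x => (√(v x) : ℝ)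
  have hwc : Continuous w := by fun_prop
  have hw0 (x : G) : w x ≠ 0 := by
    have := (Real.sqrt_pos.2 (hv0 x)).ne'
    exact Complex.ofReal_ne_zero.2 this
  have hwn (x : G) : ‖w x‖ = √(v x) := by
    rw [Complex.norm_real, Real.norm_eq_abs, abs_of_nonneg (Real.sqrt_nonneg _)]
  let W (c : G ⧸ S) : G → ℂ := {x : G | (x : G ⧸ S) = c}.indicator w
  have hW (c : G ⧸ S) : MemLp (W c) 2 haar := by
    have hm := (isClopen_coset hS c).isOpen.measurableSet
    have hWm : AEStronglyMeasurable (W c) (haar : Measure G) :=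
      hwc.measurable.aestronglyMeasurable.indicator hm
    rw [← memLp_norm_iff hWm, memLp_two_iff_integrable_sq hWm.norm]
    refine ((integrable_indicator_iff hm).2 (hvi c)).congr (.of_forall fun x => ?_)
    by_cases hx : (x : G ⧸ S) = c
    · simp [W, hx, hwn, Real.sq_sqrt (hv0 x).le]
    · simp [W, hx]
  choose p hp hpW using fun c => exists_lp_two_of_clm Λ (hW c)
  obtain ⟨P, hPm, hP⟩ := exists_measurable_glue hS p
  -- On the coset `c`, `f = W g / ω` means `g = ω f / w`, so `Λ f = ∫ conj(p) g` has density
  -- `conj(p) ω / w`.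
  let h : G → ℂ := fun x => starRingEnd ℂ (P x) * ω x / w x
  have hωm : Measurable fun x => (ω x : ℂ) :=
    (Complex.continuous_ofReal.comp ω.continuous').measurable
  have hhm : Measurable h :=
    ((Complex.continuous_conj.measurable.comp hPm).mul hωm).div hwc.measurable
  -- The bound on `h` holds only almost everywhere in each coset; truncation makes it hold at every
  -- point.
  let q : G → ℂ := fun x => if ‖h x‖ ≤ ‖Λ‖ * ω x then h x else 0
  have hqm : Measurable q := Measurable.ite
    (measurableSet_le hhm.norm (ω.continuous'.measurable.const_mul _)) hhm measurable_const
  have hq : IsDominated ω q := by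
    refine ⟨hqm, ‖Λ‖, fun x => ?_⟩
    by_cases hx : ‖h x‖ ≤ ‖Λ‖ * ω x
    · simp [q, hx]
    · simpa [q, hx] using mul_nonneg (norm_nonneg Λ) (ω.pos x).le
  have hqh (c : G ⧸ S) : ∀ᵐ x : G ∂haar, (x : G ⧸ S) = c →
      q x = starRingEnd ℂ (p c x) * ω x / w x := by
    filter_upwards [hP c, hpW c] with x h1 h2 hx
    have h3 : W c x = w x := Set.indicator_of_mem (s := {x : G | (x : G ⧸ S) = c}) hx w
    rw [h3] at h2
    have h4 : ‖h x‖ ≤ ‖Λ‖ * ω x := by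
      simp only [h, h1 hx, norm_div, norm_mul, RCLike.norm_conj, Complex.norm_real,
        Real.norm_eq_abs, abs_of_pos (ω.pos x)]
      rw [div_le_iff₀ (norm_pos_iff.2 (hw0 x)), mul_right_comm]
      exact mul_le_mul_of_nonneg_right (h2 (hw0 x)) (ω.pos x).le
    simp only [q, h4, if_true]
    simp only [h, h1 hx]
  have hωne (x : G) : (ω x : ℂ) ≠ 0 := by exact_mod_cast (ω.pos x).ne'
  have hcoset (c : G ⧸ S) (f : C_c(G, ℂ)) (hf : ∀ x : G, (x : G ⧸ S) ≠ c → f x = 0) :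
      pairing hq (ofCc ω f) = Λ (ofCc ω f) := by
    have hω := ω.continuous'
    let g : C_c(G, ℂ) := ⟨⟨fun x => ω x / w x * f x, by
      have : Continuous fun x => (ω x : ℂ) / w x := by
        exact (Complex.continuous_ofReal.comp hω).div hwc hw0
      exact this.mul f.continuous⟩, f.hasCompactSupport.mul_left⟩
    have hg : MemLp g 2 haar := g.continuous.memLp_of_hasCompactSupport g.hasCompactSupport
    have hfg : (ofCc ω f : G → ℂ) =ᵐ[haar] fun x => (ω x : ℂ)⁻¹ * (W c x * g x) := by
      filter_upwards [coeFn_ofCc (ω := ω) f] with x hx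
      rw [hx]
      change f x = (ω x : ℂ)⁻¹ * (W c x * (ω x / w x * f x))
      by_cases hxc : (x : G ⧸ S) = c
      · rw [show W c x = w x from Set.indicator_of_mem (s := {x : G | (x : G ⧸ S) = c}) hxc w]
        have := hωne x
        have := hw0 x
        field_simp
      · simp [hf x hxc]
    rw [hp c g _ hg hfg, pairing_ofCc]
    refine integral_congr_ae ?_
    filter_upwards [hqh c] with x hx
    change q x * f x = starRingEnd ℂ (p c x) * (ω x / w x * f x)
    by_cases hxc : (x : G ⧸ S) = c
    · rw [hx hxc]
      ring
    · simp [hf x hxc]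
  refine ⟨q, hq, clm_ext fun f => ?_⟩
  have hdisc := QuotientGroup.discreteTopology hS
  -- A compact support meets finitely many cosets of the open subgroup, so `f` is a finite sum of
  -- functions each living on one coset.
  have hfin : ((QuotientGroup.mk : G → G ⧸ S) '' tsupport f).Finite :=
    (f.hasCompactSupport.isCompact.image QuotientGroup.continuous_mk).finite_of_discrete
  let F (c : G ⧸ S) : C_c(G, ℂ) :=
    ⟨⟨{x : G | (x : G ⧸ S) = c}.indicator f, f.continuous.indicator fun x hx => by
      simp [(isClopen_coset hS c).frontier_eq] at hx⟩,
      f.hasCompactSupport.mono' (by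
        refine Set.Subset.trans ?_ (subset_tsupport f)
        change Function.support ({x : G | (x : G ⧸ S) = c}.indicator f) ⊆ _
        rw [Set.support_indicator]
        exact Set.inter_subset_right)⟩
  have hF (c : G ⧸ S) (x : G) : F c x = {x : G | (x : G ⧸ S) = c}.indicator f x := rfl
  have hsum : f = ∑ c ∈ hfin.toFinset, F c := by
    ext x
    rw [CompactlySupportedContinuousMap.sum_apply]
    simp only [hF]
    rw [Finset.sum_eq_single (x : G ⧸ S)]
    · simp
    · intro c _ hc
      exact Set.indicator_of_notMem (s := {x : G | (x : G ⧸ S) = c}) (fun h => hc h.symm) _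
    · intro hx
      have : x ∉ tsupport f := fun h => hx (hfin.mem_toFinset.2 ⟨x, h, rfl⟩)
      simp [image_eq_zero_of_notMem_tsupport this]
  rw [hsum, _root_.map_sum, _root_.map_sum, _root_.map_sum]
  refine Finset.sum_congr rfl fun c _ => hcoset c (F c) fun x hx => ?_
  exact (hF c x).trans (Set.indicator_of_notMem (s := {x : G | (x : G ⧸ S) = c}) hx _)

end WeightedL1

/-! ### Change of variables for dominated Borel functions -/

section Substitution

variable {X Y : Type*} [Group X] [TopologicalSpace X] [IsTopologicalGroup X]
  [LocallyCompactSpace X] [T2Space X] [MeasurableSpace X] [BorelSpace X]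
  [Group Y] [TopologicalSpace Y] [IsTopologicalGroup Y]
  [LocallyCompactSpace Y] [T2Space Y] [MeasurableSpace Y] [BorelSpace Y]
  {ω : Weight X} {ω' : Weight Y}

theorem IsDominated.comp {q : Y → ℂ} (hq : IsDominated ω' q) {θ : X → Y} (hθ : Continuous θ)
    (h : ∀ x, ω' (θ x) ≤ ω x) : IsDominated ω fun x => q (θ x) := by
  obtain ⟨C, hC⟩ := hq.2
  refine ⟨hq.1.comp hθ.measurable, |C|, fun x => ?_⟩
  calc ‖q (θ x)‖ ≤ C * ω' (θ x) := hC _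
    _ ≤ |C| * ω' (θ x) := mul_le_mul_of_nonneg_right (le_abs_self C) (ω'.pos _).le
    _ ≤ |C| * ω x := mul_le_mul_of_nonneg_left (h x) (abs_nonneg C)

namespace WeightedL1

/-- A change of variables which is valid for continuous functions with compact support is valid for
dominated functions. -/
theorem pairing_comp_ofCc {θ : X → Y} (hθ : Continuous θ) {c : ℂ}
    {k : C_c(X, ℂ)} {f : WeightedL1 ω'}
    (hk : ∀ φ : C_c(Y, ℂ), ∫ x, φ (θ x) * k x ∂haar = c * pairing (φ.isDominated ω') f)
    {q : Y → ℂ} (hq : IsDominated ω' q) (hr : IsDominated ω fun x => q (θ x)) :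
    pairing hr (ofCc ω k) = c * pairing hq f := by
  have e (φ : Y → ℂ) : (fun y => φ y * (c * f y)) = fun y => c * (φ y * f y) := by
    ext y
    ring
  have hi : Integrable (fun x => q (θ x) * k x) haar := by
    refine (integrable_dominated_mul hr (ofCc ω k)).congr ?_
    filter_upwards [coeFn_ofCc (ω := ω) k] with x hx
    rw [hx]
  have hi' : Integrable (fun y => q y * (c * f y)) haar :=
    (e q).symm ▸ (integrable_dominated_mul hq f).const_mul c
  have hk' (φ : C_c(Y, ℂ)) : ∫ x, φ (θ x) * k x ∂haar = ∫ y, φ y * (c * f y) ∂haar := by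
    rw [e φ, integral_const_mul]
    exact hk φ
  rw [pairing_ofCc, pairing_apply,
    integral_comp_mul_eq_of_forall_compactlySupported (n := haar) hθ k.integrable
      (f.integrable.const_mul c) hk' hq.1 hi hi', e q, integral_const_mul]

end WeightedL1

end Substitution

/-! ### Convolution products expressed on `G × G` and `G × G × G` -/

section Convolution

variable {G : Type*} [Group G] [TopologicalSpace G] [IsTopologicalGroup G]
  [LocallyCompactSpace G] [T2Space G] [MeasurableSpace G] [BorelSpace G] {ω : Weight G}

namespace WeightedL1

theorem pairing_translate_ofCc {q : G → ℂ} (hq : IsDominated ω q) (x : G) (φ : C_c(G, ℂ)) :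
    pairing hq (translate x (ofCc ω φ)) = ∫ y, q (x * y) * φ y ∂haar := by
  rw [translate_ofCc, pairing_ofCc, ← integral_mul_left_eq_self _ x]
  simp

theorem pairing_ofCc_mul_ofCc {q : G → ℂ} (hq : IsDominated ω q) (φ ψ : C_c(G, ℂ)) :
    pairing hq (ofCc ω φ * ofCc ω ψ) = ∫ x, φ x * ∫ y, q (x * y) * ψ y ∂haar ∂haar := by
  simp only [clm_ofCc_mul, pairing_translate_ofCc]

variable [MeasurableSpace (G × G)] [BorelSpace (G × G)]

theorem tmul_translate_left (x : G) (φ ψ : C_c(G, ℂ)) :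
    tmul ω ω (translate x (ofCc ω φ)) (ofCc ω ψ) =
      translate (x, 1) (ofCc (ω.prod ω) (tensor φ ψ)) := by
  rw [translate_ofCc, translate_ofCc, tmul_ofCc]
  congr 1
  ext t
  simp

theorem tmul_translate_right (x : G) (φ ψ : C_c(G, ℂ)) :
    tmul ω ω (ofCc ω φ) (translate x (ofCc ω ψ)) =
      translate (1, x) (ofCc (ω.prod ω) (tensor φ ψ)) := by
  rw [translate_ofCc, translate_ofCc, tmul_ofCc]
  congr 1
  ext t
  simp

/-- Translating one tensor factor is translation by `(x, 1)` in `G × G`. Convolution being an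
integral of translates, it comes out as an outer integral, while the inner one stays over `G × G`;
no Fubini theorem for the Borel function `q` is needed. -/
theorem pairing_tmul_mul_left {q : G × G → ℂ} (hq : IsDominated (ω.prod ω) q)
    (a b c : C_c(G, ℂ)) :
    pairing hq (tmul ω ω (ofCc ω a * ofCc ω b) (ofCc ω c)) =
      ∫ x, a x * ∫ p : G × G, q (x * p.1, p.2) * (b p.1 * c p.2) ∂haar ∂haar := by
  have h := clm_ofCc_mul (pairing hq ∘L (tmul ω ω).flip (ofCc ω c)) a (ofCc ω b)
  simp only [ContinuousLinearMap.comp_apply, ContinuousLinearMap.flip_apply,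
    tmul_translate_left, pairing_translate_ofCc] at h
  simpa only [Prod.mul_def, one_mul, tensor_apply] using h

theorem pairing_tmul_mul_right {q : G × G → ℂ} (hq : IsDominated (ω.prod ω) q)
    (a b c : C_c(G, ℂ)) :
    pairing hq (tmul ω ω (ofCc ω a) (ofCc ω b * ofCc ω c)) =
      ∫ y, b y * ∫ p : G × G, q (p.1, y * p.2) * (a p.1 * c p.2) ∂haar ∂haar := by
  have h := clm_ofCc_mul (pairing hq ∘L tmul ω ω (ofCc ω a)) b (ofCc ω c)
  simp only [ContinuousLinearMap.comp_apply,
    tmul_translate_right, pairing_translate_ofCc] at h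
  simpa only [Prod.mul_def, one_mul, tensor_apply] using h

theorem isDominated_mul {h : G → ℂ} (hh : IsDominated ω h) :
    IsDominated (ω.prod ω) fun t => h (t.1 * t.2) :=
  hh.comp (θ := fun t : G × G => t.1 * t.2) (by fun_prop) fun t => ω.mul_le' t.1 t.2

theorem isDominated_mul_swap {h : G → ℂ} (hh : IsDominated ω h) :
    IsDominated (ω.prod ω) fun t => h (t.2 * t.1) :=
  hh.comp (θ := fun t : G × G => t.2 * t.1) (by fun_prop) fun t =>
    (ω.mul_le' t.2 t.1).trans_eq (mul_comm _ _)

theorem isDominated_swap {q : G × G → ℂ} (hq : IsDominated (ω.prod ω) q) :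
    IsDominated (ω.prod ω) fun t => q (t.2, t.1) :=
  hq.comp (θ := fun t : G × G => (t.2, t.1)) (by fun_prop) fun t => (mul_comm _ _).le

/-- The product of functions of two variables with a tensor product, as a function with compact
support. -/
theorem exists_cc_mul_tensor {X Y : Type*} [TopologicalSpace X] [TopologicalSpace Y] [T2Space X]
    [T2Space Y] {f : X × Y → ℂ} (hf : Continuous f) (φ : C_c(X, ℂ)) (ψ : C_c(Y, ℂ)) :
    ∃ k : C_c(X × Y, ℂ), ∀ t, k t = f t * (φ t.1 * ψ t.2) :=
  ⟨⟨⟨fun t => f t * tensor φ ψ t, by fun_prop⟩, (tensor φ ψ).hasCompactSupport.mul_left⟩,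
    fun _ => rfl⟩

/-- With `h` replaced by a `C_c` function this is the iterated-integral formula for Haar measure;
`pairing_comp_ofCc` carries it over to the Borel function `h`. -/
theorem pairing_comp_mul_tensor {h : G → ℂ} (hh : IsDominated ω h) (a b : C_c(G, ℂ)) :
    pairing (isDominated_mul hh) (ofCc _ (tensor a b)) =
      haarProdFactor G G * pairing hh (ofCc ω a * ofCc ω b) := by
  refine pairing_comp_ofCc (θ := fun t : G × G => t.1 * t.2) (by fun_prop)
    (fun φ => ?_) hh _
  obtain ⟨k, hk⟩ := exists_cc_mul_tensor (f := fun t : G × G => φ (t.1 * t.2)) (by fun_prop) a b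
  have := integral_haar_prod k
  simp only [hk] at this
  simp only [tensor_apply]
  rw [this, pairing_ofCc_mul_ofCc]
  simp only [← integral_const_mul, mul_left_comm]

theorem pairing_comp_mul_swap_tensor {h : G → ℂ} (hh : IsDominated ω h) (a b : C_c(G, ℂ)) :
    pairing (isDominated_mul_swap hh) (ofCc _ (tensor a b)) =
      haarProdFactor G G * pairing hh (ofCc ω b * ofCc ω a) := by
  refine pairing_comp_ofCc (θ := fun t : G × G => t.2 * t.1) (by fun_prop)
    (fun φ => ?_) hh _
  obtain ⟨k, hk⟩ := exists_cc_mul_tensor (f := fun t : G × G => φ (t.2 * t.1)) (by fun_prop) a b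
  have := integral_haar_prod_symm k
  simp only [hk] at this
  simp only [tensor_apply]
  rw [this, pairing_ofCc_mul_ofCc]
  simp only [← integral_const_mul]
  congr 3
  ext x
  congr 1
  ext y
  ring

theorem pairing_swap_tensor {q : G × G → ℂ} (hq : IsDominated (ω.prod ω) q) (a b : C_c(G, ℂ)) :
    pairing (isDominated_swap hq) (ofCc _ (tensor a b)) =
      pairing hq (ofCc _ (tensor b a)) := by
  rw [← one_mul (pairing hq (ofCc (ω.prod ω) (tensor b a)))]
  refine pairing_comp_ofCc (θ := fun t : G × G => (t.2, t.1)) (by fun_prop)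
    (fun φ => ?_) hq _
  obtain ⟨k, hk⟩ := exists_cc_mul_tensor (f := fun t : G × G => φ (t.2, t.1)) (by fun_prop) a b
  obtain ⟨k', hk'⟩ := exists_cc_mul_tensor (f := φ) (by fun_prop) b a
  have h1 := integral_haar_prod_symm k
  have h2 := integral_haar_prod k'
  simp only [hk] at h1
  simp only [hk'] at h2
  simp only [pairing_ofCc, tensor_apply]
  rw [h1, h2, one_mul]
  simp only [mul_comm (b _)]

variable [MeasurableSpace (G × G × G)] [BorelSpace (G × G × G)]

theorem isDominated_mul_left {q : G × G → ℂ} (hq : IsDominated (ω.prod ω) q) :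
    IsDominated (ω.prod (ω.prod ω)) fun t => q (t.1 * t.2.1, t.2.2) :=
  hq.comp (θ := fun t : G × G × G => (t.1 * t.2.1, t.2.2)) (by fun_prop) fun t => by
    simp only [Weight.prod_apply, ← mul_assoc]
    exact mul_le_mul_of_nonneg_right (ω.mul_le' _ _) (ω.pos _).le

theorem isDominated_mul_right {q : G × G → ℂ} (hq : IsDominated (ω.prod ω) q) :
    IsDominated (ω.prod (ω.prod ω)) fun t => q (t.1, t.2.1 * t.2.2) :=
  hq.comp (θ := fun t : G × G × G => (t.1, t.2.1 * t.2.2)) (by fun_prop) fun t => by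
    simp only [Weight.prod_apply]
    exact mul_le_mul_of_nonneg_left (ω.mul_le' _ _) (ω.pos _).le

theorem isDominated_rotate {q : G × G → ℂ} (hq : IsDominated (ω.prod ω) q) :
    IsDominated (ω.prod (ω.prod ω)) fun t => q (t.2.1, t.2.2 * t.1) :=
  hq.comp (θ := fun t : G × G × G => (t.2.1, t.2.2 * t.1)) (by fun_prop) fun t => by
    simp only [Weight.prod_apply]
    refine (mul_le_mul_of_nonneg_left (ω.mul_le' _ _) (ω.pos _).le).trans_eq ?_
    ring

/-- This and the next two results translate the three terms of quasi-additivity into those of the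
derivation identity, all with the same factor, which then cancels. -/
theorem pairing_mul_left_tensor {q : G × G → ℂ} (hq : IsDominated (ω.prod ω) q)
    (a b c : C_c(G, ℂ)) :
    pairing (isDominated_mul_left hq) (ofCc _ (tensor a (tensor b c))) =
      haarProdFactor G (G × G) * pairing hq (tmul ω ω (ofCc ω a * ofCc ω b) (ofCc ω c)) := by
  refine pairing_comp_ofCc (θ := fun t : G × G × G => (t.1 * t.2.1, t.2.2)) (by fun_prop)
    (fun φ => ?_) hq _
  obtain ⟨k, hk⟩ := exists_cc_mul_tensor (f := fun t : G × G × G => φ (t.1 * t.2.1, t.2.2))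
    (by fun_prop) a (tensor b c)
  have := integral_haar_prod k
  simp only [hk] at this
  simp only [tensor_apply] at this ⊢
  rw [this, pairing_tmul_mul_left]
  simp only [← integral_const_mul, mul_left_comm]

theorem pairing_mul_right_tensor {q : G × G → ℂ} (hq : IsDominated (ω.prod ω) q)
    (a b c : C_c(G, ℂ)) :
    pairing (isDominated_mul_right hq) (ofCc _ (tensor a (tensor b c))) =
      haarProdFactor G (G × G) * pairing hq (tmul ω ω (ofCc ω a) (ofCc ω b * ofCc ω c)) := by
  refine pairing_comp_ofCc (θ := fun t : G × G × G => (t.1, t.2.1 * t.2.2)) (by fun_prop)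
    (fun φ => ?_) hq _
  obtain ⟨k, hk⟩ := exists_cc_mul_tensor (f := fun t : G × G × G => φ (t.1, t.2.1 * t.2.2))
    (by fun_prop) a (tensor b c)
  have := integral_haar_prod_triple_snd k
  simp only [hk] at this
  simp only [tensor_apply] at this ⊢
  rw [this, pairing_tmul_mul_right]
  simp only [← integral_const_mul]
  congr 3
  ext x
  congr 1
  ext y
  ring

theorem pairing_rotate_tensor {q : G × G → ℂ} (hq : IsDominated (ω.prod ω) q)
    (a b c : C_c(G, ℂ)) :
    pairing (isDominated_rotate hq) (ofCc _ (tensor a (tensor b c))) =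
      haarProdFactor G (G × G) * pairing hq (tmul ω ω (ofCc ω b) (ofCc ω c * ofCc ω a)) := by
  refine pairing_comp_ofCc (θ := fun t : G × G × G => (t.2.1, t.2.2 * t.1)) (by fun_prop)
    (fun φ => ?_) hq _
  obtain ⟨k, hk⟩ := exists_cc_mul_tensor (f := fun t : G × G × G => φ (t.2.1, t.2.2 * t.1))
    (by fun_prop) a (tensor b c)
  have := integral_haar_prod_triple_trd k
  simp only [hk] at this
  simp only [tensor_apply] at this ⊢
  rw [this, pairing_tmul_mul_right]
  simp only [← integral_const_mul]
  congr 3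
  ext x
  congr 1
  ext y
  ring

end WeightedL1

end Convolution

/-! ### Bilinear forms as functions on `G × G`, and the dictionary for derivations -/

section BilinearForms

variable {G : Type*} [Group G] [TopologicalSpace G] [IsTopologicalGroup G]
  [LocallyCompactSpace G] [T2Space G] [MeasurableSpace G] [BorelSpace G] {ω : Weight G}

namespace WeightedL1

theorem norm_pairing_le {q : G → ℂ} (hq : IsDominated ω q) {C : ℝ} (hC : 0 ≤ C)
    (h : ∀ x, ‖q x‖ ≤ C * ω x) : ‖pairing hq‖ ≤ C := by
  refine ContinuousLinearMap.opNorm_le_bound _ hC fun f => ?_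
  rw [norm_eq f, ← integral_const_mul]
  refine norm_integral_le_of_norm_le (f.integrable_weight.const_mul C) (.of_forall fun x => ?_)
  rw [norm_mul, ← mul_assoc]
  exact mul_le_mul_of_nonneg_right (h x) (norm_nonneg _)

variable [MeasurableSpace (G × G)] [BorelSpace (G × G)]

/-- The function `(x, y) ↦ B(L_x u, L_y u)` represents the form `(f, g) ↦ B(f * u, g * u)`. -/
theorem exists_pairing_eq_mul_right (B : WeightedL1 ω →L[ℂ] WeightedL1 ω →L[ℂ] ℂ)
    (u : WeightedL1 ω) : ∃ Λ : WeightedL1 (ω.prod ω) →L[ℂ] ℂ,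
      ‖Λ‖ ≤ ‖B‖ * ‖u‖ ^ 2 ∧ ∀ φ ψ : C_c(G, ℂ), Λ (ofCc _ (tensor φ ψ)) =
        haarProdFactor G G * B (ofCc ω φ * u) (ofCc ω ψ * u) := by
  let q : G × G → ℂ := fun t => B (translate t.1 u) (translate t.2 u)
  have hu := continuous_translate u
  have hc : Continuous q :=
    (B.continuous.comp (hu.comp continuous_fst)).clm_apply (hu.comp continuous_snd)
  have hb (t : G × G) : ‖q t‖ ≤ ‖B‖ * ‖u‖ ^ 2 * ω.prod ω t := by
    calc ‖q t‖ ≤ ‖B‖ * ‖translate t.1 u‖ * ‖translate t.2 u‖ := B.le_opNorm₂ _ _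
      _ ≤ ‖B‖ * (ω t.1 * ‖u‖) * (ω t.2 * ‖u‖) := by
        have := (ω.pos t.1).le
        gcongr
        · exact norm_translate_le _ _
        · exact norm_translate_le _ _
      _ = ‖B‖ * ‖u‖ ^ 2 * ω.prod ω t := by
        rw [Weight.prod_apply]
        ring
  have hq : IsDominated (ω.prod ω) q := ⟨hc.measurable, _, hb⟩
  refine ⟨pairing hq, norm_pairing_le hq (by positivity) hb, fun φ ψ => ?_⟩
  obtain ⟨k, hk⟩ := exists_cc_mul_tensor hc φ ψ
  have h := integral_haar_prod k
  have h1 := clm_ofCc_mul (B.flip (ofCc ω ψ * u)) φ u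
  have h2 (x : G) := clm_ofCc_mul (B (translate x u)) ψ u
  simp only [ContinuousLinearMap.flip_apply, h2, ← integral_const_mul] at h1
  simp only [hk] at h
  rw [pairing_ofCc, h1]
  simp only [tensor_apply]
  rw [h]
  congr 3
  ext x
  congr 1
  ext y
  exact (mul_left_comm _ _ _).trans (congrArg _ (mul_comm _ _)) |>.trans (by ring)

/-- Every bounded bilinear form on `L¹(G, ω)` comes from a functional on `L¹(G × G, ω ⊗ ω)`. -/
theorem exists_clm_tmul_eq (B : WeightedL1 ω →L[ℂ] WeightedL1 ω →L[ℂ] ℂ) :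
    ∃ Λ : WeightedL1 (ω.prod ω) →L[ℂ] ℂ, ∀ f g, Λ (tmul ω ω f g) = B f g := by
  have hκ : (haarProdFactor G G : ℂ) ≠ 0 := by exact_mod_cast (haarProdFactor_pos G G).ne'
  choose! u hu using fun U (hU : U ∈ 𝓝 (1 : G)) => exists_isMollifier hU
  choose Λ hΛ hΛ' using fun U => exists_pairing_eq_mul_right B (ofCc ω (u U))
  have hω2 : {x : G | ω x ≤ 2} ∈ 𝓝 (1 : G) := by
    have := ω.continuous'.tendsto 1
    rw [ω.map_one'] at this
    exact (this.eventually_lt_const (by norm_num : (1 : ℝ) < 2)).mono fun x hx => hx.le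
  have hev : ∀ᶠ U in smallNhdsOne G, ‖Λ U‖ ≤ ‖B‖ * 2 ^ 2 := by
    filter_upwards [eventually_smallNhdsOne hω2] with U ⟨hU, hU2⟩
    refine (hΛ U).trans ?_
    gcongr
    exact norm_ofCc_le_two (hu U hU) hU2
  -- The functionals `Λ U` are eventually bounded, so Banach–Alaoglu gives a weak-* limit along an
  -- ultrafilter. Since `f * u → f`, this limit takes the value `κ B(φ, ψ)` on `φ ⊗ ψ`, where `κ` is
  -- `haarProdFactor G G`.
  let F := Ultrafilter.of (smallNhdsOne G)
  have hF : (F : Filter (Set G)) ≤ smallNhdsOne G := Ultrafilter.of_le _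
  let Λ' : Set G → WeakDual ℂ (WeightedL1 (ω.prod ω)) := fun U => StrongDual.toWeakDual (Λ U)
  have hmem : ∀ᶠ U in (F : Filter (Set G)), Λ' U ∈
      WeakDual.toStrongDual ⁻¹' Metric.closedBall (0 : StrongDual ℂ (WeightedL1 (ω.prod ω)))
        (‖B‖ * 2 ^ 2) :=
    (hev.filter_mono hF).mono fun U hU => by simpa [Λ'] using hU
  obtain ⟨L, -, hL⟩ := (WeakDual.isCompact_closedBall (𝕜 := ℂ)
    (0 : StrongDual ℂ (WeightedL1 (ω.prod ω))) (‖B‖ * 2 ^ 2)).ultrafilter_le_nhds'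
      (F.map Λ') hmem
  have hL' : Filter.Tendsto Λ' F (𝓝 L) := hL
  have key (φ ψ : C_c(G, ℂ)) : WeakDual.toStrongDual L (ofCc _ (tensor φ ψ)) =
      haarProdFactor G G * B (ofCc ω φ) (ofCc ω ψ) := by
    have h1 := ((WeakDual.eval_continuous (ofCc (ω.prod ω) (tensor φ ψ))).tendsto L).comp hL'
    have h2 (f : WeightedL1 ω) := (tendsto_mul_mollifier hu f).mono_left hF
    have h3 := ((B.continuous₂.tendsto _).comp ((h2 (ofCc ω φ)).prodMk_nhds
      (h2 (ofCc ω ψ)))).const_mul (haarProdFactor G G : ℂ)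
    refine tendsto_nhds_unique (h1.congr fun U => ?_) h3
    exact hΛ' U φ ψ
  refine ⟨(haarProdFactor G G : ℂ)⁻¹ • WeakDual.toStrongDual L, fun f g => ?_⟩
  have e : (ContinuousLinearMap.compL ℂ (WeightedL1 ω) _ ℂ
      ((haarProdFactor G G : ℂ)⁻¹ • WeakDual.toStrongDual L)) ∘L tmul ω ω = B := by
    refine clm_ext fun φ => clm_ext fun ψ => ?_
    change ((haarProdFactor G G : ℂ)⁻¹ • WeakDual.toStrongDual L)
      (tmul ω ω (ofCc ω φ) (ofCc ω ψ)) = _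
    rw [tmul_ofCc, _root_.smul_apply, key, smul_eq_mul, inv_mul_cancel_left₀ hκ]
  rw [← e]
  rfl

/-- The map `L¹(G, ω) → L¹(G, ω)*` given by a functional on `L¹(G × G, ω ⊗ ω)`. -/
def toDual (Λ : WeightedL1 (ω.prod ω) →L[ℂ] ℂ) :
    WeightedL1 ω →L[ℂ] StrongDual ℂ (WeightedL1 ω) :=
  (ContinuousLinearMap.compL ℂ (WeightedL1 ω) (WeightedL1 (ω.prod ω)) ℂ Λ) ∘L tmul ω ω

theorem toDual_apply (Λ : WeightedL1 (ω.prod ω) →L[ℂ] ℂ) (f g : WeightedL1 ω) :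
    toDual Λ f g = Λ (tmul ω ω f g) := rfl

theorem exists_toDual_pairing_eq (D : WeightedL1 ω →L[ℂ] StrongDual ℂ (WeightedL1 ω)) :
    ∃ (q : G × G → ℂ) (hq : IsDominated (ω.prod ω) q), toDual (pairing hq) = D := by
  obtain ⟨Λ, hΛ⟩ := exists_clm_tmul_eq D
  obtain ⟨q, hq, rfl⟩ := exists_pairing_eq Λ
  exact ⟨q, hq, by ext f g; exact hΛ f g⟩

/-- Both conditions say that the functional given by `q(x, y) + q(y, x)` is zero, one on tensors and
the other through `pairing_eq_iff`. -/
theorem isCyclicMap_toDual_iff {q : G × G → ℂ} (hq : IsDominated (ω.prod ω) q) :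
    IsCyclicMap (toDual (pairing hq)) ↔
      HaarAE (G × G) fun t => q (t.1, t.2) + q (t.2, t.1) = 0 := by
  have h0 : IsDominated (ω.prod ω) fun _ => (0 : ℂ) := ⟨measurable_const, 0, by simp⟩
  have hs := isDominated_swap hq
  have e (a b : C_c(G, ℂ)) : pairing (hq.add hs) (ofCc _ (tensor a b)) =
      toDual (pairing hq) (ofCc ω a) (ofCc ω b) + toDual (pairing hq) (ofCc ω b) (ofCc ω a) := by
    rw [pairing_add_apply hq hs, pairing_swap_tensor hq, toDual_apply, toDual_apply, tmul_ofCc, tmul_ofCc]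
  have e0 (f) : pairing h0 f = 0 := by simp [pairing_apply]
  refine Iff.trans ?_ (pairing_eq_iff (hq.add hs) h0)
  constructor
  · intro h
    refine clm_ext_tensor fun a b => ?_
    rw [e, e0, h]
  · intro h a b
    have hd := denseRange_ofCc (ω := ω)
    refine hd.induction_on₂ (p := fun a b => toDual (pairing hq) a b + toDual (pairing hq) b a = 0)
      (isClosed_eq (by fun_prop) continuous_const) (fun a b => ?_) a b
    rw [← e, h, e0]

/-- Pairing `h(xy)` with `a ⊗ b` is pairing `h` with `a * b`, up to `haarProdFactor G G`, and
`h(yx)` likewise gives `b * a`. -/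
theorem toDual_eq_iff {q : G × G → ℂ} (hq : IsDominated (ω.prod ω) q) {h : G → ℂ}
    (hh : IsDominated ω h) :
    (∀ a b, toDual (pairing hq) a b =
        haarProdFactor G G * (pairing hh (a * b) - pairing hh (b * a))) ↔
      HaarAE (G × G) fun t => q t = h (t.1 * t.2) - h (t.2 * t.1) := by
  have h1 := isDominated_mul hh
  have h2 := isDominated_mul_swap hh
  have e (a b : C_c(G, ℂ)) : pairing (h1.sub h2) (ofCc _ (tensor a b)) = haarProdFactor G G *
      (pairing hh (ofCc ω a * ofCc ω b) - pairing hh (ofCc ω b * ofCc ω a)) := by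
    rw [pairing_sub_apply h1 h2, pairing_comp_mul_tensor hh, pairing_comp_mul_swap_tensor hh, mul_sub]
  refine Iff.trans ?_ (pairing_eq_iff hq (h1.sub h2))
  constructor
  · intro h
    refine clm_ext_tensor fun a b => ?_
    rw [e, ← h, toDual_apply, tmul_ofCc]
  · intro h a b
    have hd := denseRange_ofCc (ω := ω)
    refine hd.induction_on₂ (p := fun a b => toDual (pairing hq) a b =
        haarProdFactor G G * (pairing hh (a * b) - pairing hh (b * a)))
      (isClosed_eq (by fun_prop) (by fun_prop)) (fun a b => ?_) a b
    rw [← e, ← h, toDual_apply, tmul_ofCc]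

/-- The two sides of the quasi-additivity identity define functionals on the weighted `L¹` of `G × G
× G`. On `a ⊗ (b ⊗ c)` they are the two sides of the derivation identity times one nonzero constant,
and such tensors determine a functional. -/
theorem isDualDerivation_toDual_iff {q : G × G → ℂ} (hq : IsDominated (ω.prod ω) q) :
    IsDualDerivation (toDual (pairing hq)) ↔ IsQuasiAdditive q := by
  let _ : MeasurableSpace (G × G × G) := borel _
  have : BorelSpace (G × G × G) := ⟨rfl⟩
  have hκ : (haarProdFactor G (G × G) : ℂ) ≠ 0 := by
    exact_mod_cast (haarProdFactor_pos G (G × G)).ne'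
  have h1 := isDominated_mul_left hq
  have h2 := isDominated_mul_right hq
  have h3 := isDominated_rotate hq
  rw [IsQuasiAdditive, and_iff_right (isBorel_iff.2 hq.1)]
  refine Iff.trans ?_ (pairing_eq_iff h1 (h2.add h3))
  let D := toDual (pairing hq)
  have e1 (a b c : C_c(G, ℂ)) : pairing h1 (ofCc _ (tensor a (tensor b c))) =
      haarProdFactor G (G × G) * D (ofCc ω a * ofCc ω b) (ofCc ω c) :=
    pairing_mul_left_tensor hq a b c
  have e2 (a b c : C_c(G, ℂ)) : pairing (h2.add h3) (ofCc _ (tensor a (tensor b c))) =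
      haarProdFactor G (G × G) * (D (ofCc ω a) (ofCc ω b * ofCc ω c) +
        D (ofCc ω b) (ofCc ω c * ofCc ω a)) := by
    rw [pairing_add_apply h2 h3, pairing_mul_right_tensor hq, pairing_rotate_tensor hq, mul_add]
    rfl
  constructor
  · intro h
    -- Tensors are needed twice: for `G × (G × G)`, and then, with `a` fixed, to split `k` on the
    -- inner `G × G`.
    refine clm_ext_tensor fun a k => ?_
    have e : pairing h1 ∘L tmul ω (ω.prod ω) (ofCc ω a) =
        pairing (h2.add h3) ∘L tmul ω (ω.prod ω) (ofCc ω a) := by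
      refine clm_ext_tensor fun b c => ?_
      rw [ContinuousLinearMap.comp_apply, ContinuousLinearMap.comp_apply, tmul_ofCc, e1, e2]
      congr 1
      exact h _ _ _
    have := congrArg (fun S => S (ofCc _ k)) e
    simpa only [ContinuousLinearMap.comp_apply, tmul_ofCc] using this
  · intro h a b c
    have hd := denseRange_ofCc (ω := ω)
    refine hd.induction_on₃ (p := fun a b c => D (a * b) c = D a (b * c) + D b (c * a))
      (isClosed_eq (by fun_prop) (by fun_prop)) (fun a b c => ?_) a b c
    refine mul_left_cancel₀ hκ ?_
    rw [← e1, ← e2, h]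

end WeightedL1

end BilinearForms

/-! ### Locally null sets -/

section LocallyNull

variable {H : Type*} [Group H] [TopologicalSpace H] [IsTopologicalGroup H] [LocallyCompactSpace H]

theorem HaarAE.mono {p r : H → Prop} (hp : HaarAE H p) (h : ∀ x, p x → r x) : HaarAE H r :=
  fun K hK => measure_mono_null
    (Set.inter_subset_inter_left K fun x hx hpx => hx (h x hpx)) (hp K hK)

theorem HaarAE.and {p r : H → Prop} (hp : HaarAE H p) (hr : HaarAE H r) :
    HaarAE H fun x => p x ∧ r x := fun K hK => by
  refine measure_mono_null (fun x hx => ?_) (measure_union_null (hp K hK) (hr K hK))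
  rcases not_and_or.1 hx.1 with h | h
  exacts [Or.inl ⟨h, hx.2⟩, Or.inr ⟨h, hx.2⟩]

theorem HaarAE.of_forall {p : H → Prop} (h : ∀ x, p x) : HaarAE H p := fun _ _ =>
  measure_mono_null (fun x hx => (hx.1 (h x)).elim) measure_empty

variable [T2Space H] [MeasurableSpace H] [BorelSpace H]

theorem isDominated_indicator (ω : Weight H) {N : Set H} (hN : MeasurableSet N) :
    IsDominated ω (N.indicator fun _ => 1) :=
  isDominated_of_norm_le ω (measurable_const.indicator hN) (C := 1) fun x => by
    by_cases hx : x ∈ N <;> simp [hx]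

/-- Turns questions on locally null sets into the vanishing of a functional, which can be tested on
`C_c` functions. -/
theorem haarAE_notMem_iff (ω : Weight H) {N : Set H} (hN : MeasurableSet N) :
    HaarAE H (fun x => x ∉ N) ↔ WeightedL1.pairing (isDominated_indicator ω hN) = 0 := by
  have h0 : IsDominated ω fun _ => (0 : ℂ) := ⟨measurable_const, 0, by simp⟩
  have e0 : WeightedL1.pairing h0 = 0 := by
    ext f
    simp [WeightedL1.pairing_apply]
  rw [← e0, WeightedL1.pairing_eq_iff]
  exact ⟨fun h => h.mono fun x hx => by simp [hx], fun h => h.mono fun x hx hxN => by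
    simp [hxN] at hx⟩

end LocallyNull

/-! ### Preimages of null sets under multiplication, and inner derivations -/

section Main

variable {G : Type*} [Group G] [TopologicalSpace G] [IsTopologicalGroup G]
  [LocallyCompactSpace G] [T2Space G] [MeasurableSpace G] [BorelSpace G]

open WeightedL1

/-- The indicator of `{xy ∈ N}` pairs with `a ⊗ b` as `1_N` pairs with `a * b`, up to a nonzero
factor. If this vanishes for all `a`, `b`, letting `b` run through an approximate identity shows
that `1_N` pairs to zero with every `a`. -/
theorem haarAE_comp_mul_iff (ω : Weight G) {N : Set G} (hN : MeasurableSet N) :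
    (HaarAE (G × G) fun t => t.1 * t.2 ∉ N) ↔ HaarAE G fun x => x ∉ N := by
  let _ : MeasurableSpace (G × G) := borel _
  have : BorelSpace (G × G) := ⟨rfl⟩
  have hκ : (haarProdFactor G G : ℂ) ≠ 0 := by exact_mod_cast (haarProdFactor_pos G G).ne'
  have hd := isDominated_indicator ω hN
  have hm : Continuous fun t : G × G => t.1 * t.2 := by fun_prop
  rw [haarAE_notMem_iff ω hN]
  refine (haarAE_notMem_iff (ω.prod ω) (hm.measurable hN)).trans ?_
  have e (a b : C_c(G, ℂ)) : pairing (isDominated_indicator (ω.prod ω) (hm.measurable hN))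
      (ofCc _ (tensor a b)) = haarProdFactor G G * pairing hd (ofCc ω a * ofCc ω b) :=
    pairing_comp_mul_tensor hd a b
  constructor
  · intro h
    choose! u hu using fun U (hU : U ∈ 𝓝 (1 : G)) => exists_isMollifier hU
    refine clm_ext fun φ => ?_
    have h1 := ((pairing hd).continuous.tendsto _).comp (tendsto_mul_mollifier hu (ofCc ω φ))
    refine tendsto_nhds_unique h1 (tendsto_const_nhds.congr fun U => ?_)
    have h2 := e φ (u U)
    rw [h] at h2
    exact ((mul_eq_zero.1 h2.symm).resolve_left hκ).symm
  · intro h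
    refine clm_ext_tensor fun a b => ?_
    rw [e, h]
    simp

theorem HaarAE.comp_mul_swap (ω : Weight G) {N : Set G} (hN : MeasurableSet N)
    (h : HaarAE G fun x => x ∉ N) : HaarAE (G × G) fun t => t.2 * t.1 ∉ N := by
  let _ : MeasurableSpace (G × G) := borel _
  have : BorelSpace (G × G) := ⟨rfl⟩
  have hd := isDominated_indicator ω hN
  have hm : Continuous fun t : G × G => t.2 * t.1 := by fun_prop
  rw [haarAE_notMem_iff ω hN] at h
  refine (haarAE_notMem_iff (ω.prod ω) (hm.measurable hN)).2 (clm_ext_tensor fun a b => ?_)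
  refine (pairing_comp_mul_swap_tensor hd a b).trans ?_
  rw [h]
  simp

/-- A function in `L^∞(G, 1/ω)` agrees locally almost everywhere with a function bounded by a
multiple of `ω`. -/
theorem exists_isDominated_of_mem_weightedLInfty {ω : Weight G} {h : G → ℂ}
    (hh : h ∈ WeightedLInfty ω) : ∃ (h' : G → ℂ) (N : Set G), IsDominated ω h' ∧
      MeasurableSet N ∧ (HaarAE G fun x => x ∉ N) ∧ ∀ x ∉ N, h' x = h x := by
  obtain ⟨hb, C, hC⟩ := hh
  rw [isBorel_iff] at hb
  have hN : MeasurableSet {x | C < ‖h x‖ / ω x} :=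
    measurableSet_lt measurable_const (hb.norm.div ω.continuous'.measurable)
  refine ⟨{x | C < ‖h x‖ / ω x}ᶜ.indicator h, {x | C < ‖h x‖ / ω x},
    ⟨hb.indicator hN.compl, |C|, fun x => ?_⟩, hN, hC.mono fun x hx => not_lt.2 hx,
    fun x hx => Set.indicator_of_mem (s := {x | C < ‖h x‖ / ω x}ᶜ) hx h⟩
  by_cases hx : x ∈ {x | C < ‖h x‖ / ω x}ᶜ
  · rw [Set.indicator_of_mem hx]
    have h1 : ‖h x‖ / ω x ≤ C := not_lt.1 hx
    exact ((div_le_iff₀ (ω.pos x)).1 h1).trans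
      (mul_le_mul_of_nonneg_right (le_abs_self C) (ω.pos x).le)
  · rw [Set.indicator_of_notMem hx, norm_zero]
    exact mul_nonneg (abs_nonneg C) (ω.pos x).le

variable [MeasurableSpace (G × G)] [BorelSpace (G × G)] {ω : Weight G}

theorem IsDominated.mem_CD_iff {q : G × G → ℂ} (hq : IsDominated (ω.prod ω) q) :
    q ∈ CD ω ↔ IsDualDerivation (toDual (pairing hq)) ∧ IsCyclicMap (toDual (pairing hq)) := by
  rw [isDualDerivation_toDual_iff, isCyclicMap_toDual_iff]
  refine ⟨fun h => ⟨h.1, h.2.1⟩, fun h => ⟨h.1, h.2, ?_⟩⟩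
  obtain ⟨C, hC⟩ := hq.2
  refine ⟨C, ?_⟩
  rintro _ ⟨t, rfl⟩
  exact (div_le_iff₀ ((ω.prod ω).pos t)).2 (hC t)

theorem isDominated_of_mem_CD {q : G × G → ℂ} (hq : q ∈ CD ω) : IsDominated (ω.prod ω) q := by
  obtain ⟨C, hC⟩ := hq.2.2
  exact ⟨isBorel_iff.1 hq.1.1, C, fun t =>
    (div_le_iff₀ ((ω.prod ω).pos t)).1 (hC ⟨t, rfl⟩)⟩

/-- A function `h` in `L^∞(G, 1/ω)` is dominated only off a locally null set `N`. Correcting it on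
`N` is harmless because `xy ∈ N` and `yx ∈ N` are both locally null conditions on `G × G`. -/
theorem isInnerDerivation_toDual_iff {q : G × G → ℂ} (hq : IsDominated (ω.prod ω) q) :
    IsInnerDerivation (toDual (pairing hq)) ↔ IsInnerFunction ω q := by
  have hκ : (haarProdFactor G G : ℂ) ≠ 0 := by exact_mod_cast (haarProdFactor_pos G G).ne'
  constructor
  · rintro ⟨F, hF⟩
    obtain ⟨h, hh, rfl⟩ := exists_pairing_eq F
    -- The inverse compensates for the normalisation of Haar measure on `G × G` in `toDual_eq_iff`.
    have hh' := hh.const_mul (haarProdFactor G G : ℂ)⁻¹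
    refine ⟨_, ⟨isBorel_iff.2 hh'.1, ?_⟩, (toDual_eq_iff hq hh').1 fun a b => ?_⟩
    · obtain ⟨C, hC⟩ := hh'.2
      exact ⟨C, .of_forall fun x => (div_le_iff₀ (ω.pos x)).2 (hC x)⟩
    · rw [hF, pairing_const_mul_apply hh, pairing_const_mul_apply hh, ← mul_sub,
        mul_inv_cancel_left₀ hκ]
  · rintro ⟨h, hh, hqh⟩
    obtain ⟨h', N, hh', hN, hN0, hhN⟩ := exists_isDominated_of_mem_weightedLInfty hh
    refine ⟨(haarProdFactor G G : ℂ) • pairing hh', fun a b => ?_⟩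
    refine ((toDual_eq_iff hq hh').2 ?_ a b).trans (mul_sub _ _ _)
    refine ((hqh.and ((haarAE_comp_mul_iff ω hN).2 hN0)).and (hN0.comp_mul_swap ω hN)).mono ?_
    rintro t ⟨⟨h1, h2⟩, h3⟩
    rw [h1, hhN _ h2, hhN _ h3]

end Main

section Algebra

variable {A : Type*} [NonUnitalNormedRing A] [NormedSpace ℂ A] {D : A →L[ℂ] StrongDual ℂ A}

theorem IsInnerDerivation.isDualDerivation (hD : IsInnerDerivation D) : IsDualDerivation D := by
  obtain ⟨F, hF⟩ := hD
  intro a b c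
  rw [hF, hF, hF, mul_assoc, mul_assoc, mul_assoc]
  ring

theorem IsInnerDerivation.isCyclicMap (hD : IsInnerDerivation D) : IsCyclicMap D := by
  obtain ⟨F, hF⟩ := hD
  intro a b
  rw [hF, hF]
  ring

end Algebra
end

theorem theorem5p6 {G : Type*} [Group G] [TopologicalSpace G] [IsTopologicalGroup G]
    [LocallyCompactSpace G] [T2Space G] [MeasurableSpace G] [BorelSpace G] (ω : Weight G) :
    (CyclicallyAmenable (WeightedL1 ω) ↔ ∀ q ∈ CD ω, IsInnerFunction ω q) ∧
    (∀ q : G × G → ℂ, IsBorel q →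
      (∀ x y z : G, q (x * y, z) = q (x, y * z) + q (y, z * x)) →
      ((HaarAE G fun x => q (x, 1) = 0) ↔
        HaarAE (G × G) fun t => q (t.1, t.2) + q (t.2, t.1) = 0)) := by
  let _ : MeasurableSpace (G × G) := borel _
  have : BorelSpace (G × G) := ⟨rfl⟩
  refine ⟨⟨fun h q hq => ?_, fun h => ?_⟩, fun q hq hadd => ?_⟩
  · have hd := isDominated_of_mem_CD hq
    exact (isInnerDerivation_toDual_iff hd).1 (h.subset (hd.mem_CD_iff.1 hq))
  · refine Set.Subset.antisymm (fun D hD => ?_) fun D hD => ⟨hD.isDualDerivation, hD.isCyclicMap⟩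
    obtain ⟨q, hq, rfl⟩ := WeightedL1.exists_toDual_pairing_eq D
    exact (isInnerDerivation_toDual_iff hq).2 (h q (hq.mem_CD_iff.2 hD))
  · have hm : Measurable fun x : G => q (x, 1) :=
      (isBorel_iff.1 hq).comp (by fun_prop : Continuous fun x : G => (x, (1 : G))).measurable
    have hN : MeasurableSet {x : G | q (x, 1) ≠ 0} := (hm (measurableSet_singleton 0)).compl
    have h := haarAE_comp_mul_iff ω hN
    -- Antisymmetry thus fails at `(x, y)` exactly when `xy` lies in the set where `q(·, e)` is
    -- nonzero.
    have e (x y : G) : q (x * y, 1) = q (x, y) + q (y, x) := by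
      simpa using hadd x y 1
    simpa [e] using h.symm
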